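/- **Setting.** Let $N$ be a lattice of rank $r\ge 2$, $N_\mathbb R=N\otimes\mathbb R$, $M_\mathbb R=N_\mathbb R^*$. Let $\Delta=(n_e)_{e\in E}$ be a finite family of non-zero vectors of $N$ with $|E|\ge 3$ and $\sum_e n_e=0$. Parametrized rational tropical curves $h:\Gamma\to N_\mathbb R$ of degree $\Delta$ have unbounded ends labelled by $E$, the end $e$ having slope $n_e$. A combinatorial type is a tree with ends labelled by $E$ and no bivalent vertex. The cone of a type $C$ is $\mathbb R_{>0}^{b}\times N_\mathbb R$, where $b$ is the number of bounded edges; its coordinates are the lengths of the bounded edges and the position of the vertex adjacent to a fixed end $e_0\in E$. It is top-dimensional, i.e. $b=|E|-3$, exactly when $C$ is trivalent. *Slopes.* Fix integers $l_e\ge 0$ with $\sum_e l_e=|E|+r-3$. Slope constraints are tuples $(L_e)$ of linear subspaces $L_e\subset N_\mathbb R/\langle n_e\rangle$ of codimension $l_e$. Each $L_e$ is given by a Plücker vector $m_{e,1}\wedge\dots\wedge m_{e,l_e}\in\Lambda^{l_e}\langle n_e\rangle^\perp$, where $\langle n_e\rangle^\perp\subset M_\mathbb R$ and $(m_{e,i})_i$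 is a basis of the space of linear forms vanishing on $L_e$. So $(L_e)$ is viewed as a point of the real vector space $\mathbb L=\prod_e\Lambda^{l_e}\langle n_e\rangle^\perp$ with its usual topology. The forms $m_{e,i}$, in some order, give coordinates on $\prod_e Q_e$, where $Q_e=(N_\mathbb R/\langle n_e\rangle)/L_e$. For a top-dimensional type $C$, let $\mathrm{ev}^{(L_e)}_C:\mathbb R^{|E|-3}\times N_\mathbb R\to\prod_eQ_e$ be the linear map sending a curve to the classes of the $h(e)$, and let $m_C^{\mathbb C,(L_e)}=|\det \mathrm{ev}^{(L_e)}_C|$, computed with a basis of the lattice $\mathbb Z^{|E|-3}\times N$ and these coordinates. *The $\omega$-problem.* Let $\omega$ be an alternating bilinear form on $N_\mathbb R$ and $\delta\in N$ such that $\omega(n_{e_0},\delta)\ne0$ unless $\omega(n_{e_0},-)=0$. Choose $r-2$ linearly independent linear forms on $N_\mathbb R$ vanishing at $n_{e_0}$ and $\delta$. Let $\mathrm{ev}^{\omega,e_0}_C:\mathbb R^{|E|-3}\times N_\mathbb R\to \mathbb R^{r-2}\times\prod_{e\ne e_0}\mathbb R$ send a curve to the values of these forms on $h(e_0)$ together with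 the moments $\omega(n_e,h(e))$ for $e\neq e_0$, and let $m_C^{\omega,e_0}=|\det \mathrm{ev}_C^{\omega,e_0}|$. Say that $\omega$ *satisfies the zero-multiplicity hypothesis for* $(L_e)$ if, for every top-dimensional $C$, $$m_C^{\mathbb C,(L_e)}=0\ \Rightarrow\ m_C^{\omega,e_0}=0 .$$ *Refined invariant.* For a trivalent vertex $V$ with outgoing slopes $a_V,b_V,c_V$, put $\pi_V=a_V\wedge b_V\in\Lambda^2N$, and let $K_\omega\subset\Lambda^2N$ be the sublattice spanned by all $\pi_V$ with $\omega(\pi_V)=0$, for trivalent vertices $V$ of types of degree $\Delta$. For a top-dimensional $C$ put $$B_C^{K_\omega}=\prod_V(q^{\pi_V}-q^{-\pi_V})\in\mathbb Z[\Lambda^2N/K_\omega],$$ with $\pi_V$ oriented so that $\omega(\pi_V)>0$ (the factor is $0$ if $\omega(\pi_V)=0$). Fix once and for all, independently of $C$ and $(L_e)$, a bijection between the coordinates of the codomains of $\mathrm{ev}^{(L_e)}$ and $\mathrm{ev}^{\omega,e_0}$. Let $\varepsilon_C=\pm1$ according to whether the orientations of the cone $C$ induced by $\mathrm{ev}_C^{(L_e)}$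 and $\mathrm{ev}_C^{\omega,e_0}$ agree or not, and $\varepsilon_C=0$ if one of these maps is not invertible. Affine subspaces $\mathcal L_e\subset N_\mathbb R/\langle n_e\rangle$ with slopes $L_e$ are *generic* if every curve of degree $\Delta$ with $h(e)\in\mathcal L_e$ for all $e$ is trivalent and of a type $C$ with $m_C^{\mathbb C,(L_e)}\neq0$. Say that $\beta\in \mathbb Z[\Lambda^2N/K_\omega]$ *is the refined invariant* $\mathcal B_\Delta^{K_\omega}(L_e)$ if generic $(\mathcal L_e)$ with slopes $(L_e)$ exist and, for all of them, $$\sum_{\Gamma:\ h(e)\in\mathcal L_e\ \forall e}\varepsilon_\Gamma B_\Gamma^{K_\omega}=\beta ,$$ where the sum is over curves of degree $\Delta$ up to isomorphism. **Theorem.** Suppose $\omega$ satisfies the zero-multiplicity hypothesis for $(L_e^0)$. Then there are a neighbourhood $U$ of $(L_e^0)$ in $\mathbb L$ and an element $\beta\in\mathbb Z[\Lambda^2N/K_\omega]$ such that, for every $(L_e)\in U$, $\omega$ satisfies the zero-multiplicity hypothesis for $(L_e)$ and the refined invariant $\mathcal B_\Delta^{K_\omega}(L_e)$ is $\beta$.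 In other words, the hypothesis persists, and $(L_e)\mapsto\mathcal B_\Delta^{K_\omega}(L_e)$ is defined and constant, near $(L^0_e)$. -/

import Mathlib

open scoped TensorProduct Topology

noncomputable section

namespace Tropical53

/-! ### Labelled trees and combinatorial types -/

/-- The graph `Γ̄` underlying an abstract rational tropical curve whose unbounded ends are labelled
by `E`: a finite tree with vertex set `E ⊕ Fin k` (the `1`-valent vertices are the elements of `E`,
one for each unbounded end; the elements of `Fin k` are the vertices of `Γ`), without bivalent
vertices. -/
structure LabelledTree (E : Type*) where
  k : ℕ
  graph : SimpleGraph (E ⊕ Fin k)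
  isTree : graph.IsTree
  valency_end : ∀ e : E, (graph.neighborSet (Sum.inl e)).ncard = 1
  valency_vertex : ∀ v : Fin k, 3 ≤ (graph.neighborSet (Sum.inr v)).ncard

namespace LabelledTree

variable {E : Type*}

/-- Every vertex of `Γ` is adjacent to precisely three edges. -/
def Trivalent (T : LabelledTree E) : Prop :=
  ∀ v : Fin T.k, (T.graph.neighborSet (Sum.inr v)).ncard = 3

/-- Two labelled trees are isomorphic if they differ by a renaming of the vertices of `Γ`
(the labels of the unbounded ends are kept). -/
def Iso (T T' : LabelledTree E) : Prop :=
  ∃ σ : Fin T.k ≃ Fin T'.k, ∀ x y : E ⊕ Fin T.k,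
    T.graph.Adj x y ↔ T'.graph.Adj (Sum.map id σ x) (Sum.map id σ y)

theorem iso_equivalence : Equivalence (Iso (E := E)) where
  refl _ := ⟨Equiv.refl _, fun x y => by simp⟩
  symm := by
    rintro T T' ⟨σ, h⟩
    refine ⟨σ.symm, fun x y => ?_⟩
    rw [h]
    simp [Sum.map_map]
  trans := by
    rintro T T' T'' ⟨σ, h⟩ ⟨τ, h'⟩
    refine ⟨σ.trans τ, fun x y => ?_⟩
    rw [h, h']
    simp [Sum.map_map]

/-- The bounded edges of `Γ`: the edges that do not end at a `1`-valent vertex. -/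
abbrev BoundedEdge (T : LabelledTree E) : Type _ :=
  {γ : Sym2 (E ⊕ Fin T.k) // γ ∈ T.graph.edgeSet ∧ ∀ e : E, Sum.inl e ∉ γ}

instance [Finite E] (T : LabelledTree E) : Fintype T.BoundedEdge := Fintype.ofFinite _

/-- The edge `γ` lies on the path from `x` to `y`: removing `γ` disconnects `x` from `y`. -/
def Separates (T : LabelledTree E) (γ : Sym2 (E ⊕ Fin T.k)) (x y : E ⊕ Fin T.k) : Prop :=
  ¬ (T.graph.deleteEdges {γ}).Reachable x y

open Classical in
/-- The slope, on an edge `γ`, of the tropical curve of degree `n` with underlying tree `T`, when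
`γ` is oriented away from `x`. By the balancing condition it is the sum of the slopes of the
unbounded ends lying beyond `γ`. -/
def slopeFrom [Fintype E] {N : Type*} [AddCommGroup N] (T : LabelledTree E) (n : E → N)
    (x : E ⊕ Fin T.k) (γ : Sym2 (E ⊕ Fin T.k)) : N :=
  ∑ e ∈ Finset.univ.filter (fun e : E => T.Separates γ x (Sum.inl e)), n e

theorem exists_two_neighbors (T : LabelledTree E) (v : Fin T.k) :
    ∃ p : (E ⊕ Fin T.k) × (E ⊕ Fin T.k),
      T.graph.Adj (Sum.inr v) p.1 ∧ T.graph.Adj (Sum.inr v) p.2 ∧ p.1 ≠ p.2 := by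
  have h := T.valency_vertex v
  have hfin : (T.graph.neighborSet (Sum.inr v)).Finite :=
    Set.finite_of_ncard_ne_zero (by omega)
  obtain ⟨a, b, ha, hb, hab⟩ := (Set.one_lt_ncard_iff hfin).1 (by omega)
  exact ⟨(a, b), ha, hb, hab⟩

/-- Two of the edges adjacent to the vertex `v` (given by their other extremities). -/
def twoNeighbors (T : LabelledTree E) (v : Fin T.k) : (E ⊕ Fin T.k) × (E ⊕ Fin T.k) :=
  (T.exists_two_neighbors v).choose

/-- `a_V`: the outgoing slope at the vertex `v` along the first of two chosen adjacent edges. -/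
def slopeA [Fintype E] {N : Type*} [AddCommGroup N] (T : LabelledTree E) (n : E → N)
    (v : Fin T.k) : N :=
  T.slopeFrom n (Sum.inr v) s(Sum.inr v, (T.twoNeighbors v).1)

/-- `b_V`: the outgoing slope at the vertex `v` along the second of two chosen adjacent edges. -/
def slopeB [Fintype E] {N : Type*} [AddCommGroup N] (T : LabelledTree E) (n : E → N)
    (v : Fin T.k) : N :=
  T.slopeFrom n (Sum.inr v) s(Sum.inr v, (T.twoNeighbors v).2)

end LabelledTree

/-- Combinatorial types of rational tropical curves with ends labelled by `E`. -/
def CombType (E : Type*) : Type _ :=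
  Quotient (⟨LabelledTree.Iso, LabelledTree.iso_equivalence⟩ : Setoid (LabelledTree E))

/-- A labelled tree representing the combinatorial type `C`. -/
def CombType.tree {E : Type*} (C : CombType E) : LabelledTree E :=
  Quotient.out C

/-! ### Parametrized curves and the evaluation map -/

section Curves

variable {E : Type*} [Fintype E] {N : Type*} [AddCommGroup N]

/-- The vector space `N_ℝ`. -/
abbrev RealSpace (N : Type*) [AddCommGroup N] : Type _ := ℝ ⊗[ℤ] N

/-- The inclusion of `N` in `N_ℝ`. -/
def toReal (v : N) : RealSpace N := (1 : ℝ) ⊗ₜ[ℤ] v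

/-- A point of the moduli space of parametrized rational tropical curves in `N_ℝ` with ends
labelled by `E`: a combinatorial type, the lengths of the bounded edges, and the position in `N_ℝ`
of the vertex adjacent to a reference end `e₀`. (The slopes are determined by the degree. A tree
with labelled ends has no automorphism, so each curve is counted once up to isomorphism.) -/
structure Curve (E : Type*) (N : Type*) [AddCommGroup N] where
  type : CombType E
  len : type.tree.BoundedEdge → ℝ
  len_pos : ∀ γ, 0 < len γ
  base : RealSpace N

open Classical in
/-- The position `h(x)` of a vertex `x` of a curve of degree `n` with underlying tree `T`, as a
linear function of the lengths of the bounded edges and the position of the vertex adjacent to the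
reference end `e₀`: one follows the path from `e₀` to `x`.
For `x = Sum.inl e` this is the position of the vertex from which the end `e` emanates,
which is a point of `h(e)`. -/
def position (T : LabelledTree E) (n : E → N) (e₀ : E) (x : E ⊕ Fin T.k) :
    ((T.BoundedEdge → ℝ) × RealSpace N) →ₗ[ℝ] RealSpace N :=
  LinearMap.snd ℝ _ _ +
    ∑ γ ∈ Finset.univ.filter (fun γ : T.BoundedEdge => T.Separates γ.1 (Sum.inl e₀) x),
      ((LinearMap.proj γ).comp (LinearMap.fst ℝ (T.BoundedEdge → ℝ) (RealSpace N))).smulRight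
        (toReal (T.slopeFrom n (Sum.inl e₀) γ.1))

/-- The evaluation of a curve of degree `n` at its unbounded end `e`: a point of `h(e)`. Only its
class modulo `n e` matters. -/
def Curve.eval (Γ : Curve E N) (n : E → N) (e₀ e : E) : RealSpace N :=
  position Γ.type.tree n e₀ (Sum.inl e) (Γ.len, Γ.base)

/-- The composed evaluation map, restricted to the cone of the type `T` and extended linearly,
attached to a finite family of linear forms `φ i` on `N_ℝ`, the form `φ i` being evaluated on the
end `s i`. -/
def composedEval (T : LabelledTree E) (n : E → N) (e₀ : E) {ι : Type*} (s : ι → E)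
    (φ : ι → Module.Dual ℝ (RealSpace N)) :
    ((T.BoundedEdge → ℝ) × RealSpace N) →ₗ[ℝ] (ι → ℝ) :=
  LinearMap.pi fun i => (φ i).comp (position T n e₀ (Sum.inl (s i)))

variable [Module.Free ℤ N] [Module.Finite ℤ N]

/-- A basis of the lattice `ℤ^{bounded edges} × N`, as a basis of its real span. -/
def domainBasis (T : LabelledTree E) (N : Type*) [AddCommGroup N] [Module.Free ℤ N]
    [Module.Finite ℤ N] :
    Module.Basis (T.BoundedEdge ⊕ Fin (Module.finrank ℤ N)) ℝ
      ((T.BoundedEdge → ℝ) × RealSpace N) :=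
  (Pi.basisFun ℝ T.BoundedEdge).prod (Algebra.TensorProduct.basis ℝ (Module.finBasis ℤ N))

open Classical in
/-- The determinant of the composed evaluation map on the cone of type `T`. The columns are
identified with the rows by a bijection depending only on `T` and the index type of the rows: the
sign is defined up to the choice of an orientation of the cone, which is the same for all families
of linear forms with the same index type. It is `0` if dimensions do not match. -/
def evalDet (T : LabelledTree E) (n : E → N) (e₀ : E) {ι : Type*} [Fintype ι] (s : ι → E)
    (φ : ι → Module.Dual ℝ (RealSpace N)) : ℝ :=
  if h : Nonempty (ι ≃ T.BoundedEdge ⊕ Fin (Module.finrank ℤ N)) then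
    ((LinearMap.toMatrix (domainBasis T N) (Pi.basisFun ℝ ι)
      (composedEval T n e₀ s φ)).submatrix id h.some).det
  else 0

/-- The complex multiplicity `|det ev|` on the cone of type `T`. -/
def complexMult (T : LabelledTree E) (n : E → N) (e₀ : E) {ι : Type*} [Fintype ι] (s : ι → E)
    (φ : ι → Module.Dual ℝ (RealSpace N)) : ℝ :=
  |evalDet T n e₀ s φ|

end Curves

/-! ### Slope constraints -/

section Slopes

variable {E : Type*} {N : Type*} [AddCommGroup N]

/-- `⟨n⟩^⊥ ⊆ M_ℝ`: the linear forms on `N_ℝ` vanishing at `n`, i.e. on `N_ℝ/⟨n⟩`. -/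
def perp (n : N) : Submodule ℝ (Module.Dual ℝ (RealSpace N)) :=
  (Submodule.span ℝ {toReal n}).dualAnnihilator

/-- The space `𝕃 = ∏_e Λ^{l_e} ⟨n_e⟩^⊥`. -/
def PluckerSpace (n : E → N) (l : E → ℕ) : Type _ :=
  ∀ e : E, ⋀[ℝ]^(l e) (perp (n e))

/-- The usual topology of the real vector space `𝕃` (finite-dimensional when `E` is finite and `N`
is finitely generated): on each factor the module topology. -/
instance (n : E → N) (l : E → ℕ) : TopologicalSpace (PluckerSpace n l) :=
  @Pi.topologicalSpace E (fun e => ⋀[ℝ]^(l e) (perp (n e)))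
    (fun e => moduleTopology ℝ (⋀[ℝ]^(l e) (perp (n e))))

/-- A tuple `(L_e)` of slopes, where `L_e` has codimension `l e` in `N_ℝ/⟨n_e⟩`, presented by a
basis of the space of linear forms on `N_ℝ/⟨n_e⟩` vanishing on `L_e`. -/
structure Slopes (n : E → N) (l : E → ℕ) where
  form : ∀ e : E, Fin (l e) → perp (n e)
  linearIndependent : ∀ e : E, LinearIndependent ℝ (form e)

namespace Slopes

variable {n : E → N} {l : E → ℕ}

/-- The point of `𝕃` given by the Plücker vectors `m_{e,1} ∧ ⋯ ∧ m_{e,l_e}` of the `L_e`. -/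
def plucker (L : Slopes n l) : PluckerSpace n l :=
  fun e => exteriorPower.ιMulti ℝ (l e) (L.form e)

/-- The preimage in `N_ℝ` of the subspace `L_e ⊆ N_ℝ/⟨n_e⟩`. -/
def space (L : Slopes n l) (e : E) : Submodule ℝ (RealSpace N) :=
  ⨅ i : Fin (l e), LinearMap.ker (L.form e i : Module.Dual ℝ (RealSpace N))

/-- The forms of all the `L_e`, in one family: coordinates on `∏_e Q_e^ℝ`. -/
def forms (L : Slopes n l) (i : Σ e : E, Fin (l e)) : Module.Dual ℝ (RealSpace N) :=
  (L.form i.1 i.2 : Module.Dual ℝ (RealSpace N))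

end Slopes

/-- The rows of the evaluation map of the `ω`-problem: `r - 2` coordinates for the end `e₀`, and the
moment of each other end. This gives the end on which each row is evaluated. -/
def omegaEnd (e₀ : E) {d : ℕ} : Fin d ⊕ {e : E // e ≠ e₀} → E :=
  Sum.elim (fun _ => e₀) (fun e => e.1)

/-- The linear forms of the evaluation map of the `ω`-problem: coordinates `f` on the quotient of
`N_ℝ` by `n_{e₀}` and `δ`, and the forms `ω(n_e, -)` for `e ≠ e₀`. -/
def omegaForm (n : E → N) (ω : LinearMap.BilinForm ℝ (RealSpace N)) (e₀ : E) {d : ℕ}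
    (f : Fin d → Module.Dual ℝ (RealSpace N)) :
    Fin d ⊕ {e : E // e ≠ e₀} → Module.Dual ℝ (RealSpace N) :=
  Sum.elim f (fun e => ω (toReal (n e.1)))

end Slopes

/-! ### Refined multiplicities -/

section Refined

variable {E : Type*} [Fintype E] {N : Type*} [AddCommGroup N]

/-- The bivector `a ∧ b`. -/
def wedge (a b : N) : ⋀[ℤ]^2 N := exteriorPower.ιMulti ℤ 2 ![a, b]

/-- `K_ω`: the sublattice of `Λ² N` spanned by the bivectors `π_V` with `ω(π_V) = 0`, for all
trivalent vertices `V` of rational curves of degree `n`. -/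
def kernelLattice (n : E → N) (ω : LinearMap.BilinForm ℝ (RealSpace N)) :
    Submodule ℤ (⋀[ℤ]^2 N) :=
  Submodule.span ℤ {π | ∃ (T : LabelledTree E) (v : Fin T.k),
    (T.graph.neighborSet (Sum.inr v)).ncard = 3 ∧
    ω (toReal (T.slopeA n v)) (toReal (T.slopeB n v)) = 0 ∧
    π = wedge (T.slopeA n v) (T.slopeB n v)}

/-- The ring `ℤ[Λ² N / K_ω]` of Laurent polynomials. -/
abbrev RefinedRing (n : E → N) (ω : LinearMap.BilinForm ℝ (RealSpace N)) : Type _ :=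
  AddMonoidAlgebra ℤ ((⋀[ℤ]^2 N) ⧸ kernelLattice n ω)

/-- `q^π - q^{-π}` for `π = a ∧ b`, the exponents being taken modulo `K_ω`. -/
def qDiff (n : E → N) (ω : LinearMap.BilinForm ℝ (RealSpace N)) (a b : N) : RefinedRing n ω :=
  AddMonoidAlgebra.single ((kernelLattice n ω).mkQ (wedge a b)) 1 -
    AddMonoidAlgebra.single ((kernelLattice n ω).mkQ (-wedge a b)) 1

open Classical in
/-- The refined multiplicity `B_Γ^{K_ω} = ∏_V (q^{π_V} - q^{-π_V})` of a trivalent type, with `π_V`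
oriented so that `ω(π_V) > 0`. (If `ω(π_V) = 0` the factor vanishes for both orientations.) -/
def refinedMult (T : LabelledTree E) (n : E → N) (ω : LinearMap.BilinForm ℝ (RealSpace N)) :
    RefinedRing n ω :=
  ∏ v : Fin T.k,
    if 0 < ω (toReal (T.slopeA n v)) (toReal (T.slopeB n v)) then
      qDiff n ω (T.slopeA n v) (T.slopeB n v)
    else qDiff n ω (T.slopeB n v) (T.slopeA n v)

variable [Module.Free ℤ N] [Module.Finite ℤ N] {n : E → N} {l : E → ℕ}

/-- The zero-multiplicity hypothesis: on every trivalent type, if the complex multiplicity relative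
to `(L_e)` vanishes, then so does the complex multiplicity of the `ω`-problem. -/
def ZeroMultHyp (L : Slopes n l) (ω : LinearMap.BilinForm ℝ (RealSpace N)) (e₀ : E) {d : ℕ}
    (f : Fin d → Module.Dual ℝ (RealSpace N)) : Prop :=
  letI := Classical.decEq E
  ∀ T : LabelledTree E, T.Trivalent →
    complexMult T n e₀ Sigma.fst L.forms = 0 →
    complexMult T n e₀ (omegaEnd e₀) (omegaForm n ω e₀ f) = 0

/-- The sign `ε` of a type: `+1` or `-1` according to whether the orientations of the cone induced
by the two composed evaluation maps agree, their codomains being identified by `o`. (It is `0` if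
one of the maps is not invertible.) -/
def typeSign (T : LabelledTree E) (L : Slopes n l) (ω : LinearMap.BilinForm ℝ (RealSpace N))
    (e₀ : E) {d : ℕ} (f : Fin d → Module.Dual ℝ (RealSpace N))
    (o : (Σ e : E, Fin (l e)) ≃ Fin d ⊕ {e : E // e ≠ e₀}) : ℤ :=
  (SignType.sign (evalDet T n e₀ Sigma.fst L.forms *
    evalDet T n e₀ (omegaEnd e₀ ∘ o) (omegaForm n ω e₀ f ∘ o)) : ℤ)

/-- The curves of degree `n` such that for each `e` the end `h(e)` lies in the affine subspace
`𝓛_e` with slope `L_e` passing through `x e`. -/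
def solutions (L : Slopes n l) (e₀ : E) (x : E → RealSpace N) : Set (Curve E N) :=
  {Γ | ∀ e : E, Γ.eval n e₀ e - x e ∈ L.space e}

/-- The constraints `𝓛_e = x e + L_e` are generic: they do not lie in the image of a cone which is
not top-dimensional, nor of a cone on which the composed evaluation map is not invertible. -/
def Generic (L : Slopes n l) (e₀ : E) (x : E → RealSpace N) : Prop :=
  ∀ Γ ∈ solutions L e₀ x, Γ.type.tree.Trivalent ∧
    complexMult Γ.type.tree n e₀ Sigma.fst L.forms ≠ 0

/-- The refined count of the curves satisfying the constraints `𝓛_e = x e + L_e`, with multiplicity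
`ε_Γ B_Γ^{K_ω}`. -/
def refinedCount (L : Slopes n l) (ω : LinearMap.BilinForm ℝ (RealSpace N)) (e₀ : E) {d : ℕ}
    (f : Fin d → Module.Dual ℝ (RealSpace N))
    (o : (Σ e : E, Fin (l e)) ≃ Fin d ⊕ {e : E // e ≠ e₀}) (x : E → RealSpace N) :
    RefinedRing n ω :=
  ∑ᶠ Γ ∈ solutions L e₀ x,
    typeSign Γ.type.tree L ω e₀ f o • refinedMult Γ.type.tree n ω

/-- `β` is the refined invariant `𝓑_Δ^{K_ω}(L_e)`: generic constraints exist, and for all of them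
the refined count is `β`. -/
def IsRefinedInvariant (L : Slopes n l) (ω : LinearMap.BilinForm ℝ (RealSpace N)) (e₀ : E) {d : ℕ}
    (f : Fin d → Module.Dual ℝ (RealSpace N))
    (o : (Σ e : E, Fin (l e)) ≃ Fin d ⊕ {e : E // e ≠ e₀}) (β : RefinedRing n ω) : Prop :=
  (∃ x : E → RealSpace N, Generic L e₀ x) ∧
    ∀ x : E → RealSpace N, Generic L e₀ x → refinedCount L ω e₀ f o x = β

end Refined

end Tropical53

end

/-!
Cutting a tree at its edges attaches to each edge the set of ends lying beyond it, seen from `e₀`.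
These clusters form a laminar family, and conversely (`iso_of_hier_eq`, `IsHierarchy.hier_tree`):
combinatorial types are laminar families, the trivalent ones being the binary families
(`trivalent_iff_isBinary`). On the cone of a type, the positions of the ends are the linear
combinations of one vector `clusterVec` per bounded edge, with the lengths as coefficients, and of
the translations. Thus everything takes place in the space `E → N_ℝ` of positions, with one problem
for the slopes `(L_e)` and one for `ω`, both given by a list of linear forms.

For fixed slopes, a type on which the evaluation map is invertible contributes a curve iff the
constraints have positive coordinates (`edgeCoord`) on its cone, so that the count is a sum over
types (`signedCount`), with locally constant terms. When the constraints move along a segment, the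
term of a type changes each time a facet of its cone is crossed (`indicator_sub_eq_sum_crossing`).
Such a wall consists of curves with one four-valent vertex and belongs to three cones, the three
resolutions of this vertex (`IsFrame`, `flip`). The crossing multiplies a common factor, depending
on the slopes, by the sum over the three resolutions of the refined multiplicities, each with the
sign of the determinant of the `ω`-problem in the direction of the new edge. This sum is zero:

* the three directions add up to zero modulo the wall and the positions invisible to all the forms
  considered, hence so do the three determinants (`IsFrame.sum_wallDet`);
* their absolute values are, up to a common factor, the products of the `|ω(π_V)|` over the vertices
  (`exists_abs_evalDet_omega`), and the products of the `ω(π_V)` at the two new vertices, taken with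
  suitable orientations, also add up to zero. So the signs of the determinants are, up to a common
  one, those of these products (`sign_coherent`);
* with these signs, the relation to prove is a relation between the `q^π - q^{-π}`, the skein
  relation of the three resolutions (`qDiff_relation`), multiplied by the factors of the other
  vertices. If one of the determinants is zero and the common factor is not, some `ω(π_V)` is zero;
  then `π_V` lies in `K_ω` and the refined multiplicity is zero as well.

The zero-multiplicity hypothesis is used here: a cone on which the evaluation map of the slopes is
not invertible has multiplicity zero in the `ω`-problem, and its crossings contribute nothing. Hence
the count is the same for all constraints in general position (`signedCount_eq_of_transverse`).
Generic constraints may lie on the hyperplane spanned by a wall, but not on the wall itself, as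
contracting edges would yield a curve that is not trivalent (`not_boundary`); a small move then
brings them into general position without changing the count.

When the slopes vary, all determinants are continuous functions of the Plücker vectors
(`exists_continuous_det`). Fix constraints in general position for `(L_e⁰)`. For nearby slopes the
determinants and the coordinates of these constraints keep their signs, where the `ω`-problem is
invertible: the zero-multiplicity hypothesis persists, the constraints stay in general position, and
their count is unchanged (`eventually_signedCount_eq`). Since the count does not depend on the
constraints, the refined invariant is locally constant; it exists because the images of the cones on
which the evaluation map is not surjective do not fill the space of constraints (`exists_generic`).
-/

namespace Tropical53

/-! ### Rooted trees -/

/-- A presentation of a graph as a tree rooted at `r`: each vertex `x ≠ r` has a parent `par x`,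
the edges are the pairs `{x, par x}`, and `rank` decreases towards the root. -/
structure Rooting {V : Type*} (G : SimpleGraph V) (r : V) where
  par : V → V
  rank : V → ℕ
  par_root : par r = r
  rank_lt : ∀ x, x ≠ r → rank (par x) < rank x
  adj_iff : ∀ x y, G.Adj x y ↔ (x ≠ r ∧ par x = y) ∨ (y ≠ r ∧ par y = x)

/-- The parent of a vertex is its unique neighbour closer to `r`. -/
theorem exists_rooting {V : Type*} {G : SimpleGraph V} (hG : G.IsTree) (r : V) :
    Nonempty (Rooting G r) := by
  classical
  have hex : ∀ x, x ≠ r → ∃ y, G.Adj x y ∧ G.dist r x = G.dist r y + 1 := by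
    intro x hx
    obtain ⟨p, hp⟩ := (hG.connected x r).exists_walk_length_eq_dist
    cases p with
    | nil => exact absurd rfl hx
    | @cons _ y _ h q =>
      refine ⟨y, h, ?_⟩
      have h1 := SimpleGraph.dist_le q
      rw [SimpleGraph.Walk.length_cons] at hp
      rw [G.dist_comm (u := r) (v := x), G.dist_comm (u := r) (v := y)]
      have h2 := hG.dist_eq_dist_add_one_of_adj r h
      rw [G.dist_comm (u := r) (v := x), G.dist_comm (u := r) (v := y)] at h2
      omega
  -- two neighbours closer to `r` would give two paths to `r`
  have huniq : ∀ x y y', G.Adj x y → G.dist r x = G.dist r y + 1 →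
      G.Adj x y' → G.dist r x = G.dist r y' + 1 → y = y' := by
    intro x y y' h hd h' hd'
    obtain ⟨p, hp⟩ := (hG.connected y r).exists_walk_length_eq_dist
    obtain ⟨p', hp'⟩ := (hG.connected y' r).exists_walk_length_eq_dist
    have e1 : (SimpleGraph.Walk.cons h p).IsPath := by
      apply SimpleGraph.Walk.isPath_of_length_eq_dist
      rw [SimpleGraph.Walk.length_cons, hp, SimpleGraph.dist_comm, ← hd, SimpleGraph.dist_comm]
    have e2 : (SimpleGraph.Walk.cons h' p').IsPath := by
      apply SimpleGraph.Walk.isPath_of_length_eq_dist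
      rw [SimpleGraph.Walk.length_cons, hp', SimpleGraph.dist_comm, ← hd', SimpleGraph.dist_comm]
    have := (hG.existsUnique_path x r).unique e1 e2
    simpa using congrArg (fun w => w.getVert 1) this
  choose! par hpar using hex
  refine ⟨⟨fun x => if x = r then r else par x, fun x => G.dist r x, by simp, ?_, ?_⟩⟩
  · intro x hx
    simp only [hx, if_false]
    have := (hpar x hx).2
    omega
  · intro x y
    constructor
    · intro h
      rcases hG.dist_eq_dist_add_one_of_adj r h with h2 | h2
      · have hx : x ≠ r := by
          rintro rfl
          simp at h2
        refine Or.inl ⟨hx, ?_⟩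
        simp only [hx, if_false]
        exact huniq x _ _ (hpar x hx).1 (hpar x hx).2 h h2
      · have hy : y ≠ r := by
          rintro rfl
          simp at h2
        refine Or.inr ⟨hy, ?_⟩
        simp only [hy, if_false]
        exact huniq y _ _ (hpar y hy).1 (hpar y hy).2 h.symm h2
    · rintro (⟨hx, rfl⟩ | ⟨hx, rfl⟩)
      · simpa [hx] using (hpar x hx).1
      · simpa [hx] using (hpar y hx).1.symm

namespace Rooting

variable {V : Type*} {G : SimpleGraph V} {r : V} (P : Rooting G r)

/-- `x` lies on the path from the root to `y`. -/
def Anc (x y : V) : Prop := ∃ i : ℕ, P.par^[i] y = x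

theorem Anc.refl (x : V) : P.Anc x x := ⟨0, rfl⟩

variable {P}

theorem Anc.trans {x y z : V} (h : P.Anc x y) (h' : P.Anc y z) : P.Anc x z := by
  obtain ⟨i, rfl⟩ := h
  obtain ⟨j, rfl⟩ := h'
  exact ⟨i + j, by rw [Function.iterate_add_apply]⟩

variable (P)

theorem rank_par_le (x : V) : P.rank (P.par x) ≤ P.rank x := by
  by_cases h : x = r
  · subst h; rw [P.par_root]
  · exact (P.rank_lt x h).le

theorem anc_par (x : V) : P.Anc (P.par x) x := ⟨1, rfl⟩

variable {P}

theorem Anc.rank_le {x y : V} (h : P.Anc x y) : P.rank x ≤ P.rank y := by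
  obtain ⟨i, rfl⟩ := h
  induction i with
  | zero => exact le_rfl
  | succ i ih =>
    rw [Function.iterate_succ_apply']
    exact (P.rank_par_le _).trans ih

theorem Anc.eq_or {x y : V} (h : P.Anc x y) : x = y ∨ (y ≠ r ∧ P.Anc x (P.par y)) := by
  obtain ⟨i, rfl⟩ := h
  by_cases hy : y = r
  · subst hy
    left
    exact Function.iterate_fixed P.par_root i
  · cases i with
    | zero => exact Or.inl rfl
    | succ i => exact Or.inr ⟨hy, i, rfl⟩

theorem Anc.eq_of_rank_le {x y : V} (h : P.Anc x y) (h' : P.rank y ≤ P.rank x) : x = y := by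
  rcases h.eq_or with h1 | ⟨h1, h2⟩
  · exact h1
  · have := h2.rank_le
    have := P.rank_lt y h1
    omega

theorem Anc.antisymm {x y : V} (h : P.Anc x y) (h' : P.Anc y x) : x = y :=
  h.eq_of_rank_le h'.rank_le

theorem Anc.total {x y z : V} (h : P.Anc x z) (h' : P.Anc y z) : P.Anc x y ∨ P.Anc y x := by
  obtain ⟨i, rfl⟩ := h
  obtain ⟨j, rfl⟩ := h'
  rcases le_total i j with hij | hij
  · right
    exact ⟨j - i, by rw [← Function.iterate_add_apply]; congr 1; omega⟩
  · left
    exact ⟨i - j, by rw [← Function.iterate_add_apply]; congr 1; omega⟩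

variable (P)

theorem anc_root (x : V) : P.Anc r x := by
  induction h : P.rank x using Nat.strong_induction_on generalizing x with
  | _ m ih =>
    by_cases hx : x = r
    · subst hx; exact Anc.refl P _
    · exact (ih _ (h ▸ P.rank_lt x hx) _ rfl).trans (P.anc_par x)

theorem par_ne {x : V} (hx : x ≠ r) : P.par x ≠ x := fun h => by
  have := P.rank_lt x hx
  rw [h] at this
  exact lt_irrefl _ this

theorem adj_par {x : V} (hx : x ≠ r) : G.Adj x (P.par x) :=
  (P.adj_iff _ _).2 (Or.inl ⟨hx, rfl⟩)

theorem mem_edgeSet_iff (γ : Sym2 V) : γ ∈ G.edgeSet ↔ ∃ x, x ≠ r ∧ γ = s(x, P.par x) := by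
  induction γ using Sym2.ind with
  | _ a b =>
    rw [SimpleGraph.mem_edgeSet, P.adj_iff]
    constructor
    · rintro (⟨h, rfl⟩ | ⟨h, rfl⟩)
      · exact ⟨a, h, rfl⟩
      · exact ⟨b, h, Sym2.eq_swap⟩
    · rintro ⟨x, hx, h⟩
      rcases Sym2.eq_iff.1 h with ⟨rfl, rfl⟩ | ⟨rfl, rfl⟩
      · exact Or.inl ⟨hx, rfl⟩
      · exact Or.inr ⟨hx, rfl⟩

theorem edge_injective {x y : V} (hx : x ≠ r) (hy : y ≠ r)
    (h : s(x, P.par x) = s(y, P.par y)) : x = y := by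
  rcases Sym2.eq_iff.1 h with ⟨h1, _⟩ | ⟨h1, h2⟩
  · exact h1
  · have e1 := P.rank_lt x hx
    have e2 := P.rank_lt y hy
    rw [h2] at e1
    rw [← h1] at e2
    omega

/-- Two vertices stay connected when the edge above `x` is removed iff they lie on the same side
of it. -/
theorem reachable_deleteEdges_iff {x : V} (hx : x ≠ r) (a b : V) :
    (G.deleteEdges {s(x, P.par x)}).Reachable a b ↔ (P.Anc x a ↔ P.Anc x b) := by
  constructor
  · rintro ⟨p⟩
    induction p with
    | nil => rfl
    | @cons u v w h p ih =>
      rw [← ih]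
      rw [SimpleGraph.deleteEdges_adj, P.adj_iff] at h
      obtain ⟨h1, h2⟩ := h
      have key : ∀ y, y ≠ r → s(y, P.par y) ≠ s(x, P.par x) → (P.Anc x y ↔ P.Anc x (P.par y)) := by
        intro y _ hne
        constructor
        · intro h
          rcases h.eq_or with rfl | h
          · exact absurd rfl hne
          · exact h.2
        · intro h
          exact h.trans (P.anc_par y)
      rcases h1 with ⟨hu, rfl⟩ | ⟨hv, rfl⟩
      · exact key u hu h2
      · refine (key v hv ?_).symm
        rw [Sym2.eq_swap]
        exact h2
  · have up : ∀ y, P.Anc x y → (G.deleteEdges {s(x, P.par x)}).Reachable y x := by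
      intro y
      induction h : P.rank y using Nat.strong_induction_on generalizing y with
      | _ m ih =>
        intro hy
        by_cases hxy : x = y
        · subst hxy; exact SimpleGraph.Reachable.refl _
        · rcases hy.eq_or with h1 | ⟨h1, h2⟩
          · exact absurd h1 hxy
          · refine SimpleGraph.Reachable.trans (SimpleGraph.Adj.reachable ?_)
              (ih _ (h ▸ P.rank_lt y h1) _ rfl h2)
            rw [SimpleGraph.deleteEdges_adj]
            exact ⟨P.adj_par h1, fun h3 => hxy (P.edge_injective h1 hx h3).symm⟩
    have up' : ∀ y, ¬ P.Anc x y → (G.deleteEdges {s(x, P.par x)}).Reachable y r := by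
      intro y
      induction h : P.rank y using Nat.strong_induction_on generalizing y with
      | _ m ih =>
        intro hy
        by_cases hr : y = r
        · subst hr; exact SimpleGraph.Reachable.refl _
        · refine SimpleGraph.Reachable.trans (SimpleGraph.Adj.reachable ?_)
              (ih _ (h ▸ P.rank_lt y hr) _ rfl fun h' => hy (h'.trans (P.anc_par y)))
          rw [SimpleGraph.deleteEdges_adj]
          refine ⟨P.adj_par hr, fun h3 => hy ?_⟩
          rw [P.edge_injective hr hx h3]
          exact Anc.refl P x
    intro h
    by_cases ha : P.Anc x a
    · exact (up a ha).trans (up b (h.1 ha)).symm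
    · exact (up' a ha).trans (up' b fun hb => ha (h.2 hb)).symm

theorem connected (P : Rooting G r) : G.Connected := by
  have up : ∀ y, G.Reachable y r := by
    intro y
    induction h : P.rank y using Nat.strong_induction_on generalizing y with
    | _ m ih =>
      by_cases hr : y = r
      · subst hr; exact SimpleGraph.Reachable.refl _
      · exact (P.adj_par hr).reachable.trans (ih _ (h ▸ P.rank_lt y hr) _ rfl)
  have : Nonempty V := ⟨r⟩
  exact ⟨fun a b => (up a).trans (up b).symm⟩

theorem isTree (P : Rooting G r) : G.IsTree := by
  refine ⟨P.connected, SimpleGraph.isAcyclic_iff_forall_adj_isBridge.2 ?_⟩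
  have key : ∀ x, x ≠ r → G.IsBridge s(x, P.par x) := by
    intro x hx
    rw [SimpleGraph.isBridge_iff, P.reachable_deleteEdges_iff hx]
    intro h
    have h1 := h.1 (Anc.refl P x)
    exact P.par_ne hx (h1.antisymm (P.anc_par x)).symm
  intro a b hab
  rcases (P.adj_iff _ _).1 hab with ⟨h, rfl⟩ | ⟨h, rfl⟩
  · exact key a h
  · rw [Sym2.eq_swap]
    exact key b h

theorem neighborSet_eq (x : V) :
    G.neighborSet x = {c | c ≠ r ∧ P.par c = x} ∪ {y | x ≠ r ∧ y = P.par x} := by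
  ext y
  simp only [SimpleGraph.mem_neighborSet, P.adj_iff, Set.mem_union, Set.mem_ofPred_eq]
  constructor
  · rintro (⟨h, rfl⟩ | h)
    · exact Or.inr ⟨h, rfl⟩
    · exact Or.inl h
  · rintro (h | ⟨h, rfl⟩)
    · exact Or.inr h
    · exact Or.inl ⟨h, rfl⟩

/-- Distinct children of a vertex have no common descendant. -/
theorem eq_of_par_eq {c c' y : V} (hc : c ≠ r) (hc' : c' ≠ r) (h : P.par c = P.par c')
    (h1 : P.Anc c y) (h2 : P.Anc c' y) : c = c' := by
  have key : ∀ c c' : V, c' ≠ r → c ≠ r → P.par c = P.par c' → P.Anc c c' → c = c' := by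
    intro c c' hc' hc h h3
    rcases h3.eq_or with h4 | ⟨_, h4⟩
    · exact h4
    · rw [← h] at h4
      have := h4.rank_le
      have := P.rank_lt c hc
      omega
  rcases h1.total h2 with h3 | h3
  · exact key _ _ hc' hc h h3
  · exact (key _ _ hc hc' h.symm h3).symm

theorem exists_child_anc {x y : V} (h : P.Anc x y) (hne : x ≠ y) :
    ∃ c, c ≠ r ∧ P.par c = x ∧ P.Anc c y := by
  induction hm : P.rank y using Nat.strong_induction_on generalizing y with
  | _ m ih =>
    rcases h.eq_or with h1 | ⟨h1, h2⟩
    · exact absurd h1 hne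
    · by_cases hxy : x = P.par y
      · exact ⟨y, h1, hxy.symm, Anc.refl P y⟩
      · obtain ⟨c, hc, hc', hc''⟩ := ih _ (hm ▸ P.rank_lt y h1) h2 hxy rfl
        exact ⟨c, hc, hc', hc''.trans (P.anc_par y)⟩

end Rooting

noncomputable section

open Finset
open scoped Classical

/-! ### The hierarchy of a labelled tree -/

section TreeHierarchy

variable {E : Type*} [Fintype E]

/-- The ends lying beyond the edge `γ`, as seen from the end `e₀`. -/
def cluster (T : LabelledTree E) (e₀ : E) (γ : Sym2 (E ⊕ Fin T.k)) : Finset E :=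
  univ.filter fun e => T.Separates γ (Sum.inl e₀) (Sum.inl e)

/-- The clusters of all edges of a tree, together with the set of all ends, which stands for the
root `e₀`. Thus the members correspond to the vertices of the tree, `e₀` included. -/
def hier (T : LabelledTree E) (e₀ : E) : Finset (Finset E) :=
  univ.filter fun A => A = univ ∨ ∃ γ ∈ T.graph.edgeSet, A = cluster T e₀ γ

/-- A laminar family of non-empty sets of ends, containing the singletons and the set of all ends
but `e₀`; the set of all ends is its only member containing `e₀`. -/
structure IsHierarchy (e₀ : E) (H : Finset (Finset E)) : Prop where
  univ_mem : univ ∈ H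
  top_mem : {e₀}ᶜ ∈ H
  singleton_mem : ∀ e, e ≠ e₀ → {e} ∈ H
  nonempty : ∀ A ∈ H, A.Nonempty
  eq_univ : ∀ A ∈ H, e₀ ∈ A → A = univ
  laminar : ∀ A ∈ H, ∀ B ∈ H, A ⊆ B ∨ B ⊆ A ∨ Disjoint A B

/-- The members of a hierarchy that correspond to the vertices of `Γ`. -/
def nodes (e₀ : E) (H : Finset (Finset E)) : Finset (Finset E) :=
  H.filter fun A => e₀ ∉ A ∧ 2 ≤ A.card

/-- The members of a hierarchy that correspond to the bounded edges of `Γ`. -/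
def inner (e₀ : E) (H : Finset (Finset E)) : Finset (Finset E) :=
  (nodes e₀ H).erase {e₀}ᶜ

/-- Every member which is not a singleton is the disjoint union of two members. -/
def IsBinary (e₀ : E) (H : Finset (Finset E)) : Prop :=
  ∀ A ∈ nodes e₀ H, ∃ B ∈ H, ∃ C ∈ H, Disjoint B C ∧ B ∪ C = A

/-- `B` is the smallest member of `H` strictly containing `A`. -/
def CoveredIn (H : Finset (Finset E)) (A B : Finset E) : Prop :=
  A ⊂ B ∧ ∀ C ∈ H, A ⊂ C → B ⊆ C

namespace Rooting

/-- The ends descending from the vertex `x`. -/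
def leaves {W : Type*} {G : SimpleGraph (E ⊕ W)} {r : E ⊕ W} (P : Rooting G r) (x : E ⊕ W) :
    Finset E :=
  univ.filter fun e => P.Anc x (Sum.inl e)

theorem mem_leaves {W : Type*} {G : SimpleGraph (E ⊕ W)} {r : E ⊕ W} (P : Rooting G r)
    (x : E ⊕ W) (e : E) : e ∈ P.leaves x ↔ P.Anc x (Sum.inl e) := by
  simp [leaves]

variable {T : LabelledTree E} {e₀ : E} (P : Rooting T.graph (Sum.inl e₀))

theorem leaves_root : P.leaves (Sum.inl e₀) = univ := by
  ext e; simp [mem_leaves, P.anc_root]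

theorem anc_root_iff (x : E ⊕ Fin T.k) : P.Anc x (Sum.inl e₀) ↔ x = Sum.inl e₀ :=
  ⟨fun h => h.antisymm (P.anc_root x), fun h => h ▸ Anc.refl P _⟩

theorem root_mem_leaves_iff (x : E ⊕ Fin T.k) : e₀ ∈ P.leaves x ↔ x = Sum.inl e₀ := by
  rw [mem_leaves, anc_root_iff]

theorem eq_of_anc_leaf {e : E} (he : e ≠ e₀) {y : E ⊕ Fin T.k} (h : P.Anc (Sum.inl e) y) :
    y = Sum.inl e := by
  by_contra hne
  obtain ⟨c, hc, hc', -⟩ := P.exists_child_anc h (Ne.symm hne)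
  obtain ⟨z, hz⟩ := Set.ncard_eq_one.1 (T.valency_end e)
  have hr : (Sum.inl e : E ⊕ Fin T.k) ≠ Sum.inl e₀ := by simpa using he
  have h1 : c ∈ T.graph.neighborSet (Sum.inl e) := by
    rw [P.neighborSet_eq]; exact Or.inl ⟨hc, hc'⟩
  have h2 : P.par (Sum.inl e) ∈ T.graph.neighborSet (Sum.inl e) := P.adj_par hr
  rw [hz, Set.mem_singleton_iff] at h1 h2
  have e1 := P.rank_lt _ hr
  have e2 := P.rank_lt _ hc
  rw [hc', h1, ← h2] at e2
  omega

theorem leaves_leaf {e : E} (he : e ≠ e₀) : P.leaves (Sum.inl e) = {e} := by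
  ext e'
  rw [mem_leaves, mem_singleton]
  constructor
  · intro h
    exact Sum.inl_injective (P.eq_of_anc_leaf he h)
  · rintro rfl; exact Anc.refl P _

theorem neighborSet_inr (v : Fin T.k) : T.graph.neighborSet (Sum.inr v) =
    insert (P.par (Sum.inr v)) {c | c ≠ Sum.inl e₀ ∧ P.par c = Sum.inr v} := by
  rw [P.neighborSet_eq]
  ext y
  simp only [Set.mem_union, Set.mem_ofPred_eq, Set.mem_insert_iff]
  constructor
  · rintro (h | ⟨-, h⟩)
    · exact Or.inr h
    · exact Or.inl h
  · rintro (h | h)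
    · exact Or.inr ⟨by simp, h⟩
    · exact Or.inl h

theorem par_notMem_children (v : Fin T.k) :
    P.par (Sum.inr v) ∉ {c | c ≠ Sum.inl e₀ ∧ P.par c = Sum.inr v} := by
  rintro ⟨h1, h2⟩
  have e1 := P.rank_lt _ h1
  have e2 := P.rank_lt (Sum.inr v) (by simp)
  rw [h2] at e1
  omega

theorem ncard_neighborSet_inr (v : Fin T.k) : (T.graph.neighborSet (Sum.inr v)).ncard =
    {c | c ≠ Sum.inl e₀ ∧ P.par c = Sum.inr v}.ncard + 1 := by
  rw [P.neighborSet_inr, Set.ncard_insert_of_notMem (P.par_notMem_children v)]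

theorem exists_two_children (v : Fin T.k) : ∃ c c' : E ⊕ Fin T.k,
    c ≠ Sum.inl e₀ ∧ c' ≠ Sum.inl e₀ ∧ P.par c = Sum.inr v ∧ P.par c' = Sum.inr v ∧ c ≠ c' := by
  have h := T.valency_vertex v
  rw [P.ncard_neighborSet_inr] at h
  obtain ⟨a, b, ha, hb, hab⟩ := (Set.one_lt_ncard_iff (Set.toFinite _)).1
    (show 1 < {c | c ≠ Sum.inl e₀ ∧ P.par c = Sum.inr v}.ncard by omega)
  exact ⟨a, b, ha.1, hb.1, ha.2, hb.2, hab⟩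

/-- A descendant of `x` of maximal rank has no children, hence is an end. -/
theorem leaves_nonempty (x : E ⊕ Fin T.k) : (P.leaves x).Nonempty := by
  obtain ⟨y, hy, hmax⟩ := (Set.toFinite {y | P.Anc x y}).exists_maximalFor P.rank _
    ⟨x, Anc.refl P x⟩
  rcases y with e | v
  · exact ⟨e, (P.mem_leaves _ _).2 hy⟩
  · obtain ⟨c, -, hc, -, h, -⟩ := P.exists_two_children v
    have h1 : P.Anc x c := Anc.trans hy ⟨1, h⟩
    have h2 := P.rank_lt c hc
    rw [h] at h2
    have := hmax h1 h2.le
    omega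

theorem leaves_subset_of_anc {x y : E ⊕ Fin T.k} (h : P.Anc x y) : P.leaves y ⊆ P.leaves x := by
  intro e he
  rw [mem_leaves] at he ⊢
  exact h.trans he

/-- The sets of leaves determine the order of the vertices, since there are no bivalent vertices. -/
theorem anc_iff {x y : E ⊕ Fin T.k} : P.Anc x y ↔ P.leaves y ⊆ P.leaves x := by
  refine ⟨P.leaves_subset_of_anc, fun h => ?_⟩
  obtain ⟨e, he⟩ := P.leaves_nonempty y
  have hx := h he
  rw [mem_leaves] at he hx
  rcases hx.total he with h1 | h1
  · exact h1
  by_contra hxy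
  have hne : y ≠ x := fun h => hxy (h ▸ Anc.refl P _)
  obtain ⟨c, hc, hc', hcx⟩ := P.exists_child_anc h1 hne
  rcases y with e' | v
  · by_cases he' : e' = e₀
    · subst he'
      rw [P.leaves_root] at h
      have := (P.root_mem_leaves_iff x).1 (h (mem_univ _))
      exact hne this.symm
    · exact hne (P.eq_of_anc_leaf he' h1).symm
  · obtain ⟨a, b, ha, hb, ha', hb', hab⟩ := P.exists_two_children v
    -- if `x` were strictly below `v`, the ends below another child of `v` would not be below `x`
    obtain ⟨d, hd, hd', hdc⟩ : ∃ d, d ≠ Sum.inl e₀ ∧ P.par d = Sum.inr v ∧ d ≠ c := by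
      by_cases hac : a = c
      · exact ⟨b, hb, hb', fun h => hab (hac.trans h.symm)⟩
      · exact ⟨a, ha, ha', hac⟩
    obtain ⟨f, hf⟩ := P.leaves_nonempty d
    have h2 := P.leaves_subset_of_anc hcx (h (P.leaves_subset_of_anc ⟨1, hd'⟩ hf))
    rw [mem_leaves] at hf h2
    exact hdc (P.eq_of_par_eq hd hc (hd'.trans hc'.symm) hf h2)

theorem leaves_injective : Function.Injective P.leaves := fun _ _ h =>
  (P.anc_iff.2 h.ge).antisymm (P.anc_iff.2 h.le)

theorem cluster_eq {x : E ⊕ Fin T.k} (hx : x ≠ Sum.inl e₀) :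
    cluster T e₀ s(x, P.par x) = P.leaves x := by
  ext e
  rw [cluster, mem_filter, mem_leaves]
  simp only [mem_univ, true_and, LabelledTree.Separates]
  rw [P.reachable_deleteEdges_iff hx, P.anc_root_iff]
  simp [hx]

/-- The members of the hierarchy are the sets of ends descending from the vertices. -/
theorem mem_hier_iff (A : Finset E) : A ∈ hier T e₀ ↔ ∃ x, P.leaves x = A := by
  simp only [hier, mem_filter, mem_univ, true_and]
  constructor
  · rintro (rfl | ⟨γ, hγ, rfl⟩)
    · exact ⟨_, P.leaves_root⟩
    · obtain ⟨x, hx, rfl⟩ := (P.mem_edgeSet_iff γ).1 hγ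
      exact ⟨x, (P.cluster_eq hx).symm⟩
  · rintro ⟨x, rfl⟩
    by_cases hx : x = Sum.inl e₀
    · left; rw [hx, P.leaves_root]
    · exact Or.inr ⟨_, P.adj_par hx, (P.cluster_eq hx).symm⟩

theorem leaves_mem_hier (x : E ⊕ Fin T.k) : P.leaves x ∈ hier T e₀ := (P.mem_hier_iff _).2 ⟨x, rfl⟩

theorem exists_root_child : ∃ c : E ⊕ Fin T.k, c ≠ Sum.inl e₀ ∧ P.par c = Sum.inl e₀ ∧
    ∀ c', c' ≠ Sum.inl e₀ → P.par c' = Sum.inl e₀ → c' = c := by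
  obtain ⟨z, hz⟩ := Set.ncard_eq_one.1 (T.valency_end e₀)
  rw [P.neighborSet_eq] at hz
  have h1 : z ∈ ({z} : Set (E ⊕ Fin T.k)) := rfl
  rw [← hz] at h1
  rcases h1 with h1 | ⟨h1, -⟩
  · refine ⟨z, h1.1, h1.2, fun c' hc hc' => ?_⟩
    have : c' ∈ ({z} : Set (E ⊕ Fin T.k)) := by
      rw [← hz]; exact Or.inl ⟨hc, hc'⟩
    exact this
  · exact absurd rfl h1

theorem leaves_eq_top_iff (x : E ⊕ Fin T.k) :
    P.leaves x = {e₀}ᶜ ↔ x ≠ Sum.inl e₀ ∧ P.par x = Sum.inl e₀ := by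
  obtain ⟨c, hc, hc', hu⟩ := P.exists_root_child
  have h1 : P.leaves c = {e₀}ᶜ := by
    ext e
    rw [mem_compl, mem_singleton]
    constructor
    · rintro h rfl
      exact hc ((P.root_mem_leaves_iff c).1 h)
    · intro h
      obtain ⟨d, hd, hd', hde⟩ := P.exists_child_anc (P.anc_root (Sum.inl e))
        (by simpa using Ne.symm h)
      rw [hu d hd hd'] at hde
      exact (P.mem_leaves _ _).2 hde
  constructor
  · intro h
    rw [P.leaves_injective (h.trans h1.symm)]
    exact ⟨hc, hc'⟩
  · rintro ⟨h, h'⟩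
    rw [hu x h h', h1]

theorem mem_leaves_inr (v : Fin T.k) (e : E) : e ∈ P.leaves (Sum.inr v) ↔
    ∃ c, c ≠ Sum.inl e₀ ∧ P.par c = Sum.inr v ∧ e ∈ P.leaves c := by
  constructor
  · intro h
    obtain ⟨c, h1, h2, h3⟩ := P.exists_child_anc ((P.mem_leaves _ _).1 h) (by simp)
    exact ⟨c, h1, h2, (P.mem_leaves _ _).2 h3⟩
  · rintro ⟨c, -, h2, h3⟩
    exact P.leaves_subset_of_anc ⟨1, h2⟩ h3

theorem disjoint_leaves {c c' : E ⊕ Fin T.k} (hc : c ≠ Sum.inl e₀) (hc' : c' ≠ Sum.inl e₀)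
    (h : P.par c = P.par c') (hne : c ≠ c') : Disjoint (P.leaves c) (P.leaves c') := by
  rw [Finset.disjoint_left]
  intro e h1 h2
  rw [mem_leaves] at h1 h2
  exact hne (P.eq_of_par_eq hc hc' h h1 h2)

theorem two_le_card_leaves (v : Fin T.k) : 2 ≤ (P.leaves (Sum.inr v)).card := by
  obtain ⟨a, b, ha, hb, ha', hb', hab⟩ := P.exists_two_children v
  obtain ⟨e, he⟩ := P.leaves_nonempty a
  obtain ⟨f, hf⟩ := P.leaves_nonempty b
  have hd := P.disjoint_leaves ha hb (ha'.trans hb'.symm) hab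
  refine Finset.one_lt_card.2 ⟨e, P.leaves_subset_of_anc ⟨1, ha'⟩ he, f,
    P.leaves_subset_of_anc ⟨1, hb'⟩ hf, ?_⟩
  rintro rfl
  exact (Finset.disjoint_left.1 hd) he hf

theorem mem_nodes_iff (A : Finset E) :
    A ∈ nodes e₀ (hier T e₀) ↔ ∃ v, P.leaves (Sum.inr v) = A := by
  rw [nodes, mem_filter, P.mem_hier_iff]
  constructor
  · rintro ⟨⟨x, rfl⟩, h1, h2⟩
    rcases x with e | v
    · by_cases he : e = e₀
      · subst he
        exact absurd ((P.root_mem_leaves_iff _).2 rfl) h1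
      · rw [P.leaves_leaf he] at h2
        simp at h2
    · exact ⟨v, rfl⟩
  · rintro ⟨v, rfl⟩
    refine ⟨⟨_, rfl⟩, ?_, P.two_le_card_leaves v⟩
    rw [P.root_mem_leaves_iff]
    simp

end Rooting

theorem exists_rooting_end (T : LabelledTree E) (e₀ : E) :
    Nonempty (Rooting T.graph (Sum.inl e₀)) := exists_rooting T.isTree _

theorem isHierarchy_hier (T : LabelledTree E) (e₀ : E) : IsHierarchy e₀ (hier T e₀) := by
  obtain ⟨P⟩ := exists_rooting_end T e₀
  constructor
  · exact (P.mem_hier_iff _).2 ⟨_, P.leaves_root⟩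
  · obtain ⟨c, hc, hc', -⟩ := P.exists_root_child
    exact (P.mem_hier_iff _).2 ⟨c, (P.leaves_eq_top_iff c).2 ⟨hc, hc'⟩⟩
  · intro e he
    exact (P.mem_hier_iff _).2 ⟨_, P.leaves_leaf he⟩
  · intro A hA
    obtain ⟨x, rfl⟩ := (P.mem_hier_iff _).1 hA
    exact P.leaves_nonempty x
  · intro A hA h
    obtain ⟨x, rfl⟩ := (P.mem_hier_iff _).1 hA
    rw [(P.root_mem_leaves_iff x).1 h, P.leaves_root]
  · intro A hA B hB
    obtain ⟨x, rfl⟩ := (P.mem_hier_iff _).1 hA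
    obtain ⟨y, rfl⟩ := (P.mem_hier_iff _).1 hB
    by_cases h : Disjoint (P.leaves x) (P.leaves y)
    · exact Or.inr (Or.inr h)
    · obtain ⟨e, he, he'⟩ := Finset.not_disjoint_iff.1 h
      rw [P.mem_leaves] at he he'
      rcases he.total he' with h1 | h1
      · exact Or.inr (Or.inl (P.leaves_subset_of_anc h1))
      · exact Or.inl (P.leaves_subset_of_anc h1)

/-! ### A tree is determined by its hierarchy -/

namespace Rooting

variable {T : LabelledTree E} {e₀ : E} (P : Rooting T.graph (Sum.inl e₀))

/-- The parent map can be read off the hierarchy: its relation is the covering relation. -/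
theorem par_eq_iff (x y : E ⊕ Fin T.k) : (x ≠ Sum.inl e₀ ∧ P.par x = y) ↔
    CoveredIn (hier T e₀) (P.leaves x) (P.leaves y) := by
  have lt_of : ∀ z, z ≠ Sum.inl e₀ → P.leaves z ⊂ P.leaves (P.par z) := fun z hz =>
    lt_of_le_of_ne (P.leaves_subset_of_anc (P.anc_par z))
      fun h => P.par_ne hz (P.leaves_injective h).symm
  constructor
  · rintro ⟨hx, rfl⟩
    refine ⟨lt_of x hx, fun C hC hlt => ?_⟩
    obtain ⟨z, rfl⟩ := (P.mem_hier_iff _).1 hC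
    rcases (P.anc_iff.2 hlt.1).eq_or with rfl | ⟨_, h⟩
    · exact absurd hlt (lt_irrefl _)
    · exact P.leaves_subset_of_anc h
  · rintro ⟨h1, h2⟩
    rcases (P.anc_iff.2 h1.1).eq_or with rfl | ⟨hx, h⟩
    · exact absurd h1 (lt_irrefl _)
    · refine ⟨hx, (P.anc_iff.2 (h2 _ (P.leaves_mem_hier _) (lt_of x hx))).antisymm h⟩

theorem adj_iff_coveredIn (x y : E ⊕ Fin T.k) : T.graph.Adj x y ↔
    CoveredIn (hier T e₀) (P.leaves x) (P.leaves y) ∨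
      CoveredIn (hier T e₀) (P.leaves y) (P.leaves x) := by
  rw [P.adj_iff, P.par_eq_iff, P.par_eq_iff]

end Rooting

theorem exists_map_of_hier_eq {T T' : LabelledTree E} {e₀ : E}
    (P : Rooting T.graph (Sum.inl e₀)) (P' : Rooting T'.graph (Sum.inl e₀))
    (h : hier T e₀ = hier T' e₀) :
    ∃ σ : Fin T.k → Fin T'.k, ∀ v, P'.leaves (Sum.inr (σ v)) = P.leaves (Sum.inr v) := by
  have : ∀ v : Fin T.k, ∃ w : Fin T'.k, P'.leaves (Sum.inr w) = P.leaves (Sum.inr v) := by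
    intro v
    rw [← P'.mem_nodes_iff, ← h]
    exact (P.mem_nodes_iff _).2 ⟨v, rfl⟩
  choose σ hσ using this
  exact ⟨σ, hσ⟩

/-- A combinatorial type is determined by its hierarchy. -/
theorem iso_of_hier_eq {T T' : LabelledTree E} {e₀ : E} (h : hier T e₀ = hier T' e₀) :
    T.Iso T' := by
  obtain ⟨P⟩ := exists_rooting_end T e₀
  obtain ⟨P'⟩ := exists_rooting_end T' e₀
  obtain ⟨σ, hσ⟩ := exists_map_of_hier_eq P P' h
  obtain ⟨τ, hτ⟩ := exists_map_of_hier_eq P' P h.symm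
  refine ⟨⟨σ, τ, fun v => ?_, fun v => ?_⟩, fun x y => ?_⟩
  · exact Sum.inr_injective (P.leaves_injective ((hτ _).trans (hσ v)))
  · exact Sum.inr_injective (P'.leaves_injective ((hσ _).trans (hτ v)))
  · have key : ∀ x : E ⊕ Fin T.k, P'.leaves (Sum.map id σ x) = P.leaves x := by
      rintro (e | v)
      · by_cases he : e = e₀
        · subst he
          simp [Rooting.leaves_root]
        · simp [Rooting.leaves_leaf, he]
      · exact hσ v
    simp only [Equiv.coe_fn_mk]
    rw [P.adj_iff_coveredIn, P'.adj_iff_coveredIn, key, key, h]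

/-- The hierarchy depends only on the combinatorial type: rootings are transported along
isomorphisms. -/
theorem hier_eq_of_iso {T T' : LabelledTree E} (e₀ : E) (h : T.Iso T') :
    hier T e₀ = hier T' e₀ := by
  obtain ⟨σ, hσ⟩ := h
  let φ : T.graph ≃g T'.graph :=
    ⟨Equiv.sumCongr (Equiv.refl E) σ, fun {a b} => by simpa using (hσ a b).symm⟩
  obtain ⟨P⟩ := exists_rooting_end T e₀
  let P' : Rooting T'.graph (Sum.inl e₀) :=
    { par := fun x => φ (P.par (φ.symm x))
      rank := fun x => P.rank (φ.symm x)
      par_root := by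
        have : φ.symm (Sum.inl e₀) = Sum.inl e₀ := by
          rw [RelIso.symm_apply_eq]; simp [φ]
        rw [this, P.par_root]; simp [φ]
      rank_lt := fun x hx => by
        rw [RelIso.symm_apply_apply]
        refine P.rank_lt _ fun h => hx ?_
        rw [RelIso.symm_apply_eq] at h
        rw [h]; simp [φ]
      adj_iff := fun x y => by
        have hr : ∀ z, φ.symm z = Sum.inl e₀ ↔ z = Sum.inl e₀ := by
          intro z
          rw [RelIso.symm_apply_eq]; simp [φ]
        rw [← φ.symm.map_adj_iff, P.adj_iff, ne_eq, ne_eq, hr, hr]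
        have h2 : ∀ a b, P.par (φ.symm a) = φ.symm b ↔ φ (P.par (φ.symm a)) = b := by
          intro a b
          constructor
          · intro h; rw [h]; simp
          · rintro rfl; simp
        rw [h2, h2] }
  have hanc : ∀ x y, P'.Anc (φ x) (φ y) ↔ P.Anc x y := by
    intro x y
    have it : ∀ i, P'.par^[i] (φ y) = φ (P.par^[i] y) := by
      intro i
      induction i with
      | zero => rfl
      | succ i ih =>
        rw [Function.iterate_succ_apply', ih, Function.iterate_succ_apply']
        simp [P']
    constructor
    · rintro ⟨i, hi⟩
      rw [it] at hi
      exact ⟨i, φ.injective hi⟩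
    · rintro ⟨i, rfl⟩
      exact ⟨i, it i⟩
  have hl : ∀ x, P'.leaves (φ x) = P.leaves x := by
    intro x
    ext e
    rw [P'.mem_leaves, P.mem_leaves, ← hanc]
    rfl
  ext A
  rw [P.mem_hier_iff, P'.mem_hier_iff]
  constructor
  · rintro ⟨x, rfl⟩
    exact ⟨φ x, hl x⟩
  · rintro ⟨x, rfl⟩
    exact ⟨φ.symm x, by rw [← hl]; simp⟩

end TreeHierarchy

/-! ### Every hierarchy comes from a tree -/

section HierarchyTree

variable {E : Type*} [Fintype E]

namespace IsHierarchy

variable {e₀ : E} {H : Finset (Finset E)}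

theorem exists_coveredIn (hH : IsHierarchy e₀ H) {A : Finset E} (hA : A ∈ H) (hne : A ≠ univ) :
    ∃ B ∈ H, CoveredIn H A B := by
  have hn : (H.filter fun B => A ⊂ B).Nonempty :=
    ⟨univ, by rw [mem_filter]; exact ⟨hH.univ_mem, Finset.ssubset_univ_iff.2 hne⟩⟩
  obtain ⟨B, hB, hmin⟩ := Finset.exists_min_image _ Finset.card hn
  rw [mem_filter] at hB
  refine ⟨B, hB.1, hB.2, fun C hC hAC => ?_⟩
  rcases hH.laminar B hB.1 C hC with h | h | h
  · exact h
  · have := hmin C (by rw [mem_filter]; exact ⟨hC, hAC⟩)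
    rw [Finset.eq_of_subset_of_card_le h this]
  · obtain ⟨e, he⟩ := hH.nonempty A hA
    exact absurd (hAC.1 he) (Finset.disjoint_left.1 h (hB.2.1 he))

theorem coveredIn_unique {A B B' : Finset E} (hB : B ∈ H) (hB' : B' ∈ H)
    (h : CoveredIn H A B) (h' : CoveredIn H A B') : B = B' :=
  (h.2 B' hB' h'.1).antisymm (h'.2 B hB h.1)

theorem coveredIn_top (hH : IsHierarchy e₀ H) : CoveredIn H {e₀}ᶜ univ := by
  refine ⟨Finset.ssubset_univ_iff.2 fun h => ?_, fun C hC hlt => ?_⟩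
  · have := mem_univ e₀
    rw [← h] at this
    simp at this
  · have : e₀ ∈ C := by
      by_contra hc
      refine hlt.2 fun e he => ?_
      rw [mem_compl, mem_singleton]
      rintro rfl
      exact hc he
    rw [hH.eq_univ C hC this]

/-- The member of `H` represented by a vertex of the tree to be constructed. -/
def member (e₀ : E) (H : Finset (Finset E)) : E ⊕ Fin (nodes e₀ H).card → Finset E :=
  Sum.elim (fun e => if e = e₀ then univ else {e}) (fun v => ((nodes e₀ H).equivFin.symm v).1)

theorem member_root : member e₀ H (Sum.inl e₀) = univ := by simp [member]

theorem member_leaf {e : E} (he : e ≠ e₀) : member e₀ H (Sum.inl e) = {e} := by simp [member, he]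

theorem member_inr (v : Fin (nodes e₀ H).card) : member e₀ H (Sum.inr v) ∈ nodes e₀ H :=
  ((nodes e₀ H).equivFin.symm v).2

theorem member_mem (hH : IsHierarchy e₀ H) (x : E ⊕ Fin (nodes e₀ H).card) :
    member e₀ H x ∈ H := by
  rcases x with e | v
  · by_cases he : e = e₀
    · subst he; rw [member_root]; exact hH.univ_mem
    · rw [member_leaf he]; exact hH.singleton_mem e he
  · exact (mem_filter.1 (member_inr v)).1

theorem member_eq_univ_iff (x : E ⊕ Fin (nodes e₀ H).card) :
    e₀ ∈ member e₀ H x ↔ x = Sum.inl e₀ := by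
  constructor
  · intro h
    rcases x with e | v
    · by_cases he : e = e₀
      · rw [he]
      · rw [member_leaf he, mem_singleton] at h
        exact absurd h.symm he
    · exact absurd h (mem_filter.1 (member_inr v)).2.1
  · rintro rfl; rw [member_root]; exact mem_univ _

theorem member_injective : Function.Injective (member e₀ H) := by
  intro x y h
  by_cases hx : x = Sum.inl e₀
  · rw [hx]
    have := (member_eq_univ_iff x).2 hx
    rw [h, member_eq_univ_iff] at this
    exact this.symm
  have hy : y ≠ Sum.inl e₀ := by
    intro hy
    have := (member_eq_univ_iff y).2 hy
    rw [← h, member_eq_univ_iff] at this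
    exact hx this
  rcases x with e | v <;> rcases y with f | w
  · rw [member_leaf (by rintro rfl; exact hx rfl), member_leaf (by rintro rfl; exact hy rfl),
      Finset.singleton_inj] at h
    rw [h]
  · have h2 := (mem_filter.1 (member_inr w)).2.2
    rw [← h, member_leaf (by rintro rfl; exact hx rfl)] at h2
    simp at h2
  · have h2 := (mem_filter.1 (member_inr v)).2.2
    rw [h, member_leaf (by rintro rfl; exact hy rfl)] at h2
    simp at h2
  · simpa [member, Subtype.coe_inj] using h

theorem exists_member (hH : IsHierarchy e₀ H) {A : Finset E} (hA : A ∈ H) :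
    ∃ x, member e₀ H x = A := by
  by_cases h0 : e₀ ∈ A
  · exact ⟨Sum.inl e₀, by rw [member_root, hH.eq_univ A hA h0]⟩
  by_cases h2 : 2 ≤ A.card
  · exact ⟨Sum.inr ((nodes e₀ H).equivFin ⟨A, mem_filter.2 ⟨hA, h0, h2⟩⟩), by simp [member]⟩
  · have h1 := (hH.nonempty A hA).card_pos
    obtain ⟨e, rfl⟩ := Finset.card_eq_one.1 (show A.card = 1 by omega)
    exact ⟨Sum.inl e, member_leaf (by rintro rfl; simp at h0)⟩

theorem exists_parent (hH : IsHierarchy e₀ H) (x : E ⊕ Fin (nodes e₀ H).card)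
    (hx : x ≠ Sum.inl e₀) : ∃ y, CoveredIn H (member e₀ H x) (member e₀ H y) := by
  obtain ⟨B, hB, h⟩ := hH.exists_coveredIn (hH.member_mem x) fun h =>
    hx ((member_eq_univ_iff x).1 (h ▸ mem_univ _))
  obtain ⟨y, rfl⟩ := hH.exists_member hB
  exact ⟨y, h⟩

/-- The parent map of the tree attached to a hierarchy. -/
def parent (hH : IsHierarchy e₀ H) (x : E ⊕ Fin (nodes e₀ H).card) :
    E ⊕ Fin (nodes e₀ H).card :=
  if hx : x = Sum.inl e₀ then Sum.inl e₀ else (hH.exists_parent x hx).choose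

theorem coveredIn_parent (hH : IsHierarchy e₀ H) {x : E ⊕ Fin (nodes e₀ H).card}
    (hx : x ≠ Sum.inl e₀) : CoveredIn H (member e₀ H x) (member e₀ H (hH.parent x)) := by
  rw [parent, dif_neg hx]
  exact (hH.exists_parent x hx).choose_spec

theorem parent_eq (hH : IsHierarchy e₀ H) {x y : E ⊕ Fin (nodes e₀ H).card}
    (h : CoveredIn H (member e₀ H x) (member e₀ H y)) : hH.parent x = y := by
  have hx : x ≠ Sum.inl e₀ := by
    rintro rfl
    rw [member_root] at h
    exact h.1.2 (subset_univ _)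
  exact member_injective (coveredIn_unique (hH.member_mem _) (hH.member_mem _)
    (hH.coveredIn_parent hx) h)

/-- The graph attached to a hierarchy. -/
def graph (hH : IsHierarchy e₀ H) : SimpleGraph (E ⊕ Fin (nodes e₀ H).card) where
  Adj x y := (x ≠ Sum.inl e₀ ∧ hH.parent x = y) ∨ (y ≠ Sum.inl e₀ ∧ hH.parent y = x)
  symm := ⟨fun _ _ h => h.symm⟩
  loopless := ⟨fun x h => by
    have key : ¬ (x ≠ Sum.inl e₀ ∧ hH.parent x = x) := by
      rintro ⟨h1, h2⟩
      have := hH.coveredIn_parent h1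
      rw [h2] at this
      exact this.1.2 subset_rfl
    rcases h with h | h <;> exact key h⟩

/-- The rooting of the graph attached to a hierarchy. -/
def rooting (hH : IsHierarchy e₀ H) : Rooting hH.graph (Sum.inl e₀) where
  par := hH.parent
  rank x := ((member e₀ H x)ᶜ).card
  par_root := by simp [parent]
  rank_lt x hx := Finset.card_lt_card (Finset.compl_ssubset_compl.2 (hH.coveredIn_parent hx).1)
  adj_iff _ _ := Iff.rfl

theorem anc_iff (hH : IsHierarchy e₀ H) (x y : E ⊕ Fin (nodes e₀ H).card) :
    hH.rooting.Anc x y ↔ member e₀ H y ⊆ member e₀ H x := by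
  have up : ∀ y, member e₀ H y ⊆ member e₀ H (hH.parent y) := by
    intro y
    by_cases hy : y = Sum.inl e₀
    · rw [parent, dif_pos hy, hy]
    · exact (hH.coveredIn_parent hy).1.1
  constructor
  · rintro ⟨i, rfl⟩
    induction i with
    | zero => exact subset_rfl
    | succ i ih =>
      rw [Function.iterate_succ_apply']
      exact ih.trans (up _)
  · induction hm : hH.rooting.rank y using Nat.strong_induction_on generalizing y with
    | _ m ih =>
      intro h
      by_cases hxy : x = y
      · rw [hxy]; exact Rooting.Anc.refl _ _
      have hy : y ≠ Sum.inl e₀ := by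
        rintro rfl
        refine hxy ((member_eq_univ_iff x).1 (h ?_))
        rw [member_root]; exact mem_univ _
      have hlt : member e₀ H y ⊂ member e₀ H x :=
        lt_of_le_of_ne h fun h' => hxy (member_injective h').symm
      exact (ih _ (hm ▸ hH.rooting.rank_lt y hy) _ rfl
        ((hH.coveredIn_parent hy).2 _ (hH.member_mem x) hlt)).trans (hH.rooting.anc_par y)

theorem leaves_eq (hH : IsHierarchy e₀ H) (x : E ⊕ Fin (nodes e₀ H).card) :
    hH.rooting.leaves x = member e₀ H x := by
  ext e
  rw [Rooting.mem_leaves, hH.anc_iff]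
  by_cases he : e = e₀
  · subst he
    rw [member_root]
    constructor
    · intro h; exact h (mem_univ _)
    · intro h
      rw [(member_eq_univ_iff x).1 h, member_root]
  · rw [member_leaf he, Finset.singleton_subset_iff]

theorem ncard_neighborSet_inl (hH : IsHierarchy e₀ H) (e : E) :
    (hH.graph.neighborSet (Sum.inl e)).ncard = 1 := by
  rw [Set.ncard_eq_one, hH.rooting.neighborSet_eq]
  by_cases he : e = e₀
  · subst he
    obtain ⟨x, hx⟩ := hH.exists_member hH.top_mem
    have hxr : x ≠ Sum.inl e := by
      rintro rfl
      rw [member_root] at hx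
      have := mem_univ e
      rw [hx] at this
      simp at this
    refine ⟨x, Set.ext fun y => ?_⟩
    simp only [Set.mem_union, Set.mem_ofPred_eq, ne_eq, not_true_eq_false, false_and, or_false,
      Set.mem_singleton_iff]
    constructor
    · rintro ⟨hy, hy'⟩
      have hc := hH.coveredIn_parent hy
      change hH.parent y = _ at hy'
      rw [hy', member_root] at hc
      apply member_injective (H := H)
      rw [hx]
      have hsub : member e H y ⊆ {e}ᶜ := by
        intro f hf
        rw [mem_compl, mem_singleton]
        rintro rfl
        exact hy ((member_eq_univ_iff y).1 hf)
      by_contra hne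
      have := hc.2 _ hH.top_mem (lt_of_le_of_ne hsub hne) (mem_univ e)
      simp at this
    · rintro rfl
      refine ⟨hxr, hH.parent_eq ?_⟩
      rw [hx, member_root]
      exact hH.coveredIn_top
  · refine ⟨hH.parent (Sum.inl e), Set.ext fun y => ?_⟩
    simp only [Set.mem_union, Set.mem_ofPred_eq, Set.mem_singleton_iff]
    constructor
    · rintro (⟨hy, hy'⟩ | ⟨-, rfl⟩)
      · exfalso
        have hc := (hH.coveredIn_parent hy).1
        change hH.parent y = _ at hy'
        rw [hy', member_leaf he, Finset.ssubset_singleton_iff] at hc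
        exact (hH.nonempty _ (hH.member_mem y)).ne_empty hc
      · rfl
    · rintro rfl
      exact Or.inr ⟨by simpa using he, rfl⟩

/-- A vertex has a parent and at least two children: every end beyond the vertex lies beyond one of
its children, but the cluster of one child is not the whole cluster. -/
theorem three_le_ncard_neighborSet_inr (hH : IsHierarchy e₀ H) (v : Fin (nodes e₀ H).card) :
    3 ≤ (hH.graph.neighborSet (Sum.inr v)).ncard := by
  have hv := mem_filter.1 (member_inr v)
  have child : ∀ a ∈ member e₀ H (Sum.inr v), ∃ c, c ≠ Sum.inl e₀ ∧ hH.parent c = Sum.inr v ∧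
      a ∈ member e₀ H c := by
    intro a ha
    have h1 : hH.rooting.Anc (Sum.inr v) (Sum.inl a) := by
      rw [← Rooting.mem_leaves, hH.leaves_eq]; exact ha
    obtain ⟨c, h2, h3, h4⟩ := hH.rooting.exists_child_anc h1 (by simp)
    refine ⟨c, h2, h3, ?_⟩
    rw [← hH.leaves_eq, Rooting.mem_leaves]; exact h4
  obtain ⟨a, ha⟩ := hH.nonempty _ hv.1
  obtain ⟨c, hc, hc', hac⟩ := child a ha
  have hlt := (hH.coveredIn_parent hc).1
  rw [hc'] at hlt
  obtain ⟨b, hb, hbc⟩ := Finset.exists_of_ssubset hlt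
  obtain ⟨d, hd, hd', hbd⟩ := child b hb
  rw [Nat.succ_le_iff, Set.two_lt_ncard_iff (Set.toFinite _)]
  refine ⟨c, d, hH.parent (Sum.inr v), Or.inr ⟨hc, hc'⟩, Or.inr ⟨hd, hd'⟩,
    Or.inl ⟨by simp, rfl⟩, ?_, ?_, ?_⟩
  · rintro rfl; exact hbc hbd
  · rintro rfl
    have h1 := hH.rooting.rank_lt _ hc
    have h2 := hH.rooting.rank_lt (Sum.inr v) (by simp)
    change hH.rooting.rank (hH.parent _) < _ at h1
    rw [hc'] at h1
    exact lt_asymm h1 h2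
  · rintro rfl
    have h1 := hH.rooting.rank_lt _ hd
    have h2 := hH.rooting.rank_lt (Sum.inr v) (by simp)
    change hH.rooting.rank (hH.parent _) < _ at h1
    rw [hd'] at h1
    exact lt_asymm h1 h2

/-- The tree attached to a hierarchy. -/
def tree (hH : IsHierarchy e₀ H) : LabelledTree E where
  k := (nodes e₀ H).card
  graph := hH.graph
  isTree := hH.rooting.isTree
  valency_end := hH.ncard_neighborSet_inl
  valency_vertex := hH.three_le_ncard_neighborSet_inr

/-- Every hierarchy is the hierarchy of a tree. -/
theorem hier_tree (hH : IsHierarchy e₀ H) : hier hH.tree e₀ = H := by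
  ext A
  rw [Rooting.mem_hier_iff (T := hH.tree) hH.rooting]
  constructor
  · rintro ⟨x, rfl⟩
    exact (hH.leaves_eq x).symm ▸ hH.member_mem x
  · intro hA
    obtain ⟨x, rfl⟩ := hH.exists_member hA
    exact ⟨x, hH.leaves_eq x⟩

end IsHierarchy

/-! ### Trivalent trees and binary hierarchies -/

namespace Rooting

variable {T : LabelledTree E} {e₀ : E} (P : Rooting T.graph (Sum.inl e₀))

theorem exists_children_of_trivalent {v : Fin T.k}
    (hv : (T.graph.neighborSet (Sum.inr v)).ncard = 3) : ∃ b c : E ⊕ Fin T.k, b ≠ c ∧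
      {z | z ≠ Sum.inl e₀ ∧ P.par z = Sum.inr v} = {b, c} := by
  rw [P.ncard_neighborSet_inr] at hv
  exact Set.ncard_eq_two.1 (by omega)

theorem leaves_eq_union {v : Fin T.k} {b c : E ⊕ Fin T.k}
    (h : {z | z ≠ Sum.inl e₀ ∧ P.par z = Sum.inr v} = {b, c}) :
    P.leaves (Sum.inr v) = P.leaves b ∪ P.leaves c := by
  ext e
  rw [P.mem_leaves_inr, mem_union]
  have key : ∀ z, (z ≠ Sum.inl e₀ ∧ P.par z = Sum.inr v) ↔ z = b ∨ z = c := fun z => by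
    have := Set.ext_iff.1 h z
    simpa using this
  constructor
  · rintro ⟨z, h1, h2, h3⟩
    rcases (key z).1 ⟨h1, h2⟩ with rfl | rfl
    · exact Or.inl h3
    · exact Or.inr h3
  · rintro (h3 | h3)
    · exact ⟨b, ((key b).2 (Or.inl rfl)).1, ((key b).2 (Or.inl rfl)).2, h3⟩
    · exact ⟨c, ((key c).2 (Or.inr rfl)).1, ((key c).2 (Or.inr rfl)).2, h3⟩

/-- The children of a vertex whose set of ends is the disjoint union of two members of the
hierarchy. -/
theorem exists_children_of_disjoint {v : Fin T.k} {B C : Finset E} (hB : B ∈ hier T e₀)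
    (hC : C ∈ hier T e₀) (hd : Disjoint B C) (hU : B ∪ C = P.leaves (Sum.inr v)) :
    ∃ b c : E ⊕ Fin T.k, b ≠ c ∧ {z | z ≠ Sum.inl e₀ ∧ P.par z = Sum.inr v} = {b, c} ∧
      P.leaves b = B ∧ P.leaves c = C := by
  obtain ⟨b, rfl⟩ := (P.mem_hier_iff _).1 hB
  obtain ⟨c, rfl⟩ := (P.mem_hier_iff _).1 hC
  -- a child of `v` meeting one of the two parts contains it
  have sub : ∀ b' c' z : E ⊕ Fin T.k, Disjoint (P.leaves b') (P.leaves c') →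
      P.leaves b' ∪ P.leaves c' = P.leaves (Sum.inr v) → z ≠ Sum.inl e₀ → P.par z = Sum.inr v →
      ∀ e ∈ P.leaves z, e ∈ P.leaves b' → P.leaves b' ⊆ P.leaves z := by
    intro b' c' z hd hU hz hz' e he heb
    have h1 : P.Anc (Sum.inr v) b' := P.anc_iff.2 (hU ▸ subset_union_left)
    have h2 : Sum.inr v ≠ b' := by
      rintro rfl
      obtain ⟨f, hf⟩ := P.leaves_nonempty c'
      have : f ∈ P.leaves (Sum.inr v) := by rw [← hU]; exact mem_union_right _ hf
      exact Finset.disjoint_left.1 hd this hf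
    obtain ⟨z', h3, h4, h5⟩ := P.exists_child_anc h1 h2
    have h6 := P.leaves_subset_of_anc h5 heb
    rw [P.mem_leaves] at h6 he
    rw [P.eq_of_par_eq hz h3 (hz'.trans h4.symm) he h6]
    exact P.leaves_subset_of_anc h5
  have child : ∀ z, z ≠ Sum.inl e₀ → P.par z = Sum.inr v → z = b ∨ z = c := by
    intro z hz hz'
    have hzs : P.leaves z ⊆ P.leaves (Sum.inr v) := P.leaves_subset_of_anc ⟨1, hz'⟩
    have hne : P.leaves z ≠ P.leaves (Sum.inr v) := fun h => by
      have := P.par_ne hz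
      rw [hz'] at this
      exact this (P.leaves_injective h).symm
    by_cases h1 : ∃ e ∈ P.leaves z, e ∈ P.leaves b
    · by_cases h2 : ∃ e ∈ P.leaves z, e ∈ P.leaves c
      · obtain ⟨e, he, he'⟩ := h1
        obtain ⟨f, hf, hf'⟩ := h2
        refine absurd (hzs.antisymm ?_) hne
        rw [← hU]
        exact union_subset (sub b c z hd hU hz hz' e he he')
          (sub c b z hd.symm (by rw [union_comm]; exact hU) hz hz' f hf hf')
      · left
        obtain ⟨e, he, he'⟩ := h1
        refine P.leaves_injective (Subset.antisymm ?_ (sub b c z hd hU hz hz' e he he'))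
        intro f hf
        have := hzs hf
        rw [← hU, mem_union] at this
        exact this.resolve_right fun h => h2 ⟨f, hf, h⟩
    · right
      obtain ⟨e, he⟩ := P.leaves_nonempty z
      have hec : e ∈ P.leaves c := by
        have := hzs he
        rw [← hU, mem_union] at this
        exact this.resolve_left fun h => h1 ⟨e, he, h⟩
      refine P.leaves_injective (Subset.antisymm ?_
        (sub c b z hd.symm (by rw [union_comm]; exact hU) hz hz' e he hec))
      intro f hf
      have := hzs hf
      rw [← hU, mem_union] at this
      exact this.resolve_left fun h => h1 ⟨f, hf, h⟩
  have hbc : b ≠ c := by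
    rintro rfl
    obtain ⟨e, he⟩ := P.leaves_nonempty b
    exact Finset.disjoint_left.1 hd he he
  refine ⟨b, c, hbc, Set.Subset.antisymm (fun z hz => ?_) ?_, rfl, rfl⟩
  · rcases child z hz.1 hz.2 with rfl | rfl
    · exact Set.mem_insert _ _
    · exact Set.mem_insert_of_mem _ rfl
  · obtain ⟨x, y, hx, hy, hx', hy', hxy⟩ := P.exists_two_children v
    rcases child x hx hx' with rfl | rfl <;> rcases child y hy hy' with rfl | rfl
    · exact absurd rfl hxy
    · rintro z (rfl | rfl)
      · exact ⟨hx, hx'⟩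
      · exact ⟨hy, hy'⟩
    · rintro z (rfl | rfl)
      · exact ⟨hy, hy'⟩
      · exact ⟨hx, hx'⟩
    · exact absurd rfl hxy

end Rooting

/-- The trivalent trees are those with a binary hierarchy. -/
theorem trivalent_iff_isBinary (T : LabelledTree E) (e₀ : E) :
    T.Trivalent ↔ IsBinary e₀ (hier T e₀) := by
  obtain ⟨P⟩ := exists_rooting_end T e₀
  constructor
  · intro h A hA
    obtain ⟨v, rfl⟩ := (P.mem_nodes_iff _).1 hA
    obtain ⟨b, c, hbc, hS⟩ := P.exists_children_of_trivalent (h v)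
    have key : ∀ z, (z ≠ Sum.inl e₀ ∧ P.par z = Sum.inr v) ↔ z = b ∨ z = c := fun z => by
      have := Set.ext_iff.1 hS z
      simpa using this
    have hb := (key b).2 (Or.inl rfl)
    have hc := (key c).2 (Or.inr rfl)
    exact ⟨_, P.leaves_mem_hier b, _, P.leaves_mem_hier c,
      P.disjoint_leaves hb.1 hc.1 (hb.2.trans hc.2.symm) hbc, (P.leaves_eq_union hS).symm⟩
  · intro h v
    obtain ⟨B, hB, C, hC, hd, hU⟩ := h _ ((P.mem_nodes_iff _).2 ⟨v, rfl⟩)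
    obtain ⟨b, c, hbc, hS, -⟩ := P.exists_children_of_disjoint hB hC hd hU
    rw [P.ncard_neighborSet_inr, hS, Set.ncard_pair hbc]

/-! ### Bounded edges and their number -/

theorem card_nodes (T : LabelledTree E) (e₀ : E) : (nodes e₀ (hier T e₀)).card = T.k := by
  obtain ⟨P⟩ := exists_rooting_end T e₀
  have : nodes e₀ (hier T e₀) = univ.image fun v : Fin T.k => P.leaves (Sum.inr v) := by
    ext A
    rw [P.mem_nodes_iff]
    simp
  rw [this, Finset.card_image_of_injective _ fun v w h => Sum.inr_injective (P.leaves_injective h)]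
  simp

theorem top_mem_nodes (hE : 3 ≤ Fintype.card E) {e₀ : E} {H : Finset (Finset E)}
    (hH : IsHierarchy e₀ H) : {e₀}ᶜ ∈ nodes e₀ H := by
  refine mem_filter.2 ⟨hH.top_mem, by simp, ?_⟩
  rw [Finset.card_compl, Finset.card_singleton]
  omega

/-- The clusters excluded from the inner members are those of the unbounded edges: `{e₀}ᶜ` and the
singletons. -/
theorem cluster_mem_inner {T : LabelledTree E} (e₀ : E) (γ : T.BoundedEdge) :
    cluster T e₀ γ.1 ∈ inner e₀ (hier T e₀) := by
  obtain ⟨P⟩ := exists_rooting_end T e₀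
  obtain ⟨γ, hγ, hb⟩ := γ
  obtain ⟨x, hx, rfl⟩ := (P.mem_edgeSet_iff γ).1 hγ
  rw [P.cluster_eq hx, inner, mem_erase, P.mem_nodes_iff]
  rcases x with e | v
  · exact absurd (Sym2.mem_mk_left _ _) (hb e)
  · refine ⟨fun h => ?_, v, rfl⟩
    have := ((P.leaves_eq_top_iff _).1 h).2
    rw [this] at hb
    exact hb e₀ (Sym2.mem_mk_right _ _)

theorem cluster_injective (T : LabelledTree E) (e₀ : E) :
    Function.Injective fun γ : T.BoundedEdge => cluster T e₀ γ.1 := by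
  obtain ⟨P⟩ := exists_rooting_end T e₀
  rintro ⟨γ, hγ, hb⟩ ⟨γ', hγ', hb'⟩ h
  obtain ⟨x, hx, rfl⟩ := (P.mem_edgeSet_iff γ).1 hγ
  obtain ⟨y, hy, rfl⟩ := (P.mem_edgeSet_iff γ').1 hγ'
  simp only [P.cluster_eq hx, P.cluster_eq hy] at h
  have := P.leaves_injective h
  subst this
  rfl

theorem exists_cluster_eq {T : LabelledTree E} {e₀ : E} {A : Finset E}
    (hA : A ∈ inner e₀ (hier T e₀)) : ∃ γ : T.BoundedEdge, cluster T e₀ γ.1 = A := by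
  obtain ⟨P⟩ := exists_rooting_end T e₀
  rw [inner, mem_erase, P.mem_nodes_iff] at hA
  obtain ⟨hne, v, rfl⟩ := hA
  refine ⟨⟨s(Sum.inr v, P.par (Sum.inr v)), P.adj_par (by simp), fun e he => ?_⟩,
    P.cluster_eq (by simp)⟩
  rcases Sym2.mem_iff.1 he with h | h
  · simp at h
  · by_cases hee : e = e₀
    · subst hee
      exact hne ((P.leaves_eq_top_iff _).2 ⟨by simp, h.symm⟩)
    · have := P.eq_of_anc_leaf hee (h ▸ P.anc_par (Sum.inr v))
      simp at this

/-- The bounded edges are the inner members of the hierarchy. -/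
def edgeEquiv (T : LabelledTree E) (e₀ : E) : T.BoundedEdge ≃ inner e₀ (hier T e₀) :=
  Equiv.ofBijective (fun γ => ⟨cluster T e₀ γ.1, cluster_mem_inner e₀ γ⟩)
    ⟨fun _ _ h => cluster_injective T e₀ (Subtype.ext_iff.1 h), fun A => by
      obtain ⟨γ, hγ⟩ := exists_cluster_eq A.2
      exact ⟨γ, Subtype.ext hγ⟩⟩

/-- The number of edges of the tree, counted in two ways. -/
theorem sum_valency (T : LabelledTree E) (e₀ : E) :
    ∑ v : Fin T.k, ((T.graph.neighborSet (Sum.inr v)).ncard - 1) + 2 = Fintype.card E + T.k := by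
  obtain ⟨P⟩ := exists_rooting_end T e₀
  -- the edges are the pairs of a vertex other than the root and its parent
  have h1 := Finset.card_eq_sum_card_fiberwise (f := P.par) (s := univ.erase (Sum.inl e₀))
    (t := univ) (fun _ _ => by simp)
  rw [Finset.card_erase_of_mem (mem_univ _), Finset.card_univ, Fintype.card_sum, Fintype.card_fin,
    Fintype.sum_sum_type] at h1
  have conv : ∀ y, #{x ∈ univ.erase (Sum.inl e₀) | P.par x = y} =
      {c | c ≠ Sum.inl e₀ ∧ P.par c = y}.ncard := by
    intro y
    rw [← Set.ncard_coe_finset]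
    congr 1
    ext c
    simp
  simp only [conv] at h1
  -- among the ends, only the root has a child
  have h2 : ∀ e : E, {c | c ≠ Sum.inl e₀ ∧ P.par c = Sum.inl e}.ncard =
      if e = e₀ then 1 else 0 := by
    intro e
    split_ifs with he
    · subst he
      obtain ⟨c, hc, hc', hu⟩ := P.exists_root_child
      rw [Set.ncard_eq_one]
      refine ⟨c, Set.ext fun z => ⟨fun h => hu z h.1 h.2, ?_⟩⟩
      rintro rfl
      exact ⟨hc, hc'⟩
    · rw [Set.ncard_eq_zero]
      ext z
      simp only [Set.mem_ofPred_eq, Set.mem_empty_iff_false, iff_false]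
      rintro ⟨h3, h4⟩
      have := P.eq_of_anc_leaf he ⟨1, h4⟩
      subst this
      exact P.par_ne h3 h4
  simp only [h2, Finset.sum_ite_eq', mem_univ, if_true] at h1
  have h3 : ∀ v : Fin T.k, (T.graph.neighborSet (Sum.inr v)).ncard - 1 =
      {c | c ≠ Sum.inl e₀ ∧ P.par c = Sum.inr v}.ncard := by
    intro v
    rw [P.ncard_neighborSet_inr]; rfl
  simp only [h3]
  have : 0 < Fintype.card E := Fintype.card_pos_iff.2 ⟨e₀⟩
  omega

/-- A tree has at most as many vertices as a trivalent one. -/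
theorem k_add_two_le (T : LabelledTree E) (e₀ : E) : T.k + 2 ≤ Fintype.card E := by
  have h := sum_valency T e₀
  have h2 : ∑ _v : Fin T.k, 2 ≤ ∑ v : Fin T.k, ((T.graph.neighborSet (Sum.inr v)).ncard - 1) :=
    Finset.sum_le_sum fun v _ => by have := T.valency_vertex v; omega
  simp only [Finset.sum_const, Finset.card_univ, Fintype.card_fin, smul_eq_mul] at h2
  omega

theorem trivalent_iff_k (T : LabelledTree E) (e₀ : E) : T.Trivalent ↔ T.k + 2 = Fintype.card E := by
  have h := sum_valency T e₀
  have hle : ∀ v ∈ (univ : Finset (Fin T.k)), 2 ≤ (T.graph.neighborSet (Sum.inr v)).ncard - 1 :=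
    fun v _ => by have := T.valency_vertex v; omega
  have h3 := Finset.sum_eq_sum_iff_of_le hle
  simp only [Finset.sum_const, Finset.card_univ, Fintype.card_fin, smul_eq_mul] at h3
  constructor
  · intro ht
    have := h3.2 fun v _ => by rw [ht v]
    omega
  · intro hk v
    have := h3.1 (by omega) v (mem_univ _)
    omega

theorem card_boundedEdge (hE : 3 ≤ Fintype.card E) (T : LabelledTree E) :
    Fintype.card T.BoundedEdge + 1 = T.k := by
  obtain ⟨e₀⟩ : Nonempty E := Fintype.card_pos_iff.1 (by omega)
  have h1 : Fintype.card T.BoundedEdge = (inner e₀ (hier T e₀)).card := by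
    rw [Fintype.card_congr (edgeEquiv T e₀), Fintype.card_coe]
  have h2 := top_mem_nodes hE (isHierarchy_hier T e₀)
  rw [h1, inner, Finset.card_erase_of_mem h2, card_nodes]
  have := Finset.card_pos.2 ⟨_, h2⟩
  rw [card_nodes] at this
  omega

theorem finite_labelledTree [Nonempty E] : Finite (LabelledTree E) := by
  let F : LabelledTree E → Σ k : Fin (Fintype.card E + 1), SimpleGraph (E ⊕ Fin k) := fun T =>
    ⟨⟨T.k, by have := k_add_two_le T (Classical.arbitrary E); omega⟩, T.graph⟩
  refine Finite.of_injective F ?_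
  rintro ⟨k, g, h1, h2, h3⟩ ⟨k', g', h1', h2', h3'⟩ h
  simp only [F, Sigma.mk.injEq, Fin.mk.injEq] at h
  obtain ⟨rfl, h⟩ := h
  simp only [heq_eq_eq] at h
  subst h
  rfl

theorem finite_combType [Nonempty E] : Finite (CombType E) := by
  have := finite_labelledTree (E := E)
  exact Quotient.finite _

end HierarchyTree

/-! ### Contractions and flips of hierarchies -/

section Flips

variable {E : Type*} [Fintype E] {e₀ : E} {H : Finset (Finset E)}

/-- Removing clusters of bounded edges from a hierarchy, i.e. contracting these edges, yields a
hierarchy. -/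
theorem IsHierarchy.of_subset (hH : IsHierarchy e₀ H) {K : Finset (Finset E)} (hK : K ⊆ H)
    (hu : univ ∈ K) (ht : {e₀}ᶜ ∈ K) (hs : ∀ e, e ≠ e₀ → {e} ∈ K) : IsHierarchy e₀ K where
  univ_mem := hu
  top_mem := ht
  singleton_mem := hs
  nonempty A hA := hH.nonempty A (hK hA)
  eq_univ A hA := hH.eq_univ A (hK hA)
  laminar A hA B hB := hH.laminar A (hK hA) B (hK hB)

/-- A member of a hierarchy is the disjoint union of two members in at most one way. -/
theorem IsHierarchy.children_unique (hH : IsHierarchy e₀ H) {A B C B' C' : Finset E} (hB : B ∈ H)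
    (hC : C ∈ H) (hB' : B' ∈ H) (hC' : C' ∈ H) (hd : Disjoint B C) (hd' : Disjoint B' C')
    (hU : B ∪ C = A) (hU' : B' ∪ C' = A) : (B = B' ∧ C = C') ∨ (B = C' ∧ C = B') := by
  have nB := hH.nonempty B hB
  have nC := hH.nonempty C hC
  have nB' := hH.nonempty B' hB'
  have nC' := hH.nonempty C' hC'
  have l1 := hH.laminar B hB B' hB'
  have l2 := hH.laminar B hB C' hC'
  have l3 := hH.laminar C hC B' hB'
  have l4 := hH.laminar C hC C' hC'
  subst hU
  obtain ⟨b, hb⟩ := nB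
  obtain ⟨c, hc⟩ := nC
  obtain ⟨b', hb'⟩ := nB'
  obtain ⟨c', hc'⟩ := nC'
  rw [Finset.disjoint_left] at hd hd' l1 l2 l3 l4
  simp only [Finset.ext_iff, mem_union, Finset.subset_iff] at *
  grind

/-- Three disjoint clusters `A₁`, `A₂`, `A₃` of a binary hierarchy such that `A₁ ∪ A₂` and
`A₁ ∪ A₂ ∪ A₃` are clusters. They describe the bounded edge `A₁ ∪ A₂`, with an ordering of the
edges adjacent to it. -/
structure IsFrame (e₀ : E) (H : Finset (Finset E)) (A₁ A₂ A₃ : Finset E) : Prop where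
  isHierarchy : IsHierarchy e₀ H
  isBinary : IsBinary e₀ H
  mem₁ : A₁ ∈ H
  mem₂ : A₂ ∈ H
  mem₃ : A₃ ∈ H
  disj₁₂ : Disjoint A₁ A₂
  disj₁₃ : Disjoint A₁ A₃
  disj₂₃ : Disjoint A₂ A₃
  mem₁₂ : A₁ ∪ A₂ ∈ H
  mem₁₂₃ : A₁ ∪ A₂ ∪ A₃ ∈ H
  notMem : e₀ ∉ A₁ ∪ A₂ ∪ A₃

/-- The hierarchy where the cluster `A₁ ∪ A₂` is replaced by `A₂ ∪ A₃`. Contracting the edge with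
cluster `A₁ ∪ A₂` creates a four-valent vertex with children `A₁`, `A₂`, `A₃`, and this is another
resolution of it. -/
def flip (H : Finset (Finset E)) (A₁ A₂ A₃ : Finset E) : Finset (Finset E) :=
  insert (A₂ ∪ A₃) (H.erase (A₁ ∪ A₂))

namespace IsFrame

variable {A₁ A₂ A₃ : Finset E}

theorem swap (F : IsFrame e₀ H A₁ A₂ A₃) : IsFrame e₀ H A₂ A₁ A₃ where
  isHierarchy := F.isHierarchy
  isBinary := F.isBinary
  mem₁ := F.mem₂
  mem₂ := F.mem₁
  mem₃ := F.mem₃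
  disj₁₂ := F.disj₁₂.symm
  disj₁₃ := F.disj₂₃
  disj₂₃ := F.disj₁₃
  mem₁₂ := union_comm A₁ A₂ ▸ F.mem₁₂
  mem₁₂₃ := union_comm A₁ A₂ ▸ F.mem₁₂₃
  notMem := union_comm A₁ A₂ ▸ F.notMem

/-- By laminarity, no other cluster separates the three parts of a frame from one another. -/
theorem subset_or (F : IsFrame e₀ H A₁ A₂ A₃) {B : Finset E} (hB : B ∈ H) (hne : B ≠ A₁ ∪ A₂) :
    B ⊆ A₁ ∨ B ⊆ A₂ ∨ B ⊆ A₃ ∨ A₁ ∪ A₂ ∪ A₃ ⊆ B ∨ Disjoint B (A₁ ∪ A₂ ∪ A₃) := by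
  obtain ⟨a₁, h₁⟩ := F.isHierarchy.nonempty _ F.mem₁
  obtain ⟨a₂, h₂⟩ := F.isHierarchy.nonempty _ F.mem₂
  have l1 := F.isHierarchy.laminar B hB _ F.mem₁
  have l2 := F.isHierarchy.laminar B hB _ F.mem₂
  have l3 := F.isHierarchy.laminar B hB _ F.mem₃
  have l4 := F.isHierarchy.laminar B hB _ F.mem₁₂
  have l5 := F.isHierarchy.laminar B hB _ F.mem₁₂₃
  have d1 := F.disj₁₂
  have d2 := F.disj₁₃
  have d3 := F.disj₂₃
  clear F
  rw [Finset.disjoint_left] at *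
  simp only [ne_eq, Finset.ext_iff, mem_union, Finset.subset_iff] at *
  grind

theorem nonempty (F : IsFrame e₀ H A₁ A₂ A₃) : A₁.Nonempty ∧ A₂.Nonempty ∧ A₃.Nonempty :=
  ⟨F.isHierarchy.nonempty _ F.mem₁, F.isHierarchy.nonempty _ F.mem₂,
    F.isHierarchy.nonempty _ F.mem₃⟩

theorem union_notMem (F : IsFrame e₀ H A₁ A₂ A₃) : A₂ ∪ A₃ ∉ H := by
  intro h
  obtain ⟨⟨a₁, h₁⟩, ⟨a₂, h₂⟩, ⟨a₃, h₃⟩⟩ := F.nonempty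
  have l := F.isHierarchy.laminar _ h _ F.mem₁₂
  have d1 := F.disj₁₂
  have d2 := F.disj₁₃
  have d3 := F.disj₂₃
  clear F
  rw [Finset.disjoint_left] at *
  simp only [mem_union, Finset.subset_iff] at *
  grind

theorem mem_nodes₁₂ (F : IsFrame e₀ H A₁ A₂ A₃) : A₁ ∪ A₂ ∈ nodes e₀ H := by
  obtain ⟨h₁, h₂, -⟩ := F.nonempty
  refine mem_filter.2 ⟨F.mem₁₂, fun h => F.notMem (mem_union_left _ h), ?_⟩
  rw [Finset.card_union_of_disjoint F.disj₁₂]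
  have := h₁.card_pos
  have := h₂.card_pos
  omega

theorem mem_nodes₁₂₃ (F : IsFrame e₀ H A₁ A₂ A₃) : A₁ ∪ A₂ ∪ A₃ ∈ nodes e₀ H := by
  refine mem_filter.2 ⟨F.mem₁₂₃, F.notMem, ?_⟩
  exact (mem_filter.1 F.mem_nodes₁₂).2.2.trans (Finset.card_le_card subset_union_left)

theorem ne (F : IsFrame e₀ H A₁ A₂ A₃) : A₁ ∪ A₂ ∪ A₃ ≠ A₁ ∪ A₂ := by
  intro h
  obtain ⟨-, -, ⟨a, ha⟩⟩ := F.nonempty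
  have h1 : a ∈ A₁ ∪ A₂ := h ▸ mem_union_right _ ha
  rcases mem_union.1 h1 with h2 | h2
  · exact Finset.disjoint_left.1 F.disj₁₃ h2 ha
  · exact Finset.disjoint_left.1 F.disj₂₃ h2 ha

theorem mem_inner (F : IsFrame e₀ H A₁ A₂ A₃) : A₁ ∪ A₂ ∈ inner e₀ H := by
  refine mem_erase.2 ⟨fun h => F.ne (Subset.antisymm ?_ subset_union_left), F.mem_nodes₁₂⟩
  rw [h]
  intro e he
  rw [mem_compl, mem_singleton]
  rintro rfl
  exact F.notMem (h ▸ he)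

/-- The children of a vertex away from the bounded edge are not the cluster of this edge. -/
theorem child_ne (F : IsFrame e₀ H A₁ A₂ A₃) {B C D : Finset E} (hB : B ∈ H) (hD : D ∈ H)
    (hd : Disjoint C D) (hU : C ∪ D = B) (h₁ : B ≠ A₁ ∪ A₂) (h₂ : B ≠ A₁ ∪ A₂ ∪ A₃) :
    C ≠ A₁ ∪ A₂ := by
  rintro rfl
  obtain ⟨⟨a₁, g₁⟩, ⟨a₂, g₂⟩, ⟨a₃, g₃⟩⟩ := F.nonempty
  have hDne : D ≠ A₁ ∪ A₂ := by
    rintro rfl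
    exact Finset.disjoint_left.1 hd (mem_union_left _ g₁) (mem_union_left _ g₁)
  have k1 := F.subset_or hB h₁
  have k2 := F.subset_or hD hDne
  have d1 := F.disj₁₂
  have d2 := F.disj₁₃
  have d3 := F.disj₂₃
  clear F
  subst hU
  rw [Finset.disjoint_left] at *
  simp only [ne_eq, Finset.ext_iff, mem_union, Finset.subset_iff] at *
  grind

theorem isHierarchy_flip (F : IsFrame e₀ H A₁ A₂ A₃) : IsHierarchy e₀ (flip H A₁ A₂ A₃) := by
  have hsub : ∀ B ∈ H.erase (A₁ ∪ A₂), A₂ ∪ A₃ ⊆ B ∨ B ⊆ A₂ ∪ A₃ ∨ Disjoint (A₂ ∪ A₃) B := by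
    intro B hB
    rw [mem_erase] at hB
    have k := F.subset_or hB.2 hB.1
    have d1 := F.disj₁₂
    have d2 := F.disj₁₃
    clear F
    rw [Finset.disjoint_left] at *
    simp only [ne_eq, Finset.ext_iff, mem_union, Finset.subset_iff] at *
    grind
  have hn := mem_filter.1 F.mem_nodes₁₂
  have hK : ∀ B ∈ H, B ≠ A₁ ∪ A₂ → B ∈ flip H A₁ A₂ A₃ := fun B hB hne =>
    mem_insert_of_mem (mem_erase.2 ⟨hne, hB⟩)
  refine ⟨hK _ F.isHierarchy.univ_mem ?_, hK _ F.isHierarchy.top_mem ?_, fun e he =>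
    hK _ (F.isHierarchy.singleton_mem e he) ?_, fun A hA => ?_, fun A hA h => ?_,
    fun A hA B hB => ?_⟩
  · intro h; exact hn.2.1 (h ▸ mem_univ _)
  · exact (mem_erase.1 F.mem_inner).1.symm
  · intro h
    have := hn.2.2
    rw [← h, card_singleton] at this
    omega
  · rcases mem_insert.1 hA with rfl | hA
    · exact F.nonempty.2.1.mono subset_union_left
    · exact F.isHierarchy.nonempty _ (mem_of_mem_erase hA)
  · rcases mem_insert.1 hA with rfl | hA
    · refine absurd ?_ F.notMem
      rw [union_assoc]
      exact mem_union_right _ h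
    · exact F.isHierarchy.eq_univ _ (mem_of_mem_erase hA) h
  · rcases mem_insert.1 hA with rfl | hA <;> rcases mem_insert.1 hB with rfl | hB
    · exact Or.inl subset_rfl
    · exact hsub B hB
    · rcases hsub A hA with h | h | h
      · exact Or.inr (Or.inl h)
      · exact Or.inl h
      · exact Or.inr (Or.inr h.symm)
    · exact F.isHierarchy.laminar _ (mem_of_mem_erase hA) _ (mem_of_mem_erase hB)

theorem mem_flip_of_mem {B : Finset E} (hB : B ∈ H) (hne : B ≠ A₁ ∪ A₂) : B ∈ flip H A₁ A₂ A₃ :=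
  mem_insert_of_mem (mem_erase.2 ⟨hne, hB⟩)

theorem isFrame_flip (F : IsFrame e₀ H A₁ A₂ A₃) : IsFrame e₀ (flip H A₁ A₂ A₃) A₂ A₃ A₁ := by
  obtain ⟨⟨a₁, h₁⟩, ⟨a₂, h₂⟩, ⟨a₃, h₃⟩⟩ := F.nonempty
  have d1 := Finset.disjoint_left.1 F.disj₁₂
  have d2 := Finset.disjoint_left.1 F.disj₁₃
  have d3 := Finset.disjoint_left.1 F.disj₂₃
  have e1 : A₁ ∈ flip H A₁ A₂ A₃ := mem_flip_of_mem F.mem₁ fun h =>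
    d1 (h ▸ mem_union_right _ h₂) h₂
  have e2 : A₂ ∈ flip H A₁ A₂ A₃ := mem_flip_of_mem F.mem₂ fun h =>
    d1 h₁ (h ▸ mem_union_left _ h₁)
  have e3 : A₃ ∈ flip H A₁ A₂ A₃ := mem_flip_of_mem F.mem₃ fun h =>
    d2 h₁ (h ▸ mem_union_left _ h₁)
  have e4 : A₂ ∪ A₃ ∈ flip H A₁ A₂ A₃ := mem_insert_self _ _
  have eU : A₂ ∪ A₃ ∪ A₁ = A₁ ∪ A₂ ∪ A₃ := by ext; simp only [mem_union]; tauto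
  refine ⟨F.isHierarchy_flip, fun B hB => ?_, e2, e3, e1, F.disj₂₃, F.disj₁₂.symm, F.disj₁₃.symm,
    e4, eU ▸ mem_flip_of_mem F.mem₁₂₃ F.ne, eU ▸ F.notMem⟩
  obtain ⟨hB, hB2⟩ := mem_filter.1 hB
  rcases mem_insert.1 hB with rfl | hB
  · exact ⟨_, e2, _, e3, F.disj₂₃, rfl⟩
  obtain ⟨hne, hB⟩ := mem_erase.1 hB
  by_cases hP : B = A₁ ∪ A₂ ∪ A₃
  · refine ⟨_, e1, _, e4, ?_, by rw [hP, union_assoc]⟩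
    rw [Finset.disjoint_union_right]
    exact ⟨F.disj₁₂, F.disj₁₃⟩
  · obtain ⟨C, hC, D, hD, hd, hU⟩ := F.isBinary B (mem_filter.2 ⟨hB, hB2⟩)
    exact ⟨C, mem_flip_of_mem hC (F.child_ne hB hD hd hU hne hP), D,
      mem_flip_of_mem hD (F.child_ne hB hC hd.symm (by rw [union_comm, hU]) hne hP), hd, hU⟩

theorem flip_flip (F : IsFrame e₀ H A₁ A₂ A₃) :
    flip (flip H A₁ A₂ A₃) A₂ A₃ A₁ = insert (A₃ ∪ A₁) (H.erase (A₁ ∪ A₂)) := by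
  rw [flip, flip, Finset.erase_insert]
  exact fun h => F.union_notMem (mem_of_mem_erase h)

/-- Flipping goes cyclically through the three resolutions of a four-valent vertex. -/
theorem flip_flip_flip (F : IsFrame e₀ H A₁ A₂ A₃) :
    flip (flip (flip H A₁ A₂ A₃) A₂ A₃ A₁) A₃ A₁ A₂ = H := by
  have h := F.swap.union_notMem
  rw [F.flip_flip, flip, Finset.erase_insert, Finset.insert_erase F.mem₁₂]
  rw [union_comm A₃ A₁]
  exact fun h' => h (mem_of_mem_erase h')

theorem erase_flip (F : IsFrame e₀ H A₁ A₂ A₃) :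
    (flip H A₁ A₂ A₃).erase (A₂ ∪ A₃) = H.erase (A₁ ∪ A₂) := by
  rw [flip, Finset.erase_insert]
  exact fun h => F.union_notMem (mem_of_mem_erase h)

theorem nodes_erase (A : Finset E) : (nodes e₀ H).erase A = nodes e₀ (H.erase A) := by
  ext B; simp only [nodes, mem_erase, mem_filter]; tauto

theorem inner_erase (A : Finset E) : (inner e₀ H).erase A = inner e₀ (H.erase A) := by
  ext B; simp only [inner, nodes, mem_erase, mem_filter]; tauto

theorem nodes_erase_flip (F : IsFrame e₀ H A₁ A₂ A₃) :
    (nodes e₀ (flip H A₁ A₂ A₃)).erase (A₂ ∪ A₃) = (nodes e₀ H).erase (A₁ ∪ A₂) := by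
  rw [nodes_erase, nodes_erase, F.erase_flip]

theorem inner_erase_flip (F : IsFrame e₀ H A₁ A₂ A₃) :
    (inner e₀ (flip H A₁ A₂ A₃)).erase (A₂ ∪ A₃) = (inner e₀ H).erase (A₁ ∪ A₂) := by
  rw [inner_erase, inner_erase, F.erase_flip]

end IsFrame

/-! ### Products over the vertices -/

variable {M : Type*} [CommMonoid M]

/-- The term `θ B C`, where `B` and `C` are the two members whose disjoint union is `A` (and `1` if
there are none). It is meant for symmetric `θ`, as `B` and `C` come in no particular order. -/
def childTerm (H : Finset (Finset E)) (θ : Finset E → Finset E → M) (A : Finset E) : M :=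
  if h : ∃ p : Finset E × Finset E, p.1 ∈ H ∧ p.2 ∈ H ∧ Disjoint p.1 p.2 ∧ p.1 ∪ p.2 = A then
    θ h.choose.1 h.choose.2
  else 1

theorem childTerm_eq (hH : IsHierarchy e₀ H) {θ : Finset E → Finset E → M}
    (hθ : ∀ B C, θ B C = θ C B) {B C : Finset E} (hB : B ∈ H) (hC : C ∈ H) (hd : Disjoint B C) :
    childTerm H θ (B ∪ C) = θ B C := by
  have h : ∃ p : Finset E × Finset E, p.1 ∈ H ∧ p.2 ∈ H ∧ Disjoint p.1 p.2 ∧ p.1 ∪ p.2 = B ∪ C :=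
    ⟨(B, C), hB, hC, hd, rfl⟩
  rw [childTerm, dif_pos h]
  obtain ⟨h1, h2, h3, h4⟩ := h.choose_spec
  rcases hH.children_unique h1 h2 hB hC h3 hd h4 rfl with ⟨e1, e2⟩ | ⟨e1, e2⟩
  · rw [e1, e2]
  · rw [e1, e2, hθ]

namespace IsFrame

variable {A₁ A₂ A₃ : Finset E}

theorem prod_nodes (F : IsFrame e₀ H A₁ A₂ A₃) {θ : Finset E → Finset E → M}
    (hθ : ∀ B C, θ B C = θ C B) : ∏ A ∈ nodes e₀ H, childTerm H θ A =
      (∏ B ∈ ((nodes e₀ H).erase (A₁ ∪ A₂)).erase (A₁ ∪ A₂ ∪ A₃), childTerm H θ B) *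
        (θ A₁ A₂ * θ (A₁ ∪ A₂) A₃) := by
  rw [← Finset.prod_erase_mul _ _ F.mem_nodes₁₂,
    ← Finset.prod_erase_mul _ _ (mem_erase.2 ⟨F.ne, F.mem_nodes₁₂₃⟩),
    childTerm_eq F.isHierarchy hθ F.mem₁ F.mem₂ F.disj₁₂,
    childTerm_eq F.isHierarchy hθ F.mem₁₂ F.mem₃
      (Finset.disjoint_union_left.2 ⟨F.disj₁₃, F.disj₂₃⟩), mul_assoc, mul_comm (θ A₁ A₂)]

theorem prod_rest_flip (F : IsFrame e₀ H A₁ A₂ A₃) {θ : Finset E → Finset E → M}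
    (hθ : ∀ B C, θ B C = θ C B) :
    ∏ B ∈ ((nodes e₀ (flip H A₁ A₂ A₃)).erase (A₂ ∪ A₃)).erase (A₂ ∪ A₃ ∪ A₁),
        childTerm (flip H A₁ A₂ A₃) θ B =
      ∏ B ∈ ((nodes e₀ H).erase (A₁ ∪ A₂)).erase (A₁ ∪ A₂ ∪ A₃), childTerm H θ B := by
  have eU : A₂ ∪ A₃ ∪ A₁ = A₁ ∪ A₂ ∪ A₃ := by ext; simp only [mem_union]; tauto
  rw [F.nodes_erase_flip, eU]
  refine Finset.prod_congr rfl fun B hB => ?_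
  obtain ⟨hP, hB⟩ := mem_erase.1 hB
  obtain ⟨hne, hB⟩ := mem_erase.1 hB
  obtain ⟨C, hC, D, hD, hd, hU⟩ := F.isBinary B hB
  have hB := (mem_filter.1 hB).1
  have h1 := F.child_ne hB hD hd hU hne hP
  have h2 := F.child_ne hB hC hd.symm (by rw [union_comm, hU]) hne hP
  rw [← hU, childTerm_eq F.isHierarchy hθ hC hD hd,
    childTerm_eq F.isHierarchy_flip hθ (mem_flip_of_mem hC h1) (mem_flip_of_mem hD h2) hd]

/-- The vertices away from the bounded edge contribute the same factor to the three trees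
obtained by flipping it. -/
theorem exists_prod_nodes_eq (F : IsFrame e₀ H A₁ A₂ A₃) {θ : Finset E → Finset E → M}
    (hθ : ∀ B C, θ B C = θ C B) : ∃ R : M,
    ∏ A ∈ nodes e₀ H, childTerm H θ A = R * (θ A₁ A₂ * θ (A₁ ∪ A₂) A₃) ∧
    ∏ A ∈ nodes e₀ (flip H A₁ A₂ A₃), childTerm (flip H A₁ A₂ A₃) θ A =
      R * (θ A₂ A₃ * θ (A₂ ∪ A₃) A₁) ∧
    ∏ A ∈ nodes e₀ (flip (flip H A₁ A₂ A₃) A₂ A₃ A₁),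
      childTerm (flip (flip H A₁ A₂ A₃) A₂ A₃ A₁) θ A = R * (θ A₃ A₁ * θ (A₃ ∪ A₁) A₂) := by
  refine ⟨_, F.prod_nodes hθ, ?_, ?_⟩
  · rw [F.isFrame_flip.prod_nodes hθ, F.prod_rest_flip hθ]
  · rw [F.isFrame_flip.isFrame_flip.prod_nodes hθ, F.isFrame_flip.prod_rest_flip hθ,
      F.prod_rest_flip hθ]

end IsFrame

/-! ### Sums over the bounded edges of all trivalent trees -/

/-- The binary hierarchies, i.e. the trivalent combinatorial types. -/
def binaries (e₀ : E) : Finset (Finset (Finset E)) :=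
  univ.filter fun H => IsHierarchy e₀ H ∧ IsBinary e₀ H

theorem mem_binaries : H ∈ binaries e₀ ↔ IsHierarchy e₀ H ∧ IsBinary e₀ H := by
  simp [binaries]

/-- Every cluster other than that of the edge at `e₀` has a sibling in a binary hierarchy. -/
theorem exists_sibling (hH : IsHierarchy e₀ H) (hb : IsBinary e₀ H) {A : Finset E} (hAH : A ∈ H)
    (h0 : e₀ ∉ A) (hne : A ≠ {e₀}ᶜ) : ∃ Z ∈ H, Disjoint A Z ∧ A ∪ Z ∈ nodes e₀ H := by
  obtain ⟨P, hP, hcov⟩ := hH.exists_coveredIn hAH (fun h => h0 (h ▸ mem_univ _))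
  have hPtop : P ⊆ {e₀}ᶜ := by
    refine hcov.2 _ hH.top_mem (lt_of_le_of_ne (fun e he => ?_) hne)
    rw [mem_compl, mem_singleton]
    rintro rfl
    exact h0 he
  have hP0 : e₀ ∉ P := fun h => by simpa using hPtop h
  have hPn : P ∈ nodes e₀ H := by
    have h1 := (hH.nonempty _ hAH).card_pos
    have h2 := card_lt_card hcov.1
    exact mem_filter.2 ⟨hP, hP0, by omega⟩
  obtain ⟨C', hC', D', hD', hd', hU'⟩ := hb P hPn
  have l1 := hH.laminar _ hAH _ hC'
  have l2 := hH.laminar _ hAH _ hD'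
  have c1 := hcov.2 _ hC'
  have c2 := hcov.2 _ hD'
  have hss := hcov.1
  obtain ⟨c', hc'⟩ := hH.nonempty _ hC'
  obtain ⟨d', hd''⟩ := hH.nonempty _ hD'
  have key : A = C' ∨ A = D' := by
    by_contra hcon
    rw [not_or] at hcon
    have n1 : ¬ A ⊆ C' := fun h => by
      have := c1 (lt_of_le_of_ne h hcon.1)
      rw [← hU'] at this
      exact Finset.disjoint_left.1 hd' (this (mem_union_right _ hd'')) hd''
    have n2 : ¬ A ⊆ D' := fun h => by
      have := c2 (lt_of_le_of_ne h hcon.2)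
      rw [← hU'] at this
      exact Finset.disjoint_left.1 hd' hc' (this (mem_union_left _ hc'))
    have hsub := hss.1
    rw [← hU'] at hsub
    rcases l1.resolve_left n1 with m1 | m1
    · rcases l2.resolve_left n2 with m2 | m2
      · exact hss.2 (hU' ▸ union_subset m1 m2)
      · exact n1 fun x hx => (mem_union.1 (hsub hx)).resolve_right
          fun h => Finset.disjoint_left.1 m2 hx h
    · exact n2 fun x hx => (mem_union.1 (hsub hx)).resolve_left
        fun h => Finset.disjoint_left.1 m1 hx h
  rcases key with rfl | rfl
  · exact ⟨D', hD', hd', hU' ▸ hPn⟩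
  · exact ⟨C', hC', hd'.symm, by rw [union_comm, hU']; exact hPn⟩

/-- Every bounded edge of a trivalent tree has a frame: two children and a sibling. -/
theorem exists_isFrame (hH : IsHierarchy e₀ H) (hb : IsBinary e₀ H) {A : Finset E}
    (hA : A ∈ inner e₀ H) : ∃ A₁ A₂ A₃, IsFrame e₀ H A₁ A₂ A₃ ∧ A₁ ∪ A₂ = A := by
  obtain ⟨hne, hA⟩ := mem_erase.1 hA
  obtain ⟨hAH, h0, h2⟩ := mem_filter.1 hA
  obtain ⟨B, hB, C, hC, hd, rfl⟩ := hb A hA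
  obtain ⟨Z, hZ, hdZ, hP⟩ := exists_sibling hH hb hAH h0 hne
  obtain ⟨hP, hP0, -⟩ := mem_filter.1 hP
  exact ⟨B, C, Z, ⟨hH, hb, hB, hC, hZ, hd, (Finset.disjoint_union_left.1 hdZ).1,
    (Finset.disjoint_union_left.1 hdZ).2, hAH, hP, hP0⟩, rfl⟩

theorem IsHierarchy.eq_or_eq_of_between (hH : IsHierarchy e₀ H) {A₁ A₂ B : Finset E}
    (h₁ : A₁ ∈ H) (h₂ : A₂ ∈ H) (hB : B ∈ H) (hd : Disjoint A₁ A₂) (hl : A₁ ⊆ B)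
    (hu : B ⊆ A₁ ∪ A₂) : B = A₁ ∨ B = A₁ ∪ A₂ := by
  rcases hH.laminar B hB A₂ h₂ with h | h | h
  · obtain ⟨a, ha⟩ := hH.nonempty _ h₁
    exact absurd (h (hl ha)) (Finset.disjoint_left.1 hd ha)
  · exact Or.inr (hu.antisymm (union_subset hl h))
  · exact Or.inl (Subset.antisymm (fun x hx => (mem_union.1 (hu hx)).resolve_right
      (Finset.disjoint_left.1 h hx)) hl)

/-- The frame of a bounded edge is unique up to exchanging the two children. -/
theorem IsFrame.unique {A₁ A₂ A₃ B₁ B₂ B₃ : Finset E} (F : IsFrame e₀ H A₁ A₂ A₃)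
    (G : IsFrame e₀ H B₁ B₂ B₃) (h : A₁ ∪ A₂ = B₁ ∪ B₂) :
    ((A₁ = B₁ ∧ A₂ = B₂) ∨ (A₁ = B₂ ∧ A₂ = B₁)) ∧ A₃ = B₃ := by
  refine ⟨F.isHierarchy.children_unique F.mem₁ F.mem₂ G.mem₁ G.mem₂ F.disj₁₂ G.disj₁₂ rfl h.symm,
    ?_⟩
  have l1 := F.isHierarchy.laminar _ F.mem₃ _ G.mem₃
  have l2 := F.isHierarchy.laminar _ F.mem₁₂₃ _ G.mem₁₂₃
  have l3 := F.isHierarchy.laminar _ F.mem₁₂₃ _ G.mem₃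
  have l4 := F.isHierarchy.laminar _ G.mem₁₂₃ _ F.mem₃
  obtain ⟨⟨a, ha⟩, -, ⟨c, hc⟩⟩ := F.nonempty
  obtain ⟨-, -, ⟨d, hd⟩⟩ := G.nonempty
  have d1 := Finset.disjoint_union_left.2 ⟨F.disj₁₃, F.disj₂₃⟩
  have d2 := Finset.disjoint_union_left.2 ⟨G.disj₁₃, G.disj₂₃⟩
  clear F G
  rw [← h] at *
  have ha := mem_union_left A₂ ha
  generalize A₁ ∪ A₂ = A at *
  clear h
  rw [Finset.disjoint_left] at *
  simp only [Finset.ext_iff, mem_union, Finset.subset_iff] at *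
  grind

/-- A quantity attached to the bounded edges of the trivalent trees has total sum zero as soon as
its sum over the three trees around each wall vanishes. -/
theorem sum_inner_eq_zero {G : Type*} [AddCommGroup G] [IsAddTorsionFree G]
    (g : Finset (Finset E) → Finset E → G)
    (hg : ∀ H A₁ A₂ A₃, IsFrame e₀ H A₁ A₂ A₃ → g H (A₁ ∪ A₂) + g (flip H A₁ A₂ A₃) (A₂ ∪ A₃) +
      g (flip (flip H A₁ A₂ A₃) A₂ A₃ A₁) (A₃ ∪ A₁) = 0) :
    ∑ H ∈ binaries e₀, ∑ A ∈ inner e₀ H, g H A = 0 := by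
  let FT := Finset (Finset E) × Finset E × Finset E × Finset E
  let S : Finset FT := univ.filter fun p => IsFrame e₀ p.1 p.2.1 p.2.2.1 p.2.2.2
  have hS : ∀ p : FT, p ∈ S ↔ IsFrame e₀ p.1 p.2.1 p.2.2.1 p.2.2.2 := fun p => by simp [S]
  -- the flip permutes the framed edges cyclically
  let ρ : FT → FT := fun p => (flip p.1 p.2.1 p.2.2.1 p.2.2.2, p.2.2.1, p.2.2.2, p.2.1)
  have hρ : ∀ p ∈ S, ρ p ∈ S := fun p hp => (hS _).2 ((hS p).1 hp).isFrame_flip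
  have hρ3 : ∀ p ∈ S, ρ (ρ (ρ p)) = p := fun p hp => by
    have := ((hS p).1 hp).flip_flip_flip
    simp only [ρ, this]
    rfl
  have hsum : ∀ f : FT → G, ∑ p ∈ S, f (ρ p) = ∑ p ∈ S, f p := fun f =>
    Finset.sum_nbij' ρ (fun p => ρ (ρ p)) hρ (fun p hp => hρ _ (hρ _ hp)) hρ3 hρ3 fun _ _ => rfl
  let f : FT → G := fun p => g p.1 (p.2.1 ∪ p.2.2.1)
  -- summing the hypothesis over all framed edges counts each of them three times
  have h3 : 3 • ∑ p ∈ S, f p = 0 := by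
    have : ∑ p ∈ S, (f p + f (ρ p) + f (ρ (ρ p))) = 0 :=
      Finset.sum_eq_zero fun p hp => hg _ _ _ _ ((hS p).1 hp)
    rw [Finset.sum_add_distrib, Finset.sum_add_distrib, hsum f, hsum fun p => f (ρ p), hsum f]
      at this
    rw [← this]
    abel
  have h0 : ∑ p ∈ S, f p = 0 := (smul_eq_zero_iff_right (by norm_num)).1 h3
  let t : Finset (Finset (Finset E) × Finset E) :=
    univ.filter fun q => q.1 ∈ binaries e₀ ∧ q.2 ∈ inner e₀ q.1
  have ht : ∑ q ∈ t, g q.1 q.2 = ∑ H ∈ binaries e₀, ∑ A ∈ inner e₀ H, g H A :=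
    Finset.sum_finset_product' t (binaries e₀) (fun H => inner e₀ H) fun p => by simp [t]
  have hmap : ∀ p ∈ S, (p.1, p.2.1 ∪ p.2.2.1) ∈ t := fun p hp => by
    have F := (hS p).1 hp
    simp only [t, mem_filter, mem_univ, true_and, mem_binaries]
    exact ⟨⟨F.isHierarchy, F.isBinary⟩, F.mem_inner⟩
  -- each bounded edge has two frames, exchanged by `IsFrame.swap`
  have h2 : ∑ p ∈ S, f p = 2 • ∑ q ∈ t, g q.1 q.2 := by
    rw [← Finset.sum_fiberwise_of_maps_to hmap, Finset.smul_sum]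
    refine Finset.sum_congr rfl fun q hq => ?_
    simp only [t, mem_filter, mem_univ, true_and, mem_binaries] at hq
    obtain ⟨A₁, A₂, A₃, F, hA⟩ := exists_isFrame hq.1.1 hq.1.2 hq.2
    have hfib : S.filter (fun p => (p.1, p.2.1 ∪ p.2.2.1) = q) =
        {(q.1, A₁, A₂, A₃), (q.1, A₂, A₁, A₃)} := by
      ext ⟨K, B₁, B₂, B₃⟩
      obtain ⟨H, A⟩ := q
      simp only [mem_filter, hS, mem_insert, mem_singleton, Prod.mk.injEq] at hA ⊢
      constructor
      · rintro ⟨G, rfl, rfl⟩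
        rcases G.unique F hA.symm with ⟨⟨rfl, rfl⟩ | ⟨rfl, rfl⟩, rfl⟩ <;> simp
      · rintro (⟨rfl, rfl, rfl, rfl⟩ | ⟨rfl, rfl, rfl, rfl⟩)
        · exact ⟨F, rfl, hA⟩
        · exact ⟨F.swap, rfl, by rw [union_comm]; exact hA⟩
    have hne : A₁ ≠ A₂ := by
      rintro rfl
      obtain ⟨⟨a, ha⟩, -⟩ := F.nonempty
      exact Finset.disjoint_left.1 F.disj₁₂ ha ha
    rw [hfib, Finset.sum_pair fun h => hne (congrArg (fun p : FT => p.2.1) h)]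
    simp only [f]
    rw [union_comm A₂ A₁, hA, two_smul]
  rw [h2] at h0
  rw [← ht]
  exact (smul_eq_zero_iff_right (by norm_num)).1 h0

end Flips

/-! ### Crossings of a segment with an open simplicial cone -/

/-- Along a segment, the indicator of an intersection of open half-lines changes by the signed
number of the boundary points crossed. -/
theorem indicator_sub_indicator_eq_sum_crossings {J : Type*} (s : Finset J) (α β : J → ℝ)
    {a b : ℝ} (hab : a ≤ b) (ha : ∀ j ∈ s, α j + β j * a ≠ 0) (hb : ∀ j ∈ s, α j + β j * b ≠ 0)
    (hcom : ∀ j ∈ s, ∀ k ∈ s, j ≠ k → ∀ t, α j + β j * t = 0 → α k + β k * t ≠ 0) :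
    (if ∀ j ∈ s, 0 < α j + β j * b then (1 : ℤ) else 0) -
        (if ∀ j ∈ s, 0 < α j + β j * a then 1 else 0) =
      ∑ j ∈ s, if ∃ t ∈ Set.Ioo a b, α j + β j * t = 0 ∧ ∀ k ∈ s, k ≠ j → 0 < α k + β k * t then
        (SignType.sign (β j) : ℤ) else 0 := by
  induction s using Finset.induction_on generalizing a b with
  | empty => simp
  | insert i s hi ih =>
    have hcom' : ∀ j ∈ s, ∀ k ∈ s, j ≠ k → ∀ t, α j + β j * t = 0 → α k + β k * t ≠ 0 :=
      fun j hj k hk => hcom j (mem_insert_of_mem hj) k (mem_insert_of_mem hk)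
    have has : ∀ j ∈ s, α j + β j * a ≠ 0 := fun j hj => ha j (mem_insert_of_mem hj)
    have hbs : ∀ j ∈ s, α j + β j * b ≠ 0 := fun j hj => hb j (mem_insert_of_mem hj)
    have hne : ∀ j ∈ s, j ≠ i := by rintro j hj rfl; exact hi hj
    rw [Finset.sum_insert hi]
    simp only [Finset.forall_mem_insert]
    have hia := ha i (mem_insert_self _ _)
    have hib := hb i (mem_insert_self _ _)
    -- for `j ∈ s`, the crossing condition involves `i` only through positivity
    have e1 : ∀ j ∈ s, ∀ t, ((i ≠ j → 0 < α i + β i * t) ∧ ∀ k ∈ s, k ≠ j → 0 < α k + β k * t) ↔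
        0 < α i + β i * t ∧ ∀ k ∈ s, k ≠ j → 0 < α k + β k * t := by
      intro j hj t
      simp only [(hne j hj).symm, ne_eq, not_false_eq_true, true_implies]
    have e2 : ∀ t, ((i ≠ i → 0 < α i + β i * t) ∧ ∀ k ∈ s, k ≠ i → 0 < α k + β k * t) ↔
        ∀ k ∈ s, 0 < α k + β k * t := by
      intro t
      simp only [ne_eq, not_true_eq_false, false_implies, true_and]
      exact ⟨fun h k hk => h k hk (hne k hk), fun h k hk _ => h k hk⟩
    have e5 : (∑ j ∈ s, if ∃ t ∈ Set.Ioo a b, α j + β j * t = 0 ∧ (i ≠ j → 0 < α i + β i * t) ∧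
        ∀ k ∈ s, k ≠ j → 0 < α k + β k * t then (SignType.sign (β j) : ℤ) else 0) =
        ∑ j ∈ s, if ∃ t ∈ Set.Ioo a b, α j + β j * t = 0 ∧ 0 < α i + β i * t ∧
        ∀ k ∈ s, k ≠ j → 0 < α k + β k * t then (SignType.sign (β j) : ℤ) else 0 :=
      Finset.sum_congr rfl fun j hj => by simp only [e1 j hj]
    rw [e5]
    simp only [e2]
    -- the half-line of index `i` meets the segment in nothing, in a subsegment starting or ending
    -- at the boundary point `t₀`, or in the whole segment
    rcases lt_or_gt_of_ne hia with ha0 | ha0 <;> rcases lt_or_gt_of_ne hib with hb0 | hb0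
    · have neg : ∀ t ∈ Set.Ioo a b, α i + β i * t < 0 := by
        rintro t ⟨h1, h2⟩
        rcases le_total 0 (β i) with h | h <;> nlinarith
      rw [if_neg fun h => lt_asymm hb0 h.1, if_neg fun h => lt_asymm ha0 h.1,
        if_neg (by rintro ⟨t, ht, h, -⟩; exact (neg t ht).ne h), Finset.sum_eq_zero]
      · simp
      · intro j hj
        exact if_neg (by rintro ⟨t, ht, -, h, -⟩; exact lt_asymm (neg t ht) h)
    · have hβ : 0 < β i := by nlinarith
      obtain ⟨t₀, ht₀⟩ : ∃ t₀, α i + β i * t₀ = 0 :=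
        ⟨-α i / β i, by rw [mul_div_cancel₀ _ hβ.ne']; ring⟩
      have h1 : a < t₀ := by nlinarith
      have h2 : t₀ < b := by nlinarith
      have pos : ∀ t, 0 < α i + β i * t ↔ t₀ < t := fun t =>
        ⟨fun h => by nlinarith, fun h => by nlinarith⟩
      have key := ih h2.le (fun j hj => hcom i (mem_insert_self _ _) j (mem_insert_of_mem hj)
        (hne j hj).symm t₀ ht₀) hbs hcom'
      rw [if_neg (c := _ ∧ _) fun h : 0 < α i + β i * a ∧ _ => lt_asymm ha0 h.1]
      have e3 : ∀ j ∈ s, (∃ t ∈ Set.Ioo a b, α j + β j * t = 0 ∧ 0 < α i + β i * t ∧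
          ∀ k ∈ s, k ≠ j → 0 < α k + β k * t) ↔ ∃ t ∈ Set.Ioo t₀ b, α j + β j * t = 0 ∧
          ∀ k ∈ s, k ≠ j → 0 < α k + β k * t := by
        intro j _
        constructor
        · rintro ⟨t, ht, h3, h4, h5⟩
          exact ⟨t, ⟨(pos t).1 h4, ht.2⟩, h3, h5⟩
        · rintro ⟨t, ht, h3, h5⟩
          exact ⟨t, ⟨h1.trans ht.1, ht.2⟩, h3, (pos t).2 ht.1, h5⟩
      have e6 : (∑ j ∈ s, if ∃ t ∈ Set.Ioo a b, α j + β j * t = 0 ∧ 0 < α i + β i * t ∧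
          ∀ k ∈ s, k ≠ j → 0 < α k + β k * t then (SignType.sign (β j) : ℤ) else 0) =
          ∑ j ∈ s, if ∃ t ∈ Set.Ioo t₀ b, α j + β j * t = 0 ∧
          ∀ k ∈ s, k ≠ j → 0 < α k + β k * t then (SignType.sign (β j) : ℤ) else 0 :=
        Finset.sum_congr rfl fun j hj => by simp only [e3 j hj]
      rw [e6, ← key]
      have e4 : (∃ t ∈ Set.Ioo a b, α i + β i * t = 0 ∧ ∀ k ∈ s, 0 < α k + β k * t) ↔
          ∀ k ∈ s, 0 < α k + β k * t₀ := by
        constructor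
        · rintro ⟨t, -, h3, h4⟩
          have : t = t₀ := by
            have : β i * (t - t₀) = 0 := by linarith
            rcases mul_eq_zero.1 this with h | h
            · exact absurd h hβ.ne'
            · linarith
          exact this ▸ h4
        · intro h; exact ⟨t₀, ⟨h1, h2⟩, ht₀, h⟩
      simp only [e4, hb0, true_and, sign_pos hβ, SignType.coe_one]
      split_ifs <;> simp
    · have hβ : β i < 0 := by nlinarith
      obtain ⟨t₀, ht₀⟩ : ∃ t₀, α i + β i * t₀ = 0 :=
        ⟨-α i / β i, by rw [mul_div_cancel₀ _ hβ.ne]; ring⟩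
      have h1 : a < t₀ := by nlinarith
      have h2 : t₀ < b := by nlinarith
      have pos : ∀ t, 0 < α i + β i * t ↔ t < t₀ := fun t =>
        ⟨fun h => by nlinarith, fun h => by nlinarith⟩
      have key := ih h1.le has (fun j hj => hcom i (mem_insert_self _ _) j (mem_insert_of_mem hj)
        (hne j hj).symm t₀ ht₀) hcom'
      rw [if_neg (c := _ ∧ _) fun h : 0 < α i + β i * b ∧ _ => lt_asymm hb0 h.1]
      have e3 : ∀ j ∈ s, (∃ t ∈ Set.Ioo a b, α j + β j * t = 0 ∧ 0 < α i + β i * t ∧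
          ∀ k ∈ s, k ≠ j → 0 < α k + β k * t) ↔ ∃ t ∈ Set.Ioo a t₀, α j + β j * t = 0 ∧
          ∀ k ∈ s, k ≠ j → 0 < α k + β k * t := by
        intro j _
        constructor
        · rintro ⟨t, ht, h3, h4, h5⟩
          exact ⟨t, ⟨ht.1, (pos t).1 h4⟩, h3, h5⟩
        · rintro ⟨t, ht, h3, h5⟩
          exact ⟨t, ⟨ht.1, ht.2.trans h2⟩, h3, (pos t).2 ht.2, h5⟩
      have e6 : (∑ j ∈ s, if ∃ t ∈ Set.Ioo a b, α j + β j * t = 0 ∧ 0 < α i + β i * t ∧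
          ∀ k ∈ s, k ≠ j → 0 < α k + β k * t then (SignType.sign (β j) : ℤ) else 0) =
          ∑ j ∈ s, if ∃ t ∈ Set.Ioo a t₀, α j + β j * t = 0 ∧
          ∀ k ∈ s, k ≠ j → 0 < α k + β k * t then (SignType.sign (β j) : ℤ) else 0 :=
        Finset.sum_congr rfl fun j hj => by simp only [e3 j hj]
      rw [e6, ← key]
      have e4 : (∃ t ∈ Set.Ioo a b, α i + β i * t = 0 ∧ ∀ k ∈ s, 0 < α k + β k * t) ↔
          ∀ k ∈ s, 0 < α k + β k * t₀ := by
        constructor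
        · rintro ⟨t, -, h3, h4⟩
          have : t = t₀ := by
            have : β i * (t - t₀) = 0 := by linarith
            rcases mul_eq_zero.1 this with h | h
            · exact absurd h hβ.ne
            · linarith
          exact this ▸ h4
        · intro h; exact ⟨t₀, ⟨h1, h2⟩, ht₀, h⟩
      simp only [e4, ha0, true_and, sign_neg hβ, SignType.coe_neg_one]
      split_ifs <;> simp
    · have pos : ∀ t ∈ Set.Ioo a b, 0 < α i + β i * t := by
        rintro t ⟨h1, h2⟩
        rcases le_total 0 (β i) with h | h <;> nlinarith
      have e3 : ∀ j ∈ s, (∃ t ∈ Set.Ioo a b, α j + β j * t = 0 ∧ 0 < α i + β i * t ∧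
          ∀ k ∈ s, k ≠ j → 0 < α k + β k * t) ↔ ∃ t ∈ Set.Ioo a b, α j + β j * t = 0 ∧
          ∀ k ∈ s, k ≠ j → 0 < α k + β k * t := by
        intro j _
        constructor
        · rintro ⟨t, ht, h3, h4, h5⟩
          exact ⟨t, ht, h3, h5⟩
        · rintro ⟨t, ht, h3, h5⟩
          exact ⟨t, ht, h3, pos t ht, h5⟩
      have e6 : (∑ j ∈ s, if ∃ t ∈ Set.Ioo a b, α j + β j * t = 0 ∧ 0 < α i + β i * t ∧
          ∀ k ∈ s, k ≠ j → 0 < α k + β k * t then (SignType.sign (β j) : ℤ) else 0) =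
          ∑ j ∈ s, if ∃ t ∈ Set.Ioo a b, α j + β j * t = 0 ∧
          ∀ k ∈ s, k ≠ j → 0 < α k + β k * t then (SignType.sign (β j) : ℤ) else 0 :=
        Finset.sum_congr rfl fun j hj => by simp only [e3 j hj]
      rw [e6, ← ih hab has hbs hcom']
      rw [if_neg (c := ∃ t ∈ Set.Ioo a b, α i + β i * t = 0 ∧ _)
        (by rintro ⟨t, ht, h, -⟩; exact (pos t ht).ne' h)]
      have ha0' : 0 < α i + β i * a := ha0
      have hb0' : 0 < α i + β i * b := hb0
      simp only [ha0', hb0', true_and, zero_add]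

/-! ### Determinants of evaluation maps -/

/-- A matrix that is triangular for a grading of its indices, the indices of equal degree being
unrelated, has the product of its diagonal entries as determinant. -/
theorem det_eq_prod_diag {m : Type*} [Fintype m] [DecidableEq m] {R : Type*} [CommRing R]
    (M : Matrix m m R) (c : m → ℕ) (h : ∀ i j, M i j ≠ 0 → i ≠ j → c i < c j) :
    M.det = ∏ i, M i i := by
  rw [Matrix.det_apply, Finset.sum_eq_single 1]
  · simp
  · intro σ _ hσ
    -- a permutation with non-zero term cannot raise any degree, and the total degree is preserved
    by_contra hne
    have hp : ∀ i, M (σ i) i ≠ 0 := fun i hi =>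
      hne (by rw [Finset.prod_eq_zero (f := fun i => M (σ i) i) (mem_univ i) hi, smul_zero])
    have hle : ∀ i ∈ univ, c (σ i) ≤ c i := fun i _ => by
      by_cases hi : σ i = i
      · rw [hi]
      · exact (h _ _ (hp i) hi).le
    refine hσ (Equiv.ext fun i => ?_)
    by_contra hi
    have hlt := Finset.sum_lt_sum hle ⟨i, mem_univ _, h _ _ (hp i) hi⟩
    rw [Equiv.sum_comp σ c] at hlt
    exact lt_irrefl _ hlt
  · simp

section Eval

variable {E : Type*} [Fintype E] {N : Type*} [AddCommGroup N] {ι : Type*}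

/-- The contribution of a bounded edge with cluster `A` to the positions of the ends: when the edge
grows, the ends in `A` move in the direction of its slope. -/
def clusterVec (n : E → N) (A : Finset E) : E → RealSpace N :=
  fun e => if e ∈ A then toReal (∑ e ∈ A, n e) else 0

/-- The values of linear forms on the positions of the ends. -/
def evalForms (s : ι → E) (φ : ι → Module.Dual ℝ (RealSpace N)) :
    (E → RealSpace N) →ₗ[ℝ] (ι → ℝ) :=
  LinearMap.pi fun i => (φ i).comp (LinearMap.proj (s i))

@[simp] theorem evalForms_apply (s : ι → E) (φ : ι → Module.Dual ℝ (RealSpace N))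
    (z : E → RealSpace N) (i : ι) : evalForms s φ z i = φ i (z (s i)) := rfl

/-- The positions of the ends of a curve. -/
def endPositions (T : LabelledTree E) (n : E → N) (e₀ : E) :
    ((T.BoundedEdge → ℝ) × RealSpace N) →ₗ[ℝ] (E → RealSpace N) :=
  LinearMap.pi fun e => position T n e₀ (Sum.inl e)

/-- The positions of the ends are linear combinations of the vectors of the clusters and of the
translations. -/
theorem endPositions_apply (T : LabelledTree E) (n : E → N) (e₀ : E)
    (p : (T.BoundedEdge → ℝ) × RealSpace N) : endPositions T n e₀ p =
      ∑ γ, p.1 γ • clusterVec n (cluster T e₀ γ.1) + Function.const E p.2 := by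
  ext1 e
  rw [Pi.add_apply, Finset.sum_apply]
  simp only [endPositions, LinearMap.pi_apply, position, LinearMap.add_apply, LinearMap.snd_apply,
    LinearMap.sum_apply, Function.const_apply, Finset.sum_filter]
  rw [add_comm]
  congr 1
  refine Finset.sum_congr rfl fun γ _ => ?_
  simp only [Pi.smul_apply, clusterVec, cluster, mem_filter, mem_univ, true_and, smul_ite,
    smul_zero]
  split_ifs <;> rfl

theorem composedEval_eq (T : LabelledTree E) (n : E → N) (e₀ : E) (s : ι → E)
    (φ : ι → Module.Dual ℝ (RealSpace N)) :
    composedEval T n e₀ s φ = (evalForms s φ).comp (endPositions T n e₀) := rfl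

variable [Module.Free ℤ N] [Module.Finite ℤ N]

/-- The basis of `N_ℝ` used in the definition of the determinants. -/
def stdVec (N : Type*) [AddCommGroup N] [Module.Free ℤ N] [Module.Finite ℤ N]
    (j : Fin (Module.finrank ℤ N)) : RealSpace N :=
  Algebra.TensorProduct.basis ℝ (Module.finBasis ℤ N) j

/-- The variations of the positions of the ends along the basis of the domain of the evaluation
map. -/
def edgeFamily (T : LabelledTree E) (n : E → N) (e₀ : E) :
    T.BoundedEdge ⊕ Fin (Module.finrank ℤ N) → E → RealSpace N :=
  Sum.elim (fun γ => clusterVec n (cluster T e₀ γ.1)) fun j => Function.const E (stdVec N j)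

theorem endPositions_domainBasis (T : LabelledTree E) (n : E → N) (e₀ : E)
    (k : T.BoundedEdge ⊕ Fin (Module.finrank ℤ N)) :
    endPositions T n e₀ (domainBasis T N k) = edgeFamily T n e₀ k := by
  rw [endPositions_apply]
  rcases k with γ | j
  · simp only [domainBasis, Module.Basis.prod_apply, Sum.elim_inl, Function.comp_apply,
      LinearMap.inl_apply, Pi.basisFun_apply, edgeFamily]
    rw [Finset.sum_eq_single γ]
    · simp only [Pi.single_eq_same, one_smul]
      ext e; simp
    · intro γ' _ hne
      simp [Pi.single_eq_of_ne hne]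
    · simp
  · simp only [domainBasis, Module.Basis.prod_apply, Sum.elim_inr, Function.comp_apply,
      LinearMap.inr_apply, edgeFamily, stdVec]
    simp

variable [Fintype ι]

/-- The columns of `evalDet` are the values of the forms on the variations of the positions. -/
theorem evalDet_eq {T : LabelledTree E} {n : E → N} {e₀ : E} {s : ι → E}
    {φ : ι → Module.Dual ℝ (RealSpace N)}
    (h : Nonempty (ι ≃ T.BoundedEdge ⊕ Fin (Module.finrank ℤ N))) :
    evalDet T n e₀ s φ =
      Matrix.det (Matrix.of fun i j => φ i (edgeFamily T n e₀ (h.some j) (s i))) := by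
  rw [evalDet, dif_pos h]
  congr 1
  ext i j
  rw [Matrix.submatrix_apply, LinearMap.toMatrix_apply, Matrix.of_apply, composedEval_eq,
    LinearMap.comp_apply, endPositions_domainBasis]
  simp

theorem evalDet_eq_toMatrix {T : LabelledTree E} {n : E → N} {e₀ : E} {s : ι → E}
    {φ : ι → Module.Dual ℝ (RealSpace N)}
    (h : Nonempty (ι ≃ T.BoundedEdge ⊕ Fin (Module.finrank ℤ N))) :
    evalDet T n e₀ s φ = (LinearMap.toMatrix ((domainBasis T N).reindex h.some.symm)
      (Pi.basisFun ℝ ι) (composedEval T n e₀ s φ)).det := by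
  rw [evalDet, dif_pos h]
  congr 1
  ext i j
  simp [LinearMap.toMatrix_apply]

theorem bijective_of_evalDet_ne_zero {T : LabelledTree E} {n : E → N} {e₀ : E} {s : ι → E}
    {φ : ι → Module.Dual ℝ (RealSpace N)} (h0 : evalDet T n e₀ s φ ≠ 0) :
    Function.Bijective (composedEval T n e₀ s φ) := by
  have h : Nonempty (ι ≃ T.BoundedEdge ⊕ Fin (Module.finrank ℤ N)) := by
    by_contra h
    exact h0 (by rw [evalDet, dif_neg h])
  rw [evalDet_eq_toMatrix h] at h0
  exact (LinearEquiv.ofIsUnitDet h0.isUnit).bijective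

theorem finrank_domain (T : LabelledTree E) (N : Type*) [AddCommGroup N] [Module.Free ℤ N]
    [Module.Finite ℤ N] : Module.finrank ℝ ((T.BoundedEdge → ℝ) × RealSpace N) =
      Fintype.card T.BoundedEdge + Module.finrank ℤ N := by
  rw [Module.finrank_eq_card_basis (domainBasis T N)]
  simp

theorem finite_domain (T : LabelledTree E) (N : Type*) [AddCommGroup N] [Module.Free ℤ N]
    [Module.Finite ℤ N] : Module.Finite ℝ ((T.BoundedEdge → ℝ) × RealSpace N) :=
  (domainBasis T N).finiteDimensional_of_finite

theorem evalDet_ne_zero_of_surjective {T : LabelledTree E} {n : E → N} {e₀ : E} {s : ι → E}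
    {φ : ι → Module.Dual ℝ (RealSpace N)}
    (h : Nonempty (ι ≃ T.BoundedEdge ⊕ Fin (Module.finrank ℤ N)))
    (hs : Function.Surjective (composedEval T n e₀ s φ)) : evalDet T n e₀ s φ ≠ 0 := by
  have := finite_domain T N
  have hr : Module.finrank ℝ ((T.BoundedEdge → ℝ) × RealSpace N) = Module.finrank ℝ (ι → ℝ) := by
    rw [finrank_domain, Module.finrank_fintype_fun_eq_card, Fintype.card_congr h.some]
    simp
  have hi := (LinearMap.injective_iff_surjective_of_finrank_eq_finrank hr).2 hs
  rw [evalDet_eq_toMatrix h]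
  exact (LinearEquiv.isUnit_det (LinearEquiv.ofBijective _ ⟨hi, hs⟩) _ _).ne_zero

/-! ### The linear form of a wall -/

/-- The variations of the positions of the ends along a wall, completed by `u`. -/
def wallFamily (n : E → N) (W : Finset (Finset E)) (u : E → RealSpace N) :
    Option (W ⊕ Fin (Module.finrank ℤ N)) → E → RealSpace N :=
  fun k => k.elim u (Sum.elim (fun A => clusterVec n A.1) fun j => Function.const E (stdVec N j))

/-- The linear form `u ↦ det (u, w)`, where `w` spans the wall with set of clusters `W`. The
order of the columns depends only on `W` and on the index type of the linear forms. It is `0` if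
dimensions do not match. -/
def wallDet (n : E → N) (s : ι → E) (φ : ι → Module.Dual ℝ (RealSpace N))
    (W : Finset (Finset E)) : (E → RealSpace N) →ₗ[ℝ] ℝ :=
  if h : Nonempty (ι ≃ Option (W ⊕ Fin (Module.finrank ℤ N))) then
    (Matrix.detRowAlternating.toMultilinearMap.toLinearMap
      (fun j => evalForms s φ (wallFamily n W 0 (h.some j))) (h.some.symm none)).comp
        (evalForms s φ)
  else 0

theorem wallDet_apply (n : E → N) (s : ι → E) (φ : ι → Module.Dual ℝ (RealSpace N))
    {W : Finset (Finset E)} (h : Nonempty (ι ≃ Option (W ⊕ Fin (Module.finrank ℤ N))))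
    (u : E → RealSpace N) : wallDet n s φ W u =
      Matrix.det (Matrix.of fun j i => φ i (wallFamily n W u (h.some j) (s i))) := by
  rw [wallDet, dif_pos h]
  simp only [LinearMap.comp_apply, MultilinearMap.toLinearMap_apply,
    AlternatingMap.coe_multilinearMap]
  change Matrix.detRowAlternating _ =
    Matrix.detRowAlternating (fun j i => φ i (wallFamily n W u (h.some j) (s i)))
  congr 1
  ext j i
  by_cases hj : j = h.some.symm none
  · subst hj
    simp [wallFamily]
  · rw [Function.update_of_ne hj]
    obtain ⟨k, hk⟩ : ∃ k, h.some j = some k := by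
      rw [← Option.ne_none_iff_exists']
      intro h'
      exact hj (by rw [← h', Equiv.symm_apply_apply])
    simp [wallFamily, hk]

theorem wallDet_eq_zero_of_evalForms {n : E → N} {s : ι → E}
    {φ : ι → Module.Dual ℝ (RealSpace N)} (W : Finset (Finset E)) {u : E → RealSpace N}
    (hu : evalForms s φ u = 0) : wallDet n s φ W u = 0 := by
  rw [wallDet]
  split_ifs
  · rw [LinearMap.comp_apply, hu, map_zero]
  · rfl

/-- The linear form of a wall vanishes on the wall. -/
theorem wallDet_clusterVec (n : E → N) (s : ι → E) (φ : ι → Module.Dual ℝ (RealSpace N))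
    {W : Finset (Finset E)} {A : Finset E} (hA : A ∈ W) : wallDet n s φ W (clusterVec n A) = 0 := by
  by_cases h : Nonempty (ι ≃ Option (W ⊕ Fin (Module.finrank ℤ N)))
  · rw [wallDet_apply n s φ h]
    refine Matrix.det_zero_of_row_eq (i := h.some.symm none)
      (j := h.some.symm (some (Sum.inl ⟨A, hA⟩))) (by simp) ?_
    ext i
    simp [wallFamily]
  · rw [wallDet, dif_neg h]; rfl

/-- The linear form of a wall vanishes on translations, which preserve the wall. -/
theorem wallDet_const (n : E → N) (s : ι → E) (φ : ι → Module.Dual ℝ (RealSpace N))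
    (W : Finset (Finset E)) (v : RealSpace N) :
    wallDet n s φ W (Function.const E v) = 0 := by
  by_cases h : Nonempty (ι ≃ Option (W ⊕ Fin (Module.finrank ℤ N)))
  · let c : RealSpace N →ₗ[ℝ] (E → RealSpace N) := LinearMap.pi fun _ => LinearMap.id
    suffices hz : (wallDet n s φ W).comp c = 0 from LinearMap.congr_fun hz v
    refine (Algebra.TensorProduct.basis ℝ (Module.finBasis ℤ N)).ext fun j => ?_
    change wallDet n s φ W (Function.const E (stdVec N j)) = 0
    rw [wallDet_apply n s φ h]
    refine Matrix.det_zero_of_row_eq (i := h.some.symm none)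
      (j := h.some.symm (some (Sum.inr j))) (by simp) ?_
    ext i
    simp [wallFamily]
  · rw [wallDet, dif_neg h]; rfl

/-- The determinant of the evaluation map on a cone is obtained, up to a sign independent of the
linear forms, by evaluating the linear form of a wall on the remaining edge. -/
theorem exists_evalDet_eq_wallDet (T : LabelledTree E) (n : E → N) (e₀ : E)
    (hι : Fintype.card ι = Fintype.card T.BoundedEdge + Module.finrank ℤ N) {A : Finset E}
    (hA : A ∈ inner e₀ (hier T e₀)) : ∃ σ : ℝ, σ * σ = 1 ∧
      ∀ (s : ι → E) (φ : ι → Module.Dual ℝ (RealSpace N)), evalDet T n e₀ s φ =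
        σ * wallDet n s φ ((inner e₀ (hier T e₀)).erase A) (clusterVec n A) := by
  set W := (inner e₀ (hier T e₀)).erase A
  let κ := edgeEquiv T e₀
  let θ : Option (W ⊕ Fin (Module.finrank ℤ N)) → T.BoundedEdge ⊕ Fin (Module.finrank ℤ N) :=
    fun k => k.elim (Sum.inl (κ.symm ⟨A, hA⟩))
      (Sum.map (fun B => κ.symm ⟨B.1, mem_of_mem_erase B.2⟩) id)
  have hθ : Function.Bijective θ := by
    constructor
    · rintro (_ | B | j) (_ | B' | j') h
      · rfl
      · have h1 := congrArg Subtype.val (κ.symm.injective (Sum.inl_injective h))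
        exact absurd h1.symm (mem_erase.1 B'.2).1
      · simp [θ] at h
      · have h1 := congrArg Subtype.val (κ.symm.injective (Sum.inl_injective h))
        exact absurd h1 (mem_erase.1 B.2).1
      · have h1 := congrArg Subtype.val (κ.symm.injective (Sum.inl_injective h))
        have h2 : B = B' := Subtype.ext h1
        rw [h2]
      · simp [θ] at h
      · simp [θ] at h
      · simp [θ] at h
      · have h1 := Sum.inr_injective h
        simp only [id_eq] at h1
        rw [h1]
    · rintro (γ | j)
      · by_cases hγ : (κ γ).1 = A
        · refine ⟨none, ?_⟩
          simp only [θ, Option.elim_none, Sum.inl.injEq]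
          rw [Equiv.symm_apply_eq]
          exact Subtype.ext hγ.symm
        · refine ⟨some (Sum.inl ⟨(κ γ).1, mem_erase.2 ⟨hγ, (κ γ).2⟩⟩), ?_⟩
          simp [θ]
      · exact ⟨some (Sum.inr j), rfl⟩
  have hfam : ∀ k, edgeFamily T n e₀ (θ k) = wallFamily n W (clusterVec n A) k := by
    have hκ : ∀ B : inner e₀ (hier T e₀), cluster T e₀ (κ.symm B).1 = B.1 := fun B => by
      have := congrArg Subtype.val (κ.apply_symm_apply B)
      exact this
    rintro (_ | B | j)
    · simp only [θ, edgeFamily, wallFamily, Option.elim_none, Sum.elim_inl, hκ]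
    · simp only [θ, edgeFamily, wallFamily, Option.elim_some, Sum.elim_inl, Sum.map_inl, hκ]
    · rfl
  have h : Nonempty (ι ≃ T.BoundedEdge ⊕ Fin (Module.finrank ℤ N)) := by
    rw [← Fintype.card_eq, hι]; simp
  have h' : Nonempty (ι ≃ Option (W ⊕ Fin (Module.finrank ℤ N))) :=
    ⟨h.some.trans (Equiv.ofBijective θ hθ).symm⟩
  -- the two determinants differ by the order of their columns only
  let π : Equiv.Perm ι := (h.some.trans (Equiv.ofBijective θ hθ).symm).trans h'.some.symm
  refine ⟨((Equiv.Perm.sign π : ℤ) : ℝ), ?_, fun s φ => ?_⟩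
  · rw [← Int.cast_mul, ← Units.val_mul, Int.units_mul_self]; simp
  · rw [evalDet_eq h, wallDet_apply n s φ h', ← Matrix.det_permute, ← Matrix.det_transpose]
    congr 1
    ext j i
    simp only [Matrix.transpose_apply, Matrix.of_apply, Matrix.submatrix_apply, id_eq, ← hfam]
    have : θ (h'.some (π j)) = h.some j := by
      simp only [π, Equiv.trans_apply, Equiv.apply_symm_apply]
      exact (Equiv.ofBijective θ hθ).apply_symm_apply _
    rw [this]

end Eval

/-! ### The multiplicity of the `ω`-problem -/

section ToReal

variable {N : Type*} [AddCommGroup N]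

theorem toReal_add (a b : N) : toReal (a + b) = toReal a + toReal b := TensorProduct.tmul_add _ _ _

theorem toReal_zero : toReal (0 : N) = 0 := TensorProduct.tmul_zero _ _

theorem toReal_neg (a : N) : toReal (-a) = -toReal a := TensorProduct.tmul_neg _ _

theorem toReal_sum {α : Type*} (s : Finset α) (f : α → N) :
    toReal (∑ i ∈ s, f i) = ∑ i ∈ s, toReal (f i) := TensorProduct.tmul_sum _ _ _

end ToReal

section OmegaForms

variable {V : Type*} [AddCommGroup V] [Module ℝ V] [FiniteDimensional ℝ V]

/-- The common kernel of the `f i` is a plane containing `u` and `δ`; in this plane, `η` vanishes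
only along `u`. -/
theorem exists_smul_of_forms_eq_zero {d : ℕ} (hr : Module.finrank ℝ V = d + 2)
    {f : Fin d → Module.Dual ℝ V} (hf : LinearIndependent ℝ f) {η : Module.Dual ℝ V} {u δ : V}
    (hfu : ∀ i, f i u = 0) (hfδ : ∀ i, f i δ = 0) (hηu : η u = 0) (hηδ : η δ ≠ 0) (hu : u ≠ 0)
    {z : V} (hfz : ∀ i, f i z = 0) (hηz : η z = 0) : ∃ a : ℝ, z = a • u := by
  let K : Submodule ℝ V := (Submodule.span ℝ (Set.range f)).dualCoannihilator
  have hmem : ∀ x, x ∈ K ↔ ∀ i, f i x = 0 := by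
    intro x
    rw [Submodule.mem_dualCoannihilator]
    constructor
    · intro h i
      exact h _ (Submodule.subset_span ⟨i, rfl⟩)
    · intro h φ hφ
      induction hφ using Submodule.span_induction with
      | mem φ hφ => obtain ⟨i, rfl⟩ := hφ; exact h i
      | zero => rfl
      | add φ ψ _ _ h1 h2 => rw [LinearMap.add_apply, h1, h2, add_zero]
      | smul c φ _ h1 => rw [LinearMap.smul_apply, h1, smul_zero]
  have hK : Module.finrank ℝ K = 2 := by
    have h1 := Subspace.finrank_add_finrank_dualCoannihilator_eq (Submodule.span ℝ (Set.range f))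
    rw [finrank_span_eq_card hf, Fintype.card_fin, hr] at h1
    change d + Module.finrank ℝ K = d + 2 at h1
    omega
  let w : Fin 2 → K := ![⟨u, (hmem u).2 hfu⟩, ⟨δ, (hmem δ).2 hfδ⟩]
  have hw : LinearIndependent ℝ w := by
    rw [LinearIndependent.pair_iff]
    intro a b hab
    have h1 : a • u + b • δ = 0 := congrArg Subtype.val hab
    have h2 := congrArg η h1
    rw [map_add, map_smul, map_smul, hηu, smul_zero, zero_add, map_zero, smul_eq_mul] at h2
    have hb := (mul_eq_zero.1 h2).resolve_right hηδ
    rw [hb, zero_smul, add_zero] at h1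
    exact ⟨(smul_eq_zero.1 h1).resolve_right hu, hb⟩
  have hspan := hw.span_eq_top_of_card_eq_finrank (by rw [hK, Fintype.card_fin])
  have hz : (⟨z, (hmem z).2 hfz⟩ : K) ∈ Submodule.span ℝ (Set.range w) := by
    rw [hspan]; trivial
  rw [Matrix.range_cons, Matrix.range_cons, Matrix.range_empty, Set.union_empty,
    Set.singleton_union, Submodule.mem_span_pair] at hz
  obtain ⟨a, b, hab⟩ := hz
  have h1 : a • u + b • δ = z := congrArg Subtype.val hab
  have h2 := congrArg η h1
  rw [map_add, map_smul, map_smul, hηu, smul_zero, zero_add, hηz, smul_eq_mul] at h2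
  have hb := (mul_eq_zero.1 h2).resolve_right hηδ
  exact ⟨a, by rw [← h1, hb, zero_smul, add_zero]⟩

/-- The determinant of `f`, `ω (x, -)` and `ω (u, -)` is proportional to `ω (x, u)`. -/
theorem exists_det_forms_eq {d : ℕ} (hr : Module.finrank ℝ V = d + 2)
    {f : Fin d → Module.Dual ℝ V} (hf : LinearIndependent ℝ f) (ω : LinearMap.BilinForm ℝ V)
    (hω : ω.IsAlt) {u δ : V} (hfu : ∀ i, f i u = 0) (hfδ : ∀ i, f i δ = 0)
    (hδ : ω u ≠ 0 → ω u δ ≠ 0) (b : Fin d ⊕ Fin 2 → V) : ∃ c : ℝ, ∀ x : V,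
      Matrix.det (Matrix.of fun i k : Fin d ⊕ Fin 2 =>
        (Sum.elim f ![ω x, ω u] i : Module.Dual ℝ V) (b k)) = c * ω x u := by
  let coord : Module.Dual ℝ V →ₗ[ℝ] (Fin d ⊕ Fin 2 → ℝ) :=
    LinearMap.pi fun k => LinearMap.applyₗ (b k)
  -- the determinant as a linear form `g` of the row `m = ω x`; it is the evaluation at a vector
  -- `z`, which is proportional to `u` since `g` vanishes on the other rows
  let g : Module.Dual ℝ V →ₗ[ℝ] ℝ := (Matrix.detRowAlternating.toMultilinearMap.toLinearMap
    (fun i => coord (Sum.elim f ![0, ω u] i)) (Sum.inr 0)).comp coord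
  have hg : ∀ m, g m = Matrix.detRowAlternating fun i => coord (Sum.elim f ![m, ω u] i) := by
    intro m
    simp only [g, LinearMap.comp_apply, MultilinearMap.toLinearMap_apply,
      AlternatingMap.coe_multilinearMap]
    congr 1
    ext1 i
    rcases i with j | i
    · rw [Function.update_of_ne (by simp)]; rfl
    · fin_cases i
      · simp
      · rw [Function.update_of_ne (by simp)]; rfl
  by_cases hη : ω u = 0
  · refine ⟨0, fun x => ?_⟩
    rw [zero_mul]
    refine Matrix.det_eq_zero_of_row_eq_zero (Sum.inr 1) fun k => ?_
    simp [hη]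
  · obtain ⟨z, hz⟩ := (Module.evalEquiv ℝ V).surjective g
    have hz' : ∀ m, g m = m z := fun m => by
      rw [← hz]; rfl
    have h1 : ∀ i, f i z = 0 := fun i => by
      rw [← hz', hg]
      exact AlternatingMap.map_eq_zero_of_eq _ _ (i := Sum.inl i) (j := Sum.inr 0) rfl (by simp)
    have h2 : ω u z = 0 := by
      rw [← hz', hg]
      exact AlternatingMap.map_eq_zero_of_eq _ _ (i := Sum.inr 1) (j := Sum.inr 0) rfl (by simp)
    obtain ⟨a, rfl⟩ := exists_smul_of_forms_eq_zero hr hf hfu hfδ (hω u) (hδ hη)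
      (fun h => hη (by rw [h, map_zero])) h1 h2
    refine ⟨a, fun x => ?_⟩
    have h3 := hz' (ω x)
    rw [hg, map_smul, smul_eq_mul] at h3
    exact h3

end OmegaForms

variable {E : Type*} [Fintype E] {N : Type*} [AddCommGroup N]

/-- The total slope of a set of ends. -/
def slopeSum (n : E → N) (A : Finset E) : N := ∑ e ∈ A, n e

theorem slopeSum_union (n : E → N) {A B : Finset E} (h : Disjoint A B) :
    slopeSum n (A ∪ B) = slopeSum n A + slopeSum n B := Finset.sum_union h

/-- The total moment of the ends in `A`, when they move along the vector of the cluster `B`. -/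
theorem sum_moment (n : E → N) {ω : LinearMap.BilinForm ℝ (RealSpace N)} (A B : Finset E) :
    ∑ e ∈ A, ω (toReal (n e)) (clusterVec n B e) =
      ω (toReal (slopeSum n (A ∩ B))) (toReal (slopeSum n B)) := by
  have h1 : ∀ e ∈ A, ω (toReal (n e)) (clusterVec n B e) =
      if e ∈ B then ω (toReal (n e)) (toReal (slopeSum n B)) else 0 := by
    intro e _
    by_cases h : e ∈ B <;> simp [clusterVec, h, slopeSum]
  rw [Finset.sum_congr rfl h1, ← Finset.sum_filter, Finset.filter_mem_eq_inter]
  have h2 : toReal (slopeSum n (A ∩ B)) = ∑ e ∈ A ∩ B, toReal (n e) := toReal_sum _ _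
  rw [h2, map_sum, LinearMap.sum_apply]

/-- Lengthening the edge with cluster `B` changes the total moment of the ends in `A` only if `A` is
strictly contained in `B`: otherwise these ends do not move, or their total moment changes by
`ω(x, x)`, where `x` is the slope of the edge. -/
theorem sum_moment_of_not_lt {e₀ : E} {H : Finset (Finset E)} (hH : IsHierarchy e₀ H) (n : E → N)
    {ω : LinearMap.BilinForm ℝ (RealSpace N)} (hω : ω.IsAlt) {A B : Finset E} (hA : A ∈ H)
    (hB : B ∈ H) (h : ¬ A ⊂ B) : ∑ e ∈ A, ω (toReal (n e)) (clusterVec n B e) = 0 := by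
  rw [sum_moment]
  rcases hH.laminar A hA B hB with h1 | h1 | h1
  · have : A = B := by
      by_contra hne
      exact h (lt_of_le_of_ne h1 hne)
    rw [this, inter_self]
    exact hω _
  · rw [inter_eq_right.2 h1]
    exact hω _
  · rw [Finset.disjoint_iff_inter_eq_empty.1 h1]
    simp [slopeSum, toReal_zero]

theorem sum_moment_of_subset (n : E → N) {ω : LinearMap.BilinForm ℝ (RealSpace N)}
    {A B : Finset E} (h : A ⊆ B) : ∑ e ∈ A, ω (toReal (n e)) (clusterVec n B e) =
      ω (toReal (slopeSum n A)) (toReal (slopeSum n B)) := by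
  rw [sum_moment, inter_eq_left.2 h]

/-- The indicator function of a set of ends, on the rows of the `ω`-problem. -/
def rowIndicator (e₀ : E) (d : ℕ) (A : Finset E) : Fin d ⊕ {e : E // e ≠ e₀} → ℤ :=
  Sum.elim (fun _ => 0) fun e => if e.1 ∈ A then 1 else 0

section RowOps

variable {e₀ : E} {H : Finset (Finset E)} {d : ℕ}

/-- The row operations adding up the moments of the ends in the first child of each vertex, and the
moments of all ends. -/
def rowOps (e₀ : E) (H : Finset (Finset E)) (d : ℕ) (ch : Finset E → Finset E) :
    Matrix (inner e₀ H ⊕ (Fin d ⊕ Fin 2)) (Fin d ⊕ {e : E // e ≠ e₀}) ℤ :=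
  Matrix.of (Sum.elim (fun A => rowIndicator e₀ d (ch A))
    (Sum.elim (fun j => Pi.single (Sum.inl j) 1)
      ![rowIndicator e₀ d (ch {e₀}ᶜ), rowIndicator e₀ d {e₀}ᶜ]))

/-- By induction starting from `{e₀}ᶜ`: the indicator of a cluster that is not a first child is the
difference of the indicators of its parent and of its sibling. -/
theorem rowIndicator_mem_span (hH : IsHierarchy e₀ H) (hb : IsBinary e₀ H)
    {ch : Finset E → Finset E} (hch : ∀ A ∈ nodes e₀ H, ch A ∈ H ∧ A \ ch A ∈ H ∧ ch A ⊆ A)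
    {B : Finset E} (hB : B ∈ H) (h0 : e₀ ∉ B) :
    rowIndicator e₀ d B ∈ Submodule.span ℤ (Set.range (rowOps e₀ H d ch)) := by
  have hrow : ∀ A ∈ nodes e₀ H,
      rowIndicator e₀ d (ch A) ∈ Submodule.span ℤ (Set.range (rowOps e₀ H d ch)) := by
    intro A hA
    by_cases hne : A = {e₀}ᶜ
    · exact Submodule.subset_span ⟨Sum.inr (Sum.inr 0), by rw [hne]; rfl⟩
    · exact Submodule.subset_span ⟨Sum.inl ⟨A, mem_erase.2 ⟨hne, hA⟩⟩, rfl⟩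
  induction hm : Bᶜ.card using Nat.strong_induction_on generalizing B with
  | _ m ih =>
    by_cases hne : B = {e₀}ᶜ
    · exact Submodule.subset_span ⟨Sum.inr (Sum.inr 1), by rw [hne]; rfl⟩
    obtain ⟨Z, hZ, hd, hP⟩ := exists_sibling hH hb hB h0 hne
    have hPH := mem_filter.1 hP
    obtain ⟨c1, c2, c3⟩ := hch _ hP
    have hlt : (B ∪ Z)ᶜ.card < m := by
      rw [← hm]
      refine card_lt_card (compl_ssubset_compl.2 (lt_of_le_of_ne subset_union_left fun h => ?_))
      obtain ⟨z, hz⟩ := hH.nonempty Z hZ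
      have : z ∈ B := h ▸ mem_union_right _ hz
      exact Finset.disjoint_left.1 hd this hz
    have hP' := ih _ hlt hPH.1 hPH.2.1 rfl
    rcases hH.children_unique hB hZ c1 c2 hd disjoint_sdiff rfl
      (by rw [union_sdiff_of_subset c3]) with ⟨h1, -⟩ | ⟨h1, h2⟩
    · rw [h1]; exact hrow _ hP
    · have : rowIndicator e₀ d B = rowIndicator e₀ d (B ∪ Z) - rowIndicator e₀ d Z := by
        ext i
        rcases i with j | e
        · simp [rowIndicator]
        · have hBZ : e.1 ∈ B → e.1 ∉ Z := fun h => Finset.disjoint_left.1 hd h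
          by_cases hx : e.1 ∈ B
          · simp [rowIndicator, hx, hBZ hx]
          · simp [rowIndicator, hx]
      rw [this]
      refine Submodule.sub_mem _ hP' ?_
      have := hrow _ hP
      rwa [← h2] at this

/-- The row operations are unimodular. -/
theorem abs_det_rowOps (hH : IsHierarchy e₀ H) (hb : IsBinary e₀ H)
    {ch : Finset E → Finset E} (hch : ∀ A ∈ nodes e₀ H, ch A ∈ H ∧ A \ ch A ∈ H ∧ ch A ⊆ A)
    (κ : Fin d ⊕ {e : E // e ≠ e₀} ≃ inner e₀ H ⊕ (Fin d ⊕ Fin 2)) :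
    |((rowOps e₀ H d ch).submatrix κ id).det| = 1 := by
  have hmem : ∀ i, Pi.single i 1 ∈ Submodule.span ℤ (Set.range (rowOps e₀ H d ch)) := by
    rintro (j | e)
    · exact Submodule.subset_span ⟨Sum.inr (Sum.inl j), rfl⟩
    · have h1 := rowIndicator_mem_span (d := d) hH hb hch (hH.singleton_mem e.1 e.2)
        (by simpa using e.2.symm)
      convert h1 using 1
      ext i
      rcases i with j | e'
      · simp [rowIndicator]
      · simp [rowIndicator, Pi.single_apply, Subtype.ext_iff]
  choose c hc using fun i => (Submodule.mem_span_range_iff_exists_fun ℤ).1 (hmem i)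
  have hmul : ((Matrix.of c).submatrix id κ) * ((rowOps e₀ H d ch).submatrix κ id) = 1 := by
    rw [Matrix.submatrix_mul_equiv, Matrix.submatrix_id_id]
    ext i k
    rw [Matrix.mul_apply, Matrix.one_apply]
    have := congrFun (hc i) k
    rw [Finset.sum_apply] at this
    simp only [Pi.smul_apply, smul_eq_mul] at this
    rw [Pi.single_apply] at this
    simp only [Matrix.of_apply]
    rw [this]
    simp only [eq_comm]
  have hdet := congrArg Matrix.det hmul
  rw [Matrix.det_mul, Matrix.det_one] at hdet
  exact Int.isUnit_iff_abs_eq.1 (IsUnit.of_mul_eq_one_right _ hdet)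

end RowOps

theorem sum_rowIndicator_mul {e₀ : E} {d : ℕ} {A : Finset E} (h0 : e₀ ∉ A) (g : Fin d → ℝ)
    (X : E → ℝ) : ∑ i, ((rowIndicator e₀ d A i : ℤ) : ℝ) *
      Sum.elim g (fun e : {e : E // e ≠ e₀} => X e.1) i = ∑ e ∈ A, X e := by
  rw [Fintype.sum_sum_type]
  simp only [rowIndicator, Sum.elim_inl, Int.cast_zero, zero_mul, Finset.sum_const_zero,
    Sum.elim_inr, zero_add, Int.cast_ite, Int.cast_one, ite_mul, one_mul]
  rw [← Finset.sum_subtype_of_mem (p := fun e => e ≠ e₀) X (fun e he h => h0 (h ▸ he)),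
    ← Finset.sum_filter]
  refine Finset.sum_congr ?_ fun _ _ => rfl
  ext e
  simp

variable [Module.Free ℤ N] [Module.Finite ℤ N]

theorem finrank_realSpace : Module.finrank ℝ (RealSpace N) = Module.finrank ℤ N :=
  Module.finrank_baseChange

theorem slopeSum_top {n : E → N} (hsum : ∑ e, n e = 0) (e₀ : E) :
    slopeSum n {e₀}ᶜ = -n e₀ := by
  have h := Finset.sum_add_sum_compl {e₀} n
  rw [Finset.sum_singleton, hsum] at h
  exact (neg_eq_of_add_eq_zero_right h).symm

/-- The multiplicity of a trivalent tree in the `ω`-problem is, up to a common constant, the product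
of the `|ω(π_V)|` over its vertices. Adding up the moments of the ends beyond the first child of
each vertex makes the evaluation matrix triangular. -/
theorem exists_abs_evalDet_omega {d : ℕ} (hdr : d + 2 = Module.finrank ℤ N)
    (hE : 3 ≤ Fintype.card E) (n : E → N) (hsum : ∑ e, n e = 0)
    {ω : LinearMap.BilinForm ℝ (RealSpace N)} (hω : ω.IsAlt)
    (e₀ : E) (δ : N) (hδ : ω (toReal (n e₀)) ≠ 0 → ω (toReal (n e₀)) (toReal δ) ≠ 0)
    {f : Fin d → Module.Dual ℝ (RealSpace N)}
    (hf : LinearIndependent ℝ f) (hf₀ : ∀ i, f i (toReal (n e₀)) = 0 ∧ f i (toReal δ) = 0) :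
    ∃ C : ℝ, ∀ T : LabelledTree E, T.Trivalent →
      |evalDet T n e₀ (omegaEnd e₀) (omegaForm n ω e₀ f)| =
        C * ∏ A ∈ nodes e₀ (hier T e₀), childTerm (hier T e₀)
          (fun B C => |ω (toReal (slopeSum n B)) (toReal (slopeSum n C))|) A := by
  let e2 : Fin d ⊕ Fin 2 ≃ Fin (Module.finrank ℤ N) := finSumFinEquiv.trans (finCongr hdr)
  let b : Fin d ⊕ Fin 2 → RealSpace N := fun k => stdVec N (e2 k)
  let u : RealSpace N := toReal (slopeSum n {e₀}ᶜ)
  have hu : u = -toReal (n e₀) := by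
    simp only [u]; rw [slopeSum_top hsum, toReal_neg]
  obtain ⟨c, hc⟩ := exists_det_forms_eq (V := RealSpace N) (finrank_realSpace.trans hdr.symm) hf ω
    hω (u := u) (δ := toReal δ) (fun i => by rw [hu, map_neg, (hf₀ i).1, neg_zero])
    (fun i => (hf₀ i).2) (by
      rw [hu, map_neg, LinearMap.neg_apply, neg_ne_zero, neg_ne_zero]; exact hδ) b
  refine ⟨|c|, fun T hT => ?_⟩
  set H := hier T e₀ with hHdef
  have hH : IsHierarchy e₀ H := isHierarchy_hier T e₀
  have hb : IsBinary e₀ H := (trivalent_iff_isBinary T e₀).1 hT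
  have hex : ∀ A, ∃ B, A ∈ nodes e₀ H → B ∈ H ∧ A \ B ∈ H ∧ B ⊆ A := by
    intro A
    by_cases hA : A ∈ nodes e₀ H
    · obtain ⟨B, hB, C, hC, hd, rfl⟩ := hb A hA
      exact ⟨B, fun _ => ⟨hB, by rwa [union_sdiff_cancel_left hd], subset_union_left⟩⟩
    · exact ⟨∅, fun h => absurd h hA⟩
  -- a choice of a first child for each vertex
  choose ch hch using hex
  have htop : {e₀}ᶜ ∈ nodes e₀ H := top_mem_nodes hE hH
  have hch0 : ∀ A ∈ nodes e₀ H, e₀ ∉ ch A := fun A hA h =>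
    (mem_filter.1 hA).2.1 ((hch A hA).2.2 h)
  have hterm : ∀ A ∈ nodes e₀ H, childTerm H
      (fun B C => |ω (toReal (slopeSum n B)) (toReal (slopeSum n C))|) A =
        |ω (toReal (slopeSum n (ch A))) (toReal (slopeSum n A))| := by
    intro A hA
    obtain ⟨h1, h2, h3⟩ := hch A hA
    have hsplit : A = ch A ∪ A \ ch A := (union_sdiff_of_subset h3).symm
    have hn : slopeSum n A = slopeSum n (ch A) + slopeSum n (A \ ch A) := by
      conv_lhs => rw [hsplit]
      exact slopeSum_union n disjoint_sdiff
    rw [hn, toReal_add, map_add, hω, zero_add]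
    conv_lhs => rw [hsplit]
    refine childTerm_eq hH (fun B C => ?_) h1 h2 disjoint_sdiff
    rw [← hω.neg_eq, abs_neg]
  have h : Nonempty (Fin d ⊕ {e : E // e ≠ e₀} ≃
      T.BoundedEdge ⊕ Fin (Module.finrank ℤ N)) := by
    rw [← Fintype.card_eq, Fintype.card_sum, Fintype.card_sum, Fintype.card_fin, Fintype.card_fin,
      Fintype.card_subtype_compl, Fintype.card_subtype_eq]
    have h1 := card_boundedEdge hE T
    have h2 := (trivalent_iff_k T e₀).1 hT
    omega
  let κ : Fin d ⊕ {e : E // e ≠ e₀} ≃ inner e₀ H ⊕ (Fin d ⊕ Fin 2) :=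
    h.some.trans (Equiv.sumCongr (edgeEquiv T e₀) e2.symm)
  let col : inner e₀ H ⊕ (Fin d ⊕ Fin 2) → E → RealSpace N :=
    Sum.elim (fun A => clusterVec n A.1) fun k => Function.const E (b k)
  let M : Matrix (Fin d ⊕ {e : E // e ≠ e₀}) (inner e₀ H ⊕ (Fin d ⊕ Fin 2)) ℝ :=
    Matrix.of fun i k => omegaForm n ω e₀ f i (col k (omegaEnd e₀ i))
  have hdet : evalDet T n e₀ (omegaEnd e₀) (omegaForm n ω e₀ f) = (M.submatrix id κ).det := by
    rw [evalDet_eq h]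
    congr 1
    ext i j
    simp only [Matrix.of_apply, Matrix.submatrix_apply, id_eq, M, κ, Equiv.trans_apply]
    rcases h.some j with γ | j
    · rfl
    · simp [edgeFamily, col, b]
  let P : Matrix (inner e₀ H ⊕ (Fin d ⊕ Fin 2)) (Fin d ⊕ {e : E // e ≠ e₀}) ℝ :=
    (rowOps e₀ H d ch).map (Int.castRingHom ℝ)
  have hP : |(P.submatrix κ id).det| = 1 := by
    have h1 := abs_det_rowOps (d := d) hH hb hch κ
    have h2 : P.submatrix κ id =
        (Int.castRingHom ℝ).mapMatrix ((rowOps e₀ H d ch).submatrix κ id) := rfl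
    rw [h2, ← RingHom.map_det, eq_intCast, ← Int.cast_abs, h1, Int.cast_one]
  have habs : |evalDet T n e₀ (omegaEnd e₀) (omegaForm n ω e₀ f)| = |(P * M).det| := by
    have h1 : (P * M).submatrix κ κ = P.submatrix κ id * M.submatrix id κ :=
      Matrix.submatrix_mul P M κ id κ Function.bijective_id
    rw [← Matrix.det_submatrix_equiv_self κ, h1, Matrix.det_mul, abs_mul, hP, one_mul, hdet]
  have hM : ∀ k, (fun i => M i k) = Sum.elim (fun j => f j (col k e₀))
      (fun e : {e : E // e ≠ e₀} => ω (toReal (n e.1)) (col k e.1)) := by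
    intro k
    ext i
    rcases i with j | e <;> rfl
  have hMi : ∀ i k, M i k = Sum.elim (fun j => f j (col k e₀))
      (fun e : {e : E // e ≠ e₀} => ω (toReal (n e.1)) (col k e.1)) i := fun i k =>
    congrFun (hM k) i
  have row : ∀ A, e₀ ∉ A → ∀ k, ∑ i, ((rowIndicator e₀ d A i : ℤ) : ℝ) * M i k =
      ∑ e ∈ A, ω (toReal (n e)) (col k e) := by
    intro A hA k
    simp only [hMi]
    exact sum_rowIndicator_mul hA _ fun e => ω (toReal (n e)) (col k e)
  have ent1 : ∀ (A : inner e₀ H) k, (P * M) (Sum.inl A) k =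
      ∑ e ∈ ch A.1, ω (toReal (n e)) (col k e) := fun A k => by
    rw [Matrix.mul_apply]
    exact row _ (hch0 _ (mem_of_mem_erase A.2)) k
  have ent2 : ∀ j k, (P * M) (Sum.inr (Sum.inl j)) k = f j (col k e₀) := fun j k => by
    rw [Matrix.mul_apply, Finset.sum_eq_single (Sum.inl j)]
    · simp [P, rowOps, hMi]
    · intro i _ hi
      simp [P, rowOps, Pi.single_eq_of_ne hi]
    · simp
  have ent3 : ∀ k, (P * M) (Sum.inr (Sum.inr 0)) k =
      ∑ e ∈ ch {e₀}ᶜ, ω (toReal (n e)) (col k e) := fun k => by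
    rw [Matrix.mul_apply]
    exact row _ (hch0 _ htop) k
  have ent4 : ∀ k, (P * M) (Sum.inr (Sum.inr 1)) k =
      ∑ e ∈ {e₀}ᶜ, ω (toReal (n e)) (col k e) := fun k => by
    rw [Matrix.mul_apply]
    exact row _ (by simp) k
  have hsubtop : ∀ B ∈ nodes e₀ H, B ⊆ {e₀}ᶜ := by
    intro B hB e he
    rw [mem_compl, mem_singleton]
    rintro rfl
    exact (mem_filter.1 hB).2.1 he
  have hmemH : ∀ {B}, B ∈ nodes e₀ H → B ∈ H := fun hB => (mem_filter.1 hB).1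
  -- lengthening a bounded edge does not move `e₀`, and it does not change the total moments of
  -- `{e₀}ᶜ` and of its first child, which are strictly contained in no inner cluster
  have h21 : (P * M).toBlocks₂₁ = 0 := by
    ext i B
    have hB := mem_erase.1 B.2
    change (P * M) (Sum.inr i) (Sum.inl B) = 0
    rcases i with j | i
    · rw [ent2]
      have : e₀ ∉ B.1 := (mem_filter.1 hB.2).2.1
      simp [col, clusterVec, this]
    · fin_cases i
      · refine (ent3 _).trans ?_
        obtain ⟨h1, h2, h3⟩ := hch _ htop
        refine sum_moment_of_not_lt hH n hω h1 (hmemH hB.2) fun hlt => ?_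
        rcases hH.eq_or_eq_of_between h1 h2 (hmemH hB.2) disjoint_sdiff hlt.1
          (by rw [union_sdiff_of_subset h3]; exact hsubtop _ hB.2) with h4 | h4
        · exact hlt.ne h4.symm
        · rw [union_sdiff_of_subset h3] at h4
          exact hB.1 h4
      · refine (ent4 _).trans ?_
        exact sum_moment_of_not_lt hH n hω hH.top_mem (hmemH hB.2) fun hlt =>
          hlt.2 (hsubtop _ hB.2)
  -- the moment of the first child of a vertex only depends on the edges between this vertex and the
  -- root: grading the clusters by their cardinalities makes this block triangular
  have h11 : ((P * M).toBlocks₁₁).det = ∏ A : inner e₀ H,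
      ω (toReal (slopeSum n (ch A.1))) (toReal (slopeSum n A.1)) := by
    rw [det_eq_prod_diag _ fun A => A.1.card]
    · refine Finset.prod_congr rfl fun A _ => ?_
      change (P * M) (Sum.inl A) (Sum.inl A) = _
      rw [ent1]
      exact sum_moment_of_subset n (hch _ (mem_of_mem_erase A.2)).2.2
    · intro A B hne hAB
      have hA := mem_of_mem_erase A.2
      have hB := mem_of_mem_erase B.2
      change (P * M) (Sum.inl A) (Sum.inl B) ≠ 0 at hne
      rw [ent1] at hne
      obtain ⟨h1, h2, h3⟩ := hch _ hA
      have hlt : ch A.1 ⊂ B.1 := by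
        by_contra h
        exact hne (sum_moment_of_not_lt hH n hω h1 (hmemH hB) h)
      rcases hH.laminar _ (hmemH hA) _ (hmemH hB) with h4 | h4 | h4
      · exact card_lt_card (lt_of_le_of_ne h4 fun h => hAB (Subtype.ext h))
      · rcases hH.eq_or_eq_of_between h1 h2 (hmemH hB) disjoint_sdiff hlt.1
          (by rw [union_sdiff_of_subset h3]; exact h4) with h5 | h5
        · exact absurd h5.symm hlt.ne
        · rw [union_sdiff_of_subset h3] at h5
          exact absurd (Subtype.ext h5.symm) hAB
      · obtain ⟨x, hx⟩ := hH.nonempty _ h1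
        exact absurd (hlt.1 hx) (Finset.disjoint_left.1 h4 (h3 hx))
  -- translations: here the `r - 2` forms and the moments of the vertex adjacent to `e₀` matter
  have h22 : ((P * M).toBlocks₂₂).det =
      c * ω (toReal (slopeSum n (ch {e₀}ᶜ))) (toReal (slopeSum n {e₀}ᶜ)) := by
    rw [← hc]
    congr 1
    ext i k
    change (P * M) (Sum.inr i) (Sum.inr k) = _
    have hs : ∀ A, ∑ e ∈ A, ω (toReal (n e)) (b k) = ω (toReal (slopeSum n A)) (b k) := by
      intro A
      have h2 : toReal (slopeSum n A) = ∑ e ∈ A, toReal (n e) := toReal_sum _ _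
      rw [h2, map_sum, LinearMap.sum_apply]
    rcases i with j | i
    · rw [ent2]; rfl
    · fin_cases i
      · exact (ent3 _).trans (hs _)
      · exact (ent4 _).trans (hs _)
  rw [habs, ← Matrix.fromBlocks_toBlocks (P * M), h21, Matrix.det_fromBlocks_zero₂₁, h11, h22,
    ← Finset.prod_erase_mul _ _ htop, hterm _ htop, abs_mul, abs_mul, Finset.abs_prod]
  have hprod : ∏ A : inner e₀ H, |ω (toReal (slopeSum n (ch A.1))) (toReal (slopeSum n A.1))| =
      ∏ A ∈ (nodes e₀ H).erase {e₀}ᶜ, childTerm H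
        (fun B C => |ω (toReal (slopeSum n B)) (toReal (slopeSum n C))|) A := by
    rw [Finset.prod_congr rfl fun A hA => hterm A (mem_of_mem_erase hA)]
    exact Finset.prod_coe_sort (inner e₀ H)
      fun A => |ω (toReal (slopeSum n (ch A))) (toReal (slopeSum n A))|
  rw [hprod]
  ring

/-- Reordering the linear forms does not change the absolute value of the determinant. -/
theorem abs_evalDet_comp_equiv {ι ι' : Type*} [Fintype ι] [Fintype ι'] (T : LabelledTree E)
    (n : E → N) (e₀ : E) (s : ι → E) (φ : ι → Module.Dual ℝ (RealSpace N)) (o : ι' ≃ ι) :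
    |evalDet T n e₀ (s ∘ o) (φ ∘ o)| = |evalDet T n e₀ s φ| := by
  by_cases h : Nonempty (ι ≃ T.BoundedEdge ⊕ Fin (Module.finrank ℤ N))
  · have h' : Nonempty (ι' ≃ T.BoundedEdge ⊕ Fin (Module.finrank ℤ N)) := ⟨o.trans h.some⟩
    rw [evalDet_eq h, evalDet_eq h', ← Matrix.abs_det_submatrix_equiv_equiv o
      (h'.some.trans h.some.symm)]
    congr 2
    ext i j
    simp
  · have h' : ¬ Nonempty (ι' ≃ T.BoundedEdge ⊕ Fin (Module.finrank ℤ N)) :=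
      fun ⟨g⟩ => h ⟨o.symm.trans g⟩
    rw [evalDet, evalDet, dif_neg h, dif_neg h']

/-! ### Determinants are continuous functions of the Plücker vectors -/

section Continuity

variable {E : Type*} [Fintype E] {N : Type*} [AddCommGroup N] [Module.Free ℤ N] [Module.Finite ℤ N]
  {n : E → N} {l : E → ℕ}

/-- Linear forms of non-commutative products of linear images of the Plücker vectors are continuous.
No topology on the algebra is needed: the factors are expanded in bases one after the other. -/
theorem continuous_list_prod {A : Type*} [Ring A] [Algebra ℝ A]
    (T : ∀ e, ⋀[ℝ]^(l e) (perp (n e)) →ₗ[ℝ] A) (ls : List E) (φ : A →ₗ[ℝ] ℝ) :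
    Continuous fun p : PluckerSpace n l => φ (ls.map fun e => T e (p e)).prod := by
  letI : ∀ e, TopologicalSpace (⋀[ℝ]^(l e) (perp (n e))) := fun e => moduleTopology ℝ _
  have hmod : ∀ e, IsModuleTopology ℝ (⋀[ℝ]^(l e) (perp (n e))) := fun e => ⟨rfl⟩
  have hev : ∀ e, @Continuous (PluckerSpace n l) (⋀[ℝ]^(l e) (perp (n e))) _ _ (fun p => p e) :=
    fun e =>
    @continuous_apply E (fun e => ⋀[ℝ]^(l e) (perp (n e))) (fun e => moduleTopology ℝ _) e
  induction ls generalizing φ with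
  | nil => exact continuous_of_const fun _ _ => rfl
  | cons e ls ih =>
    let b := Module.finBasis ℝ (⋀[ℝ]^(l e) (perp (n e)))
    have key : ∀ p : PluckerSpace n l, φ ((e :: ls).map fun e => T e (p e)).prod =
        ∑ k, b.coord k (p e) * (φ.comp (LinearMap.mulLeft ℝ (T e (b k))))
          (ls.map fun e => T e (p e)).prod := by
      intro p
      rw [List.map_cons, List.prod_cons]
      conv_lhs => rw [← b.sum_repr (p e), map_sum, Finset.sum_mul, map_sum]
      refine Finset.sum_congr rfl fun k _ => ?_
      rw [map_smul, smul_mul_assoc, map_smul, smul_eq_mul]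
      rfl
    simp only [key]
    refine continuous_finsetSum _ fun k _ => Continuous.mul ?_ (ih _)
    exact (IsModuleTopology.continuous_of_linearMap (b.coord k)).comp (hev e)

/-- A determinant whose rows depend linearly on the forms `L.form e k` is a continuous function of
the Plücker vectors: it is a linear form of the product of these vectors in an exterior algebra. -/
theorem exists_continuous_det (z : (Σ e : E, Fin (l e)) → E → RealSpace N) :
    ∃ F : PluckerSpace n l → ℝ, Continuous F ∧ ∀ L : Slopes n l,
      F L.plucker = Matrix.det (Matrix.of fun j i => L.forms i (z j i.1)) := by
  let J := Σ e : E, Fin (l e)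
  let R : ∀ e, perp (n e) →ₗ[ℝ] (J → ℝ) := fun e =>
    LinearMap.pi fun j => (LinearMap.applyₗ (z j e)).comp (perp (n e)).subtype
  -- the rows coming from the end `e` enter through the image of its Plücker vector
  let T : ∀ e, ⋀[ℝ]^(l e) (perp (n e)) →ₗ[ℝ] ExteriorAlgebra ℝ (J → ℝ) := fun e =>
    (ExteriorAlgebra.map (R e)).toLinearMap.comp (Submodule.subtype _)
  -- the ends are ordered arbitrarily, since the exterior algebra is not commutative
  let ls : List E := (univ : Finset E).toList
  let JL : List J := ls.flatMap fun e => List.ofFn fun k => (⟨e, k⟩ : J)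
  have hmem : ∀ i : J, i ∈ JL := by
    rintro ⟨e, k⟩
    simp only [JL, ls, List.mem_flatMap, List.mem_ofFn, Finset.mem_toList]
    exact ⟨e, Finset.mem_univ e, k, rfl⟩
  have hnd : JL.Nodup := by
    rw [List.nodup_flatMap]
    refine ⟨fun e _ => List.nodup_ofFn.2 fun k k' h => eq_of_heq (Sigma.mk.inj h).2, ?_⟩
    refine (Finset.nodup_toList _).imp fun {e e'} hne => ?_
    rw [Function.onFun, List.disjoint_left]
    intro i hi hi'
    obtain ⟨k, rfl⟩ := List.mem_ofFn.1 hi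
    obtain ⟨k', h⟩ := List.mem_ofFn.1 hi'
    exact hne (congrArg Sigma.fst h).symm
  let κ : Fin JL.length ≃ J := hnd.getEquivOfForallMemList JL hmem
  let g : (J → ℝ) [⋀^Fin JL.length]→ₗ[ℝ] ℝ := Matrix.detRowAlternating.domDomCongr κ.symm
  let vol : ExteriorAlgebra ℝ (J → ℝ) →ₗ[ℝ] ℝ :=
    ExteriorAlgebra.liftAlternating (Pi.single JL.length g)
  refine ⟨fun p => vol (ls.map fun e => T e (p e)).prod, continuous_list_prod T ls vol,
    fun L => ?_⟩
  let row : J → J → ℝ := fun i => R i.1 (L.form i.1 i.2)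
  have h1 : (ls.map fun e => T e (L.plucker e)).prod =
      (JL.map fun i => ExteriorAlgebra.ι ℝ (row i)).prod := by
    rw [List.map_flatMap, List.flatMap_def, List.prod_flatten, List.map_map]
    congr 2
    ext1 e
    change ExteriorAlgebra.map (R e) (ExteriorAlgebra.ιMulti ℝ (l e) (L.form e)) = _
    rw [ExteriorAlgebra.map_apply_ιMulti, ExteriorAlgebra.ιMulti_apply]
    change _ = ((List.ofFn fun k => (⟨e, k⟩ : J)).map fun i => ExteriorAlgebra.ι ℝ (row i)).prod
    rw [List.map_ofFn]
    rfl
  have h2 : (JL.map fun i => ExteriorAlgebra.ι ℝ (row i)).prod =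
      ExteriorAlgebra.ιMulti ℝ JL.length (row ∘ κ) := by
    rw [ExteriorAlgebra.ιMulti_apply]
    congr 1
    conv_lhs => rw [← List.ofFn_get JL, List.map_ofFn]
    rfl
  change vol (ls.map fun e => T e (L.plucker e)).prod = _
  rw [h1, h2, ExteriorAlgebra.liftAlternating_apply_ιMulti, Pi.single_eq_same,
    AlternatingMap.domDomCongr_apply, ← Matrix.det_transpose]
  have : (row ∘ κ) ∘ κ.symm = row := by ext i; simp
  rw [this]
  rfl

end Continuity

/-! ### Refined multiplicities through clusters -/

section Wedge

variable {E : Type*} [Fintype E] {N : Type*} [AddCommGroup N] (n : E → N)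
  (ω : LinearMap.BilinForm ℝ (RealSpace N))

theorem wedge_add_left (a b c : N) : wedge (a + b) c = wedge a c + wedge b c := by
  simpa [wedge] using
    (exteriorPower.ιMulti ℤ 2 (M := N)).map_vecCons_add (m := ![c]) (x := a) (y := b)

theorem wedge_self (a : N) : wedge a a = 0 :=
  (exteriorPower.ιMulti ℤ 2 (M := N)).map_eq_zero_of_eq _ (i := 0) (j := 1) rfl (by simp)

theorem wedge_swap (a b : N) : wedge b a = -wedge a b := by
  have h := (exteriorPower.ιMulti ℤ 2 (M := N)).map_swap ![a, b] (i := 0) (j := 1) (by simp)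
  rw [wedge, wedge, ← h]
  congr 1
  ext i; fin_cases i <;> rfl

theorem wedge_add_right (a b c : N) : wedge a (b + c) = wedge a b + wedge a c := by
  rw [wedge_swap, wedge_add_left, wedge_swap a b, wedge_swap a c]; abel

theorem wedge_neg_right (a b : N) : wedge a (-b) = -wedge a b := by
  have h := wedge_add_right a b (-b)
  have h0 : wedge a (0 : N) = 0 := by
    have := wedge_add_right a 0 0
    simpa using this
  rw [add_neg_cancel, h0] at h
  exact (neg_eq_of_add_eq_zero_right h.symm).symm

theorem qDiff_eq_of_wedge_eq {a b a' b' : N} (h : wedge a b = wedge a' b') :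
    qDiff n ω a b = qDiff n ω a' b' := by rw [qDiff, qDiff, h]

theorem qDiff_eq_neg_of_wedge_eq {a b a' b' : N} (h : wedge a b = -wedge a' b') :
    qDiff n ω a b = -qDiff n ω a' b' := by rw [qDiff, qDiff, h, neg_neg, neg_sub]

theorem qDiff_swap (a b : N) : qDiff n ω b a = -qDiff n ω a b :=
  qDiff_eq_neg_of_wedge_eq n ω (wedge_swap a b)

theorem qDiff_eq_zero {a b : N} (h : wedge a b ∈ kernelLattice n ω) : qDiff n ω a b = 0 := by
  have h1 : (kernelLattice n ω).mkQ (wedge a b) = 0 := (Submodule.Quotient.mk_eq_zero _).2 h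
  rw [qDiff, map_neg, h1, neg_zero, sub_self]

/-- The factor of a vertex with outgoing slopes `a` and `b` in the refined multiplicity: the sign of
`ω(a, b)` takes care of the orientation of `a ∧ b`. -/
def signedQDiff (a b : N) : RefinedRing n ω :=
  (SignType.sign (ω (toReal a) (toReal b)) : ℤ) • qDiff n ω a b

variable {ω}

theorem signedQDiff_congr {a b a' b' : N}
    (h : (wedge a b = wedge a' b' ∧ ω (toReal a) (toReal b) = ω (toReal a') (toReal b')) ∨
      (wedge a b = -wedge a' b' ∧ ω (toReal a) (toReal b) = -ω (toReal a') (toReal b'))) :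
    signedQDiff n ω a b = signedQDiff n ω a' b' := by
  rcases h with ⟨h1, h2⟩ | ⟨h1, h2⟩
  · rw [signedQDiff, signedQDiff, h2, qDiff_eq_of_wedge_eq n ω h1]
  · rw [signedQDiff, signedQDiff, h2, qDiff_eq_neg_of_wedge_eq n ω h1, Left.sign_neg]
    simp

theorem signedQDiff_swap (hω : ω.IsAlt) (a b : N) :
    signedQDiff n ω a b = signedQDiff n ω b a :=
  signedQDiff_congr n (Or.inr ⟨wedge_swap b a, (hω.neg_eq _ _).symm⟩)

/-- The skein relation between the three resolutions of a four-valent vertex with slopes `a`, `b`,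
`c` away from the root: an identity of polynomials in `q^{a ∧ b}`, `q^{b ∧ c}`, `q^{c ∧ a}` and
their inverses. -/
theorem qDiff_relation (a b c : N) :
    qDiff n ω a b * qDiff n ω (a + b) c + qDiff n ω b c * qDiff n ω (b + c) a +
      qDiff n ω c a * qDiff n ω (c + a) b = 0 := by
  let q : (⋀[ℤ]^2 N) → RefinedRing n ω := fun π =>
    AddMonoidAlgebra.single ((kernelLattice n ω).mkQ π) 1
  have hq : ∀ π π', q (π + π') = q π * q π' := fun π π' => by
    simp only [q]
    rw [map_add, AddMonoidAlgebra.single_mul_single, mul_one]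
  have h : ∀ x y z : N, qDiff n ω x y * qDiff n ω (x + y) z =
      (q (wedge x y) - q (-wedge x y)) *
        (q (wedge y z) * q (-wedge z x) - q (-wedge y z) * q (wedge z x)) := by
    intro x y z
    rw [← hq, ← hq]
    change (q _ - q _) * (q _ - q _) = _
    rw [wedge_add_left, wedge_swap z x, neg_add, neg_neg, add_comm (-wedge z x),
      add_comm (wedge z x)]
  rw [h, h, h]
  ring

end Wedge

section Vertex

variable {E : Type*} [Fintype E] {N : Type*} [AddCommGroup N] {n : E → N}
  {ω : LinearMap.BilinForm ℝ (RealSpace N)} {T : LabelledTree E} {e₀ : E}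

theorem slopeFrom_child (P : Rooting T.graph (Sum.inl e₀)) {v : Fin T.k} {b : E ⊕ Fin T.k}
    (hb : b ≠ Sum.inl e₀) (hp : P.par b = Sum.inr v) :
    T.slopeFrom n (Sum.inr v) s(Sum.inr v, b) = slopeSum n (P.leaves b) := by
  rw [LabelledTree.slopeFrom, slopeSum]
  refine Finset.sum_congr ?_ fun _ _ => rfl
  have h0 : ¬ P.Anc b (Sum.inr v) := fun h => by
    have h1 := P.rank_lt b hb
    rw [hp] at h1
    exact absurd h.rank_le (not_le.2 h1)
  ext e
  rw [mem_filter, P.mem_leaves, Sym2.eq_swap, ← hp, LabelledTree.Separates,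
    P.reachable_deleteEdges_iff hb, hp]
  simp [h0]

/-- By balancing, the slope towards `e₀` is opposite to the total slope of the ends beyond the
vertex. -/
theorem slopeFrom_par (P : Rooting T.graph (Sum.inl e₀)) (hsum : ∑ e, n e = 0) (v : Fin T.k) :
    T.slopeFrom n (Sum.inr v) s(Sum.inr v, P.par (Sum.inr v)) =
      -slopeSum n (P.leaves (Sum.inr v)) := by
  have h1 := Finset.sum_add_sum_compl (P.leaves (Sum.inr v)) n
  rw [hsum] at h1
  rw [slopeSum, neg_eq_of_add_eq_zero_right h1, LabelledTree.slopeFrom]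
  refine Finset.sum_congr ?_ fun _ _ => rfl
  ext e
  rw [mem_filter, mem_compl, P.mem_leaves, LabelledTree.Separates,
    P.reachable_deleteEdges_iff (by simp)]
  simp [Rooting.Anc.refl P (Sum.inr v)]

/-- At a trivalent vertex, the bivector of the two chosen slopes is, up to orientation, the bivector
of the slopes of the two edges leading away from `e₀`. -/
theorem wedge_slopes_eq (P : Rooting T.graph (Sum.inl e₀)) (hsum : ∑ e, n e = 0) (hω : ω.IsAlt)
    {v : Fin T.k} {B C : Finset E} (hB : B ∈ hier T e₀) (hC : C ∈ hier T e₀) (hd : Disjoint B C)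
    (hU : B ∪ C = P.leaves (Sum.inr v)) :
    (wedge (T.slopeA n v) (T.slopeB n v) = wedge (slopeSum n B) (slopeSum n C) ∧
      ω (toReal (T.slopeA n v)) (toReal (T.slopeB n v)) =
        ω (toReal (slopeSum n B)) (toReal (slopeSum n C))) ∨
    (wedge (T.slopeA n v) (T.slopeB n v) = -wedge (slopeSum n B) (slopeSum n C) ∧
      ω (toReal (T.slopeA n v)) (toReal (T.slopeB n v)) =
        -ω (toReal (slopeSum n B)) (toReal (slopeSum n C))) := by
  obtain ⟨b, c, hbc, hch, rfl, rfl⟩ := P.exists_children_of_disjoint hB hC hd hU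
  have hb : b ∈ ({b, c} : Set _) := Or.inl rfl
  have hc : c ∈ ({b, c} : Set _) := Or.inr rfl
  rw [← hch] at hb hc
  have sb := slopeFrom_child (n := n) P hb.1 hb.2
  have sc := slopeFrom_child (n := n) P hc.1 hc.2
  have sp := slopeFrom_par (n := n) P hsum v
  rw [← hU, slopeSum_union n hd] at sp
  obtain ⟨h1, h2, hne⟩ := (T.exists_two_neighbors v).choose_spec
  change T.graph.Adj _ (T.twoNeighbors v).1 at h1
  change T.graph.Adj _ (T.twoNeighbors v).2 at h2
  change (T.twoNeighbors v).1 ≠ (T.twoNeighbors v).2 at hne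
  have hnb := P.neighborSet_inr v
  rw [hch] at hnb
  have m1 : (T.twoNeighbors v).1 ∈ T.graph.neighborSet (Sum.inr v) := h1
  have m2 : (T.twoNeighbors v).2 ∈ T.graph.neighborSet (Sum.inr v) := h2
  rw [hnb] at m1 m2
  set x := slopeSum n (P.leaves b)
  set y := slopeSum n (P.leaves c)
  have wx : wedge x (-(x + y)) = -wedge x y := by
    rw [wedge_neg_right, wedge_add_right, wedge_self, zero_add]
  have wy : wedge y (-(x + y)) = wedge x y := by
    rw [wedge_neg_right, wedge_add_right, wedge_self, add_zero, wedge_swap, neg_neg]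
  have ox : ω (toReal x) (toReal (-(x + y))) = -ω (toReal x) (toReal y) := by
    rw [toReal_neg, toReal_add, map_neg, map_add, hω, zero_add]
  have oy : ω (toReal y) (toReal (-(x + y))) = ω (toReal x) (toReal y) := by
    rw [toReal_neg, toReal_add, map_neg, map_add, hω, add_zero, hω.neg_eq]
  have oyx : ω (toReal y) (toReal x) = -ω (toReal x) (toReal y) := (hω.neg_eq _ _).symm
  have sw : ∀ z : N, wedge (-(x + y)) z = -wedge z (-(x + y)) := fun z => wedge_swap _ _
  have so : ∀ z : N, ω (toReal (-(x + y))) (toReal z) = -ω (toReal z) (toReal (-(x + y))) :=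
    fun z => (hω.neg_eq _ _).symm
  rw [LabelledTree.slopeA, LabelledTree.slopeB]
  rcases m1 with m1 | m1 | m1 <;> rcases m2 with m2 | m2 | m2
  · exact absurd (m1.trans m2.symm) hne
  · rw [m1, m2, sp, sb, sw, so, wx, ox, neg_neg, neg_neg]; exact Or.inl ⟨rfl, rfl⟩
  · rw [m1, m2, sp, sc, sw, so, wy, oy]; exact Or.inr ⟨rfl, rfl⟩
  · rw [m1, m2, sp, sb, wx, ox]; exact Or.inr ⟨rfl, rfl⟩
  · exact absurd (m1.trans m2.symm) hne
  · rw [m1, m2, sb, sc]; exact Or.inl ⟨rfl, rfl⟩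
  · rw [m1, m2, sp, sc, wy, oy]; exact Or.inl ⟨rfl, rfl⟩
  · rw [m1, m2, sb, sc, wedge_swap, oyx]; exact Or.inr ⟨rfl, rfl⟩
  · exact absurd (m1.trans m2.symm) hne

/-- The kernel lattice contains the bivectors of the vertices on which `ω` vanishes. -/
theorem wedge_mem_kernelLattice (hsum : ∑ e, n e = 0) (hω : ω.IsAlt) (hT : T.Trivalent)
    {B C : Finset E} (hB : B ∈ hier T e₀) (hC : C ∈ hier T e₀) (hd : Disjoint B C)
    (hU : B ∪ C ∈ nodes e₀ (hier T e₀))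
    (h0 : ω (toReal (slopeSum n B)) (toReal (slopeSum n C)) = 0) :
    wedge (slopeSum n B) (slopeSum n C) ∈ kernelLattice n ω := by
  obtain ⟨P⟩ := exists_rooting_end T e₀
  obtain ⟨v, hv⟩ := (P.mem_nodes_iff _).1 hU
  have h := wedge_slopes_eq P hsum hω hB hC hd hv.symm
  rw [h0, neg_zero] at h
  have hz : ω (toReal (T.slopeA n v)) (toReal (T.slopeB n v)) = 0 := by
    rcases h with h | h <;> exact h.2
  have hm : wedge (T.slopeA n v) (T.slopeB n v) ∈ kernelLattice n ω :=
    Submodule.subset_span ⟨T, v, hT v, hz, rfl⟩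
  rcases h with h | h
  · rwa [← h.1]
  · rwa [h.1, Submodule.neg_mem_iff] at hm

/-- The refined multiplicity of a trivalent tree, in terms of its hierarchy. -/
def refinedHier (e₀ : E) (n : E → N) (ω : LinearMap.BilinForm ℝ (RealSpace N))
    (H : Finset (Finset E)) : RefinedRing n ω :=
  ∏ A ∈ nodes e₀ H, childTerm H (fun B C => signedQDiff n ω (slopeSum n B) (slopeSum n C)) A

/-- The edges chosen in `refinedMult` at each vertex can be replaced by those leading away from
`e₀`. -/
theorem refinedMult_eq (hsum : ∑ e, n e = 0) (hω : ω.IsAlt) (hT : T.Trivalent) (e₀ : E) :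
    refinedMult T n ω = refinedHier e₀ n ω (hier T e₀) := by
  obtain ⟨P⟩ := exists_rooting_end T e₀
  have hH := isHierarchy_hier T e₀
  have hb := (trivalent_iff_isBinary T e₀).1 hT
  rw [refinedMult, refinedHier]
  refine Finset.prod_bij (fun v _ => P.leaves (Sum.inr v))
    (fun v _ => (P.mem_nodes_iff _).2 ⟨v, rfl⟩)
    (fun v _ w _ h => Sum.inr_injective (P.leaves_injective h))
    (fun A hA => by
      obtain ⟨v, hv⟩ := (P.mem_nodes_iff _).1 hA
      exact ⟨v, mem_univ _, hv⟩) fun v _ => ?_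
  obtain ⟨B, hB, C, hC, hd, hU⟩ := hb _ ((P.mem_nodes_iff _).2 ⟨v, rfl⟩)
  rw [← hU, childTerm_eq hH (fun B C => signedQDiff_swap n hω _ _) hB hC hd,
    ← signedQDiff_congr n (wedge_slopes_eq P hsum hω hB hC hd hU), signedQDiff]
  rcases lt_trichotomy (ω (toReal (T.slopeA n v)) (toReal (T.slopeB n v))) 0 with h | h | h
  · rw [if_neg h.not_gt, sign_neg h, qDiff_swap]; simp
  · have hm : wedge (T.slopeA n v) (T.slopeB n v) ∈ kernelLattice n ω :=
      Submodule.subset_span ⟨T, v, hT v, h, rfl⟩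
    rw [if_neg h.not_gt, qDiff_swap, qDiff_eq_zero n ω hm]; simp
  · rw [if_pos h, sign_pos h]; simp

end Vertex

/-! ### The relations around a wall -/

section Wall

variable {E : Type*} [Fintype E] {N : Type*} [AddCommGroup N] [Module.Free ℤ N] [Module.Finite ℤ N]
  {ι : Type*} [Fintype ι] {n : E → N} {s : ι → E} {φ : ι → Module.Dual ℝ (RealSpace N)} {e₀ : E}
  {H : Finset (Finset E)} {A₁ A₂ A₃ : Finset E}

/-- An end moving along itself satisfies the same constraints. -/
theorem evalForms_clusterVec_singleton (hφ : ∀ i, φ i (toReal (n (s i))) = 0) (e : E) :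
    evalForms s φ (clusterVec n {e}) = 0 := by
  ext i
  rw [evalForms_apply, clusterVec, Finset.sum_singleton]
  split_ifs with h
  · rw [mem_singleton] at h
    rw [← h, hφ]; rfl
  · rw [map_zero]; rfl

/-- Moving all ends but `e₀` by `-n e₀` amounts to moving `e₀` along itself, up to a translation. -/
theorem evalForms_clusterVec_top (hφ : ∀ i, φ i (toReal (n (s i))) = 0) (hsum : ∑ e, n e = 0) :
    evalForms s φ (clusterVec n {e₀}ᶜ + Function.const E (toReal (n e₀))) = 0 := by
  rw [← evalForms_clusterVec_singleton hφ e₀]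
  congr 1
  ext1 e
  have h : ∑ e ∈ {e₀}ᶜ, n e = -n e₀ := slopeSum_top hsum e₀
  simp only [Pi.add_apply, clusterVec, h, Function.const_apply, mem_compl, mem_singleton,
    Finset.sum_singleton, toReal_neg]
  split_ifs <;> simp

/-- The linear form of the wall obtained by removing the cluster `A` vanishes on all other clusters,
including those of the unbounded edges. -/
theorem wallDet_clusterVec_of_mem (hφ : ∀ i, φ i (toReal (n (s i))) = 0) (hsum : ∑ e, n e = 0)
    {A B : Finset E} (hH : IsHierarchy e₀ H) (hB : B ∈ H) (h0 : e₀ ∉ B) (hne : B ≠ A) :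
    wallDet n s φ ((inner e₀ H).erase A) (clusterVec n B) = 0 := by
  by_cases h2 : 2 ≤ B.card
  · by_cases ht : B = {e₀}ᶜ
    · have h := wallDet_eq_zero_of_evalForms (n := n) ((inner e₀ H).erase A)
        (evalForms_clusterVec_top (e₀ := e₀) hφ hsum)
      rwa [map_add, wallDet_const, add_zero, ← ht] at h
    · exact wallDet_clusterVec n s φ
        (mem_erase.2 ⟨hne, mem_erase.2 ⟨ht, mem_filter.2 ⟨hB, h0, h2⟩⟩⟩)
  · have h1 := (hH.nonempty _ hB).card_pos
    obtain ⟨e, rfl⟩ := Finset.card_eq_one.1 (show B.card = 1 by omega)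
    exact wallDet_eq_zero_of_evalForms _ (evalForms_clusterVec_singleton hφ e)

/-- The relation between the three cones adjacent to a wall: the directions of their remaining edges
add up to zero modulo the kernel of the linear form of the wall. -/
theorem IsFrame.sum_wallDet (F : IsFrame e₀ H A₁ A₂ A₃) (hφ : ∀ i, φ i (toReal (n (s i))) = 0)
    (hsum : ∑ e, n e = 0) :
    wallDet n s φ ((inner e₀ H).erase (A₁ ∪ A₂)) (clusterVec n (A₁ ∪ A₂)) +
      wallDet n s φ ((inner e₀ H).erase (A₁ ∪ A₂)) (clusterVec n (A₂ ∪ A₃)) +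
      wallDet n s φ ((inner e₀ H).erase (A₁ ∪ A₂)) (clusterVec n (A₃ ∪ A₁)) = 0 := by
  -- both sides move the ends in each `Aᵢ` by the sum of its slope and of the total slope
  have hcv : clusterVec n (A₁ ∪ A₂) + clusterVec n (A₂ ∪ A₃) + clusterVec n (A₃ ∪ A₁) =
      clusterVec n A₁ + clusterVec n A₂ + clusterVec n A₃ + clusterVec n (A₁ ∪ A₂ ∪ A₃) := by
    ext1 e
    have d1 := F.disj₁₂
    have d2 := F.disj₁₃
    have d3 := F.disj₂₃
    have i1 : e ∈ A₁ → e ∉ A₂ := fun h => Finset.disjoint_left.1 d1 h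
    have i2 : e ∈ A₁ → e ∉ A₃ := fun h => Finset.disjoint_left.1 d2 h
    have i3 : e ∈ A₂ → e ∉ A₃ := fun h => Finset.disjoint_left.1 d3 h
    have u1 := slopeSum_union n d1
    have u2 := slopeSum_union n d3
    have u3 := slopeSum_union n d2.symm
    have u4 := slopeSum_union n (Finset.disjoint_union_left.2 ⟨d2, d3⟩)
    rw [u1] at u4
    simp only [slopeSum] at u1 u2 u3 u4
    simp only [Pi.add_apply, clusterVec, u1, u2, u3, u4, mem_union, toReal_add]
    by_cases h1 : e ∈ A₁
    · simp only [h1, i1 h1, i2 h1, true_or, or_true, or_false, if_true, if_false]; abel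
    · by_cases h2 : e ∈ A₂
      · simp only [h1, h2, i3 h2, true_or, or_true, or_false, if_true, if_false]; abel
      · by_cases h3 : e ∈ A₃
        · simp only [h1, h2, h3, or_true, or_false, if_true, if_false]; abel
        · simp [h1, h2, h3]
  have hH := F.isHierarchy
  obtain ⟨⟨a₁, h₁⟩, ⟨a₂, h₂⟩, ⟨a₃, h₃⟩⟩ := F.nonempty
  have n1 : e₀ ∉ A₁ := fun h => F.notMem (mem_union_left _ (mem_union_left _ h))
  have n2 : e₀ ∉ A₂ := fun h => F.notMem (mem_union_left _ (mem_union_right _ h))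
  have n3 : e₀ ∉ A₃ := fun h => F.notMem (mem_union_right _ h)
  rw [← map_add, ← map_add, hcv, map_add, map_add, map_add,
    wallDet_clusterVec_of_mem hφ hsum hH F.mem₁ n1 fun h =>
      Finset.disjoint_left.1 F.disj₁₂ (h ▸ mem_union_right _ h₂) h₂,
    wallDet_clusterVec_of_mem hφ hsum hH F.mem₂ n2 fun h =>
      Finset.disjoint_left.1 F.disj₁₂ h₁ (h ▸ mem_union_left _ h₁),
    wallDet_clusterVec_of_mem hφ hsum hH F.mem₃ n3 fun h =>
      Finset.disjoint_left.1 F.disj₁₃ h₁ (h ▸ mem_union_left _ h₁),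
    wallDet_clusterVec_of_mem hφ hsum hH F.mem₁₂₃ F.notMem F.ne]
  simp

theorem IsHierarchy.trivalent_tree (hH : IsHierarchy e₀ H) (hb : IsBinary e₀ H) :
    hH.tree.Trivalent := by
  rw [trivalent_iff_isBinary _ e₀, hH.hier_tree]; exact hb

/-- Three real numbers with vanishing sum and prescribed absolute values up to a factor have
prescribed signs up to a common sign. -/
theorem sign_coherent {κ d₁ d₂ d₃ t₁ t₂ t₃ : ℝ} (hd : d₁ + d₂ + d₃ = 0) (ht : t₁ + t₂ + t₃ = 0)
    (h₁ : |d₁| = κ * |t₁|) (h₂ : |d₂| = κ * |t₂|) (h₃ : |d₃| = κ * |t₃|) (hκ : 0 ≤ κ) :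
    (d₁ = κ * t₁ ∧ d₂ = κ * t₂ ∧ d₃ = κ * t₃) ∨
      (d₁ = -(κ * t₁) ∧ d₂ = -(κ * t₂) ∧ d₃ = -(κ * t₃)) := by
  have hs : κ * t₁ + κ * t₂ + κ * t₃ = 0 := by rw [← mul_add, ← mul_add, ht, mul_zero]
  have aux : ∀ {d t : ℝ}, |d| = κ * |t| → d = κ * t ∨ d = -(κ * t) := fun {d t} h => by
    rw [← abs_of_nonneg hκ, ← abs_mul, abs_eq_abs] at h; exact h
  rcases aux h₁ with h1 | h1 <;> rcases aux h₂ with h2 | h2 <;> rcases aux h₃ with h3 | h3 <;>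
    first
    | (left; refine ⟨?_, ?_, ?_⟩ <;> linarith)
    | (right; refine ⟨?_, ?_, ?_⟩ <;> linarith)

/-- The refined multiplicities of the three resolutions of a wall, with the signs of the
orientations given by the `ω`-problem, add up to zero. -/
theorem IsFrame.sum_sign_smul_refinedHier (F : IsFrame e₀ H A₁ A₂ A₃) (hsum : ∑ e, n e = 0)
    {ω : LinearMap.BilinForm ℝ (RealSpace N)} (hω : ω.IsAlt)
    (hφ : ∀ i, φ i (toReal (n (s i))) = 0) (hE : 3 ≤ Fintype.card E)
    (hι : Fintype.card ι + 3 = Fintype.card E + Module.finrank ℤ N) {C : ℝ}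
    (hdet : ∀ T : LabelledTree E, T.Trivalent → |evalDet T n e₀ s φ| =
        C * ∏ A ∈ nodes e₀ (hier T e₀), childTerm (hier T e₀)
          (fun B C => |ω (toReal (slopeSum n B)) (toReal (slopeSum n C))|) A)
    {W : Finset (Finset E)} (hW : (inner e₀ H).erase (A₁ ∪ A₂) = W) :
    (SignType.sign (wallDet n s φ W (clusterVec n (A₁ ∪ A₂))) : ℤ) • refinedHier e₀ n ω H +
      (SignType.sign (wallDet n s φ W (clusterVec n (A₂ ∪ A₃))) : ℤ) •
        refinedHier e₀ n ω (flip H A₁ A₂ A₃) +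
      (SignType.sign (wallDet n s φ W (clusterVec n (A₃ ∪ A₁))) : ℤ) •
        refinedHier e₀ n ω (flip (flip H A₁ A₂ A₃) A₂ A₃ A₁) = 0 := by
  have habs : ∀ {K : Finset (Finset E)} {B₁ B₂ B₃ : Finset E}, IsFrame e₀ K B₁ B₂ B₃ →
      |wallDet n s φ ((inner e₀ K).erase (B₁ ∪ B₂)) (clusterVec n (B₁ ∪ B₂))| =
        C * ∏ A ∈ nodes e₀ K, childTerm K
          (fun B C => |ω (toReal (slopeSum n B)) (toReal (slopeSum n C))|) A := by
    intro K B₁ B₂ B₃ G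
    have hT := G.isHierarchy.trivalent_tree G.isBinary
    have hk := (trivalent_iff_k G.isHierarchy.tree e₀).1 hT
    have hb := card_boundedEdge hE G.isHierarchy.tree
    obtain ⟨σ, hσ, h⟩ := exists_evalDet_eq_wallDet G.isHierarchy.tree n e₀ (ι := ι) (by omega)
      (A := B₁ ∪ B₂) (by rw [G.isHierarchy.hier_tree]; exact G.mem_inner)
    have h1 := hdet _ hT
    rw [h, abs_mul, G.isHierarchy.hier_tree] at h1
    have hσ1 : |σ| = 1 := by
      have : |σ| * |σ| = 1 := by rw [← abs_mul, hσ, abs_one]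
      nlinarith [abs_nonneg σ]
    rwa [hσ1, one_mul] at h1
  have G := F.isFrame_flip
  have G' := G.isFrame_flip
  have hW2 : (inner e₀ (flip H A₁ A₂ A₃)).erase (A₂ ∪ A₃) = W := F.inner_erase_flip.trans hW
  have hW3 : (inner e₀ (flip (flip H A₁ A₂ A₃) A₂ A₃ A₁)).erase (A₃ ∪ A₁) = W :=
    G.inner_erase_flip.trans hW2
  -- the vertices away from the wall contribute the common factors `K` and `R`
  obtain ⟨K, k1, k2, k3⟩ := F.exists_prod_nodes_eq
    (θ := fun B C => |ω (toReal (slopeSum n B)) (toReal (slopeSum n C))|)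
    (fun B C => by rw [← hω.neg_eq, abs_neg])
  obtain ⟨R, r1, r2, r3⟩ := F.exists_prod_nodes_eq
    (θ := fun B C => signedQDiff n ω (slopeSum n B) (slopeSum n C))
    (fun B C => signedQDiff_swap n hω _ _)
  have a1 := habs F
  have a2 := habs G
  have a3 := habs G'
  have hrel := F.sum_wallDet hφ hsum (s := s) (φ := φ)
  rw [hW] at a1 hrel
  rw [hW2] at a2
  rw [hW3] at a3
  rw [k1] at a1
  rw [k2] at a2
  rw [k3] at a3
  -- vanishing of a moment makes the corresponding quantum factor vanish
  have hq : ∀ {K : Finset (Finset E)} {B₁ B₂ B₃ : Finset E}, IsFrame e₀ K B₁ B₂ B₃ →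
      ω (toReal (slopeSum n B₁)) (toReal (slopeSum n B₂)) *
        ω (toReal (slopeSum n (B₁ ∪ B₂))) (toReal (slopeSum n B₃)) = 0 →
      qDiff n ω (slopeSum n B₁) (slopeSum n B₂) *
        qDiff n ω (slopeSum n (B₁ ∪ B₂)) (slopeSum n B₃) = 0 := by
    intro K B₁ B₂ B₃ G h
    have hT := G.isHierarchy.trivalent_tree G.isBinary
    have hh := G.isHierarchy.hier_tree
    rcases mul_eq_zero.1 h with h | h
    · rw [qDiff_eq_zero n ω (wedge_mem_kernelLattice (e₀ := e₀) hsum hω hT (hh.symm ▸ G.mem₁)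
        (hh.symm ▸ G.mem₂) G.disj₁₂ (hh.symm ▸ G.mem_nodes₁₂) h), zero_mul]
    · rw [qDiff_eq_zero n ω (wedge_mem_kernelLattice (e₀ := e₀) hsum hω hT (hh.symm ▸ G.mem₁₂)
        (hh.symm ▸ G.mem₃) (Finset.disjoint_union_left.2 ⟨G.disj₁₃, G.disj₂₃⟩)
        (hh.symm ▸ G.mem_nodes₁₂₃) h), mul_zero]
  have q1 := hq F
  have q2 := hq G
  have q3 := hq G'
  have hrelq := qDiff_relation n (ω := ω) (slopeSum n A₁) (slopeSum n A₂) (slopeSum n A₃)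
  rw [← slopeSum_union n F.disj₁₂, ← slopeSum_union n F.disj₂₃,
    ← slopeSum_union n F.disj₁₃.symm] at hrelq
  -- the analogue of the skein relation for the products of the `ω(π_V)`
  have ht : ω (toReal (slopeSum n A₁)) (toReal (slopeSum n A₂)) *
        ω (toReal (slopeSum n (A₁ ∪ A₂))) (toReal (slopeSum n A₃)) +
      ω (toReal (slopeSum n A₂)) (toReal (slopeSum n A₃)) *
        ω (toReal (slopeSum n (A₂ ∪ A₃))) (toReal (slopeSum n A₁)) +
      ω (toReal (slopeSum n A₃)) (toReal (slopeSum n A₁)) *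
        ω (toReal (slopeSum n (A₃ ∪ A₁))) (toReal (slopeSum n A₂)) = 0 := by
    simp only [slopeSum_union n F.disj₁₂, slopeSum_union n F.disj₂₃,
      slopeSum_union n F.disj₁₃.symm, toReal_add, map_add, LinearMap.add_apply]
    rw [← hω.neg_eq (toReal (slopeSum n A₁)) (toReal (slopeSum n A₂)),
      ← hω.neg_eq (toReal (slopeSum n A₂)) (toReal (slopeSum n A₃)),
      ← hω.neg_eq (toReal (slopeSum n A₃)) (toReal (slopeSum n A₁))]
    ring
  set t₁ := ω (toReal (slopeSum n A₁)) (toReal (slopeSum n A₂)) *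
    ω (toReal (slopeSum n (A₁ ∪ A₂))) (toReal (slopeSum n A₃))
  set t₂ := ω (toReal (slopeSum n A₂)) (toReal (slopeSum n A₃)) *
    ω (toReal (slopeSum n (A₂ ∪ A₃))) (toReal (slopeSum n A₁))
  set t₃ := ω (toReal (slopeSum n A₃)) (toReal (slopeSum n A₁)) *
    ω (toReal (slopeSum n (A₃ ∪ A₁))) (toReal (slopeSum n A₂))
  rw [← abs_mul, ← mul_assoc] at a1 a2 a3
  have hpos : ∀ {d t : ℝ}, |d| = C * K * |t| → |d| = |C * K| * |t| := fun {d t} h => by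
    rw [← abs_abs d, h, abs_mul, abs_abs]
  have hR : ∀ a b c d : N, R * (signedQDiff n ω a b * signedQDiff n ω c d) =
      (SignType.sign (ω (toReal a) (toReal b) * ω (toReal c) (toReal d)) : ℤ) •
        (R * (qDiff n ω a b * qDiff n ω c d)) := by
    intro a b c d
    rw [signedQDiff, signedQDiff, sign_mul, SignType.coe_mul, smul_mul_smul_comm, mul_smul_comm]
  rw [hR] at r1 r2 r3
  -- the sign of the determinant and that of the refined multiplicity cancel
  have hsq : ∀ {t : ℝ} {Q : RefinedRing n ω}, (t = 0 → Q = 0) →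
      (SignType.sign t : ℤ) • (SignType.sign t : ℤ) • (R * Q) = R * Q := by
    intro t Q h
    rcases lt_trichotomy t 0 with ht | ht | ht
    · simp [sign_neg ht]
    · simp [h ht]
    · simp [sign_pos ht]
  rw [refinedHier, refinedHier, refinedHier, r1, r2, r3]
  rcases eq_or_lt_of_le (abs_nonneg (C * K)) with h0 | h0
  · have hz : ∀ {d t : ℝ}, |d| = C * K * |t| → d = 0 := fun {d t} h => by
      rw [← abs_eq_zero, hpos h, ← h0, zero_mul]
    rw [hz a1, hz a2, hz a3]
    simp
  · have hsgn : ∀ t : ℝ, SignType.sign (|C * K| * t) = SignType.sign t := fun t => by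
      rw [sign_mul, sign_pos h0, one_mul]
    rcases sign_coherent hrel ht (hpos a1) (hpos a2) (hpos a3) h0.le with
      ⟨e1, e2, e3⟩ | ⟨e1, e2, e3⟩
    · rw [e1, e2, e3, hsgn, hsgn, hsgn, hsq q1, hsq q2, hsq q3, ← mul_add, ← mul_add, hrelq,
        mul_zero]
    · rw [e1, e2, e3, Left.sign_neg, Left.sign_neg, Left.sign_neg, hsgn, hsgn, hsgn,
        SignType.coe_neg, SignType.coe_neg, SignType.coe_neg, neg_smul, neg_smul, neg_smul,
        hsq q1, hsq q2, hsq q3, ← neg_add, ← neg_add, ← mul_add, ← mul_add, hrelq, mul_zero,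
        neg_zero]

end Wall

/-! ### Coordinates on the cones of curves -/

section Cone

variable {E : Type*} [Fintype E] {N : Type*} [AddCommGroup N] {ι : Type*}
  {n : E → N} {s : ι → E} {φ : ι → Module.Dual ℝ (RealSpace N)} {e₀ : E}

/-- The positions of the ends of a curve whose bounded edges have clusters in `I`, the edge with
cluster `A` having length `c A`. -/
def coneVec (n : E → N) (I : Finset (Finset E)) (c : Finset E → ℝ) (b : RealSpace N) :
    E → RealSpace N :=
  ∑ A ∈ I, c A • clusterVec n A + Function.const E b

theorem endPositions_eq_coneVec (T : LabelledTree E) (n : E → N) (e₀ : E) (c : Finset E → ℝ)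
    (b : RealSpace N) : endPositions T n e₀ (fun γ => c (cluster T e₀ γ.1), b) =
      coneVec n (inner e₀ (hier T e₀)) c b := by
  rw [endPositions_apply, coneVec]
  congr 1
  rw [← Finset.sum_coe_sort (inner e₀ (hier T e₀)) fun A => c A • clusterVec n A]
  exact Fintype.sum_equiv (edgeEquiv T e₀) _ _ fun γ => rfl

theorem exists_length_eq (T : LabelledTree E) (e₀ : E) (len : T.BoundedEdge → ℝ) :
    ∃ c : Finset E → ℝ, (fun γ => c (cluster T e₀ γ.1)) = len := by
  refine ⟨fun A => if h : A ∈ inner e₀ (hier T e₀) then len ((edgeEquiv T e₀).symm ⟨A, h⟩) else 0,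
    ?_⟩
  ext γ
  refine (dif_pos (cluster_mem_inner e₀ γ)).trans ?_
  congr 1
  rw [Equiv.symm_apply_eq]
  rfl

theorem coneVec_congr {I : Finset (Finset E)} {c c' : Finset E → ℝ} (h : ∀ A ∈ I, c A = c' A)
    (b : RealSpace N) : coneVec n I c b = coneVec n I c' b := by
  rw [coneVec, coneVec, Finset.sum_congr rfl fun A hA => by rw [h A hA]]

theorem coneVec_of_eq_zero {I K : Finset (Finset E)} {c : Finset E → ℝ} (hK : K ⊆ I)
    (h : ∀ A ∈ I, A ∉ K → c A = 0) (b : RealSpace N) : coneVec n K c b = coneVec n I c b := by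
  rw [coneVec, coneVec, Finset.sum_subset hK fun A hA hA' => by rw [h A hA hA', zero_smul]]

variable [Module.Free ℤ N] [Module.Finite ℤ N] [Fintype ι]

theorem wallDet_coneVec {I : Finset (Finset E)} {A : Finset E} (hA : A ∈ I) (c : Finset E → ℝ)
    (b : RealSpace N) : wallDet n s φ (I.erase A) (coneVec n I c b) =
      c A * wallDet n s φ (I.erase A) (clusterVec n A) := by
  rw [coneVec, map_add, wallDet_const, add_zero, map_sum, Finset.sum_eq_single A]
  · rw [map_smul, smul_eq_mul]
  · intro B hB hne
    rw [map_smul, wallDet_clusterVec n s φ (mem_erase.2 ⟨hne, hB⟩), smul_zero]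
  · exact fun h => absurd hA h

/-- The coordinate of the edge with cluster `A`: the length of this edge on the curve, possibly with
negative lengths, that satisfies given constraints. It has this meaning only if the evaluation map
is invertible on the cone; otherwise the inverted determinant is `0` and so is the coordinate. -/
def edgeCoord (n : E → N) (s : ι → E) (φ : ι → Module.Dual ℝ (RealSpace N))
    (I : Finset (Finset E)) (A : Finset E) : (E → RealSpace N) →ₗ[ℝ] ℝ :=
  (wallDet n s φ (I.erase A) (clusterVec n A))⁻¹ • wallDet n s φ (I.erase A)

theorem edgeCoord_eq {I : Finset (Finset E)} {A : Finset E} (hA : A ∈ I)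
    (h0 : wallDet n s φ (I.erase A) (clusterVec n A) ≠ 0) {c : Finset E → ℝ} {b : RealSpace N}
    {z : E → RealSpace N} (hz : evalForms s φ (coneVec n I c b) = evalForms s φ z) :
    edgeCoord n s φ I A z = c A := by
  have h1 : wallDet n s φ (I.erase A) z = wallDet n s φ (I.erase A) (coneVec n I c b) := by
    rw [← sub_eq_zero, ← map_sub]
    exact wallDet_eq_zero_of_evalForms _ (by rw [map_sub, hz, sub_self])
  rw [edgeCoord, LinearMap.smul_apply, h1, wallDet_coneVec hA, smul_eq_mul]
  field_simp

theorem edgeCoord_clusterVec {I : Finset (Finset E)} {A B : Finset E}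
    (h0 : wallDet n s φ (I.erase A) (clusterVec n A) ≠ 0) (hB : B ∈ I) :
    edgeCoord n s φ I A (clusterVec n B) = if A = B then 1 else 0 := by
  rw [edgeCoord, LinearMap.smul_apply, smul_eq_mul]
  split_ifs with h
  · rw [← h, inv_mul_cancel₀ h0]
  · rw [wallDet_clusterVec n s φ (mem_erase.2 ⟨Ne.symm h, hB⟩), mul_zero]

/-- On a cone where the evaluation map is invertible, all constraints are satisfied by a curve,
possibly with negative lengths. -/
theorem exists_coneVec_eq {T : LabelledTree E} (h0 : evalDet T n e₀ s φ ≠ 0)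
    (z : E → RealSpace N) : ∃ c b,
      evalForms s φ (coneVec n (inner e₀ (hier T e₀)) c b) = evalForms s φ z := by
  obtain ⟨⟨len, b⟩, hp⟩ := (bijective_of_evalDet_ne_zero h0).2 (evalForms s φ z)
  obtain ⟨c, rfl⟩ := exists_length_eq T e₀ len
  refine ⟨c, b, ?_⟩
  rw [← endPositions_eq_coneVec, ← hp, composedEval_eq, LinearMap.comp_apply]

theorem card_eq_of_trivalent (hE : 3 ≤ Fintype.card E)
    (hι : Fintype.card ι + 3 = Fintype.card E + Module.finrank ℤ N) {T : LabelledTree E}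
    (hT : T.Trivalent) :
    Fintype.card ι = Fintype.card T.BoundedEdge + Module.finrank ℤ N := by
  have h1 := card_boundedEdge hE T
  obtain ⟨e⟩ : Nonempty E := Fintype.card_pos_iff.1 (by omega)
  have h2 := (trivalent_iff_k T e).1 hT
  omega

theorem wallDet_ne_zero (hE : 3 ≤ Fintype.card E)
    (hι : Fintype.card ι + 3 = Fintype.card E + Module.finrank ℤ N) {T : LabelledTree E}
    (hT : T.Trivalent) (h0 : evalDet T n e₀ s φ ≠ 0) {A : Finset E}
    (hA : A ∈ inner e₀ (hier T e₀)) :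
    wallDet n s φ ((inner e₀ (hier T e₀)).erase A) (clusterVec n A) ≠ 0 := by
  obtain ⟨σ, -, h⟩ := exists_evalDet_eq_wallDet T n e₀ (card_eq_of_trivalent hE hι hT) hA
  rw [h] at h0
  exact right_ne_zero_of_mul h0

/-- The constraints `z` are satisfied by a curve with set of clusters `W`. -/
def MeetsCone (n : E → N) (s : ι → E) (φ : ι → Module.Dual ℝ (RealSpace N))
    (W : Finset (Finset E)) (z : E → RealSpace N) : Prop :=
  ∃ c b, (∀ A ∈ W, 0 < c A) ∧ evalForms s φ (coneVec n W c b) = evalForms s φ z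

/-- The curve of a type satisfying the constraints exists iff its coordinates are positive. -/
theorem meetsCone_iff (hE : 3 ≤ Fintype.card E)
    (hι : Fintype.card ι + 3 = Fintype.card E + Module.finrank ℤ N) {T : LabelledTree E}
    (hT : T.Trivalent) (h0 : evalDet T n e₀ s φ ≠ 0) (z : E → RealSpace N) :
    MeetsCone n s φ (inner e₀ (hier T e₀)) z ↔
      ∀ A ∈ inner e₀ (hier T e₀), 0 < edgeCoord n s φ (inner e₀ (hier T e₀)) A z := by
  constructor
  · rintro ⟨c, b, hc, h⟩ A hA
    rw [edgeCoord_eq hA (wallDet_ne_zero hE hι hT h0 hA) h]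
    exact hc A hA
  · intro h
    obtain ⟨c, b, hcb⟩ := exists_coneVec_eq h0 z
    refine ⟨c, b, fun A hA => ?_, hcb⟩
    rw [← edgeCoord_eq hA (wallDet_ne_zero hE hι hT h0 hA) hcb]
    exact h A hA

/-- The constraints are satisfied by a curve in the wall where the edge `A` is contracted iff the
coordinate of `A` is zero and the others are positive. -/
theorem meetsCone_erase_iff (hE : 3 ≤ Fintype.card E)
    (hι : Fintype.card ι + 3 = Fintype.card E + Module.finrank ℤ N) {T : LabelledTree E}
    (hT : T.Trivalent) (h0 : evalDet T n e₀ s φ ≠ 0) {A : Finset E}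
    (hA : A ∈ inner e₀ (hier T e₀)) (z : E → RealSpace N) :
    MeetsCone n s φ ((inner e₀ (hier T e₀)).erase A) z ↔
      edgeCoord n s φ (inner e₀ (hier T e₀)) A z = 0 ∧ ∀ B ∈ inner e₀ (hier T e₀), B ≠ A →
        0 < edgeCoord n s φ (inner e₀ (hier T e₀)) B z := by
  constructor
  · rintro ⟨c, b, hc, h⟩
    have h1 : evalForms s φ (coneVec n (inner e₀ (hier T e₀)) (Function.update c A 0) b) =
        evalForms s φ z := by
      rw [← h, ← coneVec_of_eq_zero (erase_subset A _) (fun B hB hB' => ?_)]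
      · rw [coneVec_congr fun B hB => Function.update_of_ne (mem_erase.1 hB).1 _ _]
      · have : B = A := by
          by_contra hne
          exact hB' (mem_erase.2 ⟨hne, hB⟩)
        rw [this, Function.update_self]
    refine ⟨?_, fun B hB hne => ?_⟩
    · rw [edgeCoord_eq hA (wallDet_ne_zero hE hι hT h0 hA) h1, Function.update_self]
    · rw [edgeCoord_eq hB (wallDet_ne_zero hE hι hT h0 hB) h1, Function.update_of_ne hne]
      exact hc B (mem_erase.2 ⟨hne, hB⟩)
  · rintro ⟨h1, h2⟩
    obtain ⟨c, b, hcb⟩ := exists_coneVec_eq h0 z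
    have hc : ∀ B ∈ inner e₀ (hier T e₀),
        edgeCoord n s φ (inner e₀ (hier T e₀)) B z = c B := fun B hB =>
      edgeCoord_eq hB (wallDet_ne_zero hE hι hT h0 hB) hcb
    refine ⟨c, b, fun B hB => ?_, ?_⟩
    · rw [← hc B (mem_of_mem_erase hB)]
      exact h2 B (mem_of_mem_erase hB) (mem_erase.1 hB).1
    · rw [coneVec_of_eq_zero (erase_subset A _) (fun B hB hB' => ?_), hcb]
      have : B = A := by
        by_contra hne
        exact hB' (mem_erase.2 ⟨hne, hB⟩)
      rw [this, ← hc A hA, h1]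

end Cone

/-! ### Wall-crossing -/

section Crossing

variable {E : Type*} [Fintype E] {N : Type*} [AddCommGroup N] [Module.Free ℤ N] [Module.Finite ℤ N]
  {ι : Type*} [Fintype ι] {n : E → N} {s s' : ι → E} {φ φ' : ι → Module.Dual ℝ (RealSpace N)}
  {e₀ : E} {ω : LinearMap.BilinForm ℝ (RealSpace N)}

/-- The multiplicity with which curves of type `T` are counted: the problem `(s, φ)` is the one to
be solved, the sign being given by comparison with the problem `(s', φ')`. -/
def signedMult (n : E → N) (e₀ : E) (s : ι → E) (φ : ι → Module.Dual ℝ (RealSpace N)) (s' : ι → E)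
    (φ' : ι → Module.Dual ℝ (RealSpace N)) (ω : LinearMap.BilinForm ℝ (RealSpace N))
    (T : LabelledTree E) : RefinedRing n ω :=
  (SignType.sign (evalDet T n e₀ s φ * evalDet T n e₀ s' φ') : ℤ) • refinedHier e₀ n ω (hier T e₀)

/-- The signed number of crossings of the segment from `x` to `x + v` with the wall spanned by the
clusters in `W`, multiplied by the signed multiplicity of an adjacent cone in the problem
`(s', φ')`. -/
def crossing (n : E → N) (e₀ : E) (s : ι → E) (φ : ι → Module.Dual ℝ (RealSpace N)) (s' : ι → E)
    (φ' : ι → Module.Dual ℝ (RealSpace N)) (ω : LinearMap.BilinForm ℝ (RealSpace N))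
    (x v : E → RealSpace N) (H : Finset (Finset E)) (A : Finset E) : RefinedRing n ω :=
  (if ∃ t ∈ Set.Ioo (0 : ℝ) 1, MeetsCone n s φ ((inner e₀ H).erase A) (x + t • v) then
      (SignType.sign (wallDet n s φ ((inner e₀ H).erase A) v) : ℤ) else 0) •
    (SignType.sign (wallDet n s' φ' ((inner e₀ H).erase A) (clusterVec n A)) : ℤ) •
      refinedHier e₀ n ω H

/-- The contribution of a type changes by the crossings of the segment with the walls of its cone.
If the problem `(s', φ')` is degenerate on the cone, there is no contribution and no crossing
counts. -/
theorem indicator_sub_eq_sum_crossing (hE : 3 ≤ Fintype.card E)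
    (hι : Fintype.card ι + 3 = Fintype.card E + Module.finrank ℤ N) {T : LabelledTree E}
    (hT : T.Trivalent) (h0 : evalDet T n e₀ s' φ' ≠ 0 → evalDet T n e₀ s φ ≠ 0)
    {x v : E → RealSpace N}
    (hx : evalDet T n e₀ s' φ' ≠ 0 → ∀ A ∈ inner e₀ (hier T e₀),
      edgeCoord n s φ (inner e₀ (hier T e₀)) A x ≠ 0)
    (hv : evalDet T n e₀ s' φ' ≠ 0 → ∀ A ∈ inner e₀ (hier T e₀),
      edgeCoord n s φ (inner e₀ (hier T e₀)) A (x + v) ≠ 0)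
    (hcom : evalDet T n e₀ s' φ' ≠ 0 → ∀ A ∈ inner e₀ (hier T e₀),
      ∀ B ∈ inner e₀ (hier T e₀), A ≠ B → ∀ t : ℝ,
      edgeCoord n s φ (inner e₀ (hier T e₀)) A (x + t • v) = 0 →
      edgeCoord n s φ (inner e₀ (hier T e₀)) B (x + t • v) ≠ 0) :
    (if MeetsCone n s φ (inner e₀ (hier T e₀)) (x + v) then
        signedMult n e₀ s φ s' φ' ω T else 0) -
      (if MeetsCone n s φ (inner e₀ (hier T e₀)) x then
        signedMult n e₀ s φ s' φ' ω T else 0) =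
      ∑ A ∈ inner e₀ (hier T e₀), crossing n e₀ s φ s' φ' ω x v (hier T e₀) A := by
  set I := inner e₀ (hier T e₀) with hI
  have hdet : ∀ A ∈ I, ∃ σ : ℝ, σ * σ = 1 ∧
      ∀ (s : ι → E) (φ : ι → Module.Dual ℝ (RealSpace N)), evalDet T n e₀ s φ =
        σ * wallDet n s φ (I.erase A) (clusterVec n A) := fun A hA =>
    exists_evalDet_eq_wallDet T n e₀ (card_eq_of_trivalent hE hι hT) hA
  by_cases h' : evalDet T n e₀ s' φ' = 0
  · have hz : signedMult n e₀ s φ s' φ' ω T = 0 := by simp [signedMult, h']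
    rw [hz]
    simp only [ite_self, sub_zero]
    refine (Finset.sum_eq_zero fun A hA => ?_).symm
    obtain ⟨σ, hσ, h⟩ := hdet A hA
    rw [h] at h'
    have hσ0 : σ ≠ 0 := by rintro rfl; simp at hσ
    rw [crossing, (mul_eq_zero.1 h').resolve_left hσ0]
    simp
  · have h0 := h0 h'
    have hone : x + v = x + (1 : ℝ) • v := by rw [one_smul]
    have hzero : x = x + (0 : ℝ) • v := by rw [zero_smul, add_zero]
    have key := indicator_sub_indicator_eq_sum_crossings I (fun A => edgeCoord n s φ I A x)
      (fun A => edgeCoord n s φ I A v) zero_le_one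
      (fun A hA => by simpa using hx h' A hA)
      (fun A hA => by simpa using hv h' A hA)
      (fun A hA B hB hne t => by
        have := hcom h' A hA B hB hne t
        simp only [map_add, map_smul, smul_eq_mul] at this
        rwa [mul_comm t, mul_comm t] at this)
    have haff : ∀ (A : Finset E) (t : ℝ), edgeCoord n s φ I A x + edgeCoord n s φ I A v * t =
        edgeCoord n s φ I A (x + t • v) := fun A t => by
      rw [map_add, map_smul, smul_eq_mul, mul_comm]
    simp only [haff] at key
    rw [← hone, ← hzero] at key
    have hpull : ∀ p : Prop, [Decidable p] → (if p then signedMult n e₀ s φ s' φ' ω T else 0) =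
        (if p then (1 : ℤ) else 0) • signedMult n e₀ s φ s' φ' ω T := fun p _ => by
      split_ifs <;> simp
    rw [hpull, hpull, ← sub_smul]
    simp only [hI, meetsCone_iff hE hι hT h0]
    simp only [← hI]
    rw [key, Finset.sum_smul]
    refine Finset.sum_congr rfl fun A hA => ?_
    obtain ⟨σ, hσ, h⟩ := hdet A hA
    rw [crossing, ← hI]
    simp only [hI, meetsCone_erase_iff hE hι hT h0 hA]
    simp only [← hI]
    split_ifs with hc
    · rw [signedMult, smul_smul, smul_smul]
      congr 1
      have hw := wallDet_ne_zero hE hι hT h0 hA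
      rw [← hI] at hw
      rw [h s φ, h s' φ', ← SignType.coe_mul, ← SignType.coe_mul, ← sign_mul, ← sign_mul]
      congr 1
      set w := wallDet n s φ (I.erase A) (clusterVec n A) with hwd
      rw [edgeCoord, LinearMap.smul_apply, smul_eq_mul, ← hwd]
      congr 1
      -- the unknown signs `σ` of the two problems on this cone are equal and cancel
      calc w⁻¹ * wallDet n s φ (I.erase A) v *
            (σ * w * (σ * wallDet n s' φ' (I.erase A) (clusterVec n A)))
          = (w⁻¹ * w) * (σ * σ) * (wallDet n s φ (I.erase A) v *
            wallDet n s' φ' (I.erase A) (clusterVec n A)) := by ring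
        _ = _ := by rw [inv_mul_cancel₀ hw, hσ, one_mul, one_mul]
    · simp

/-- The contributions of the crossings of a wall to the three adjacent cones compensate each other:
the number of crossings is the same for the three of them. -/
theorem IsFrame.sum_crossing {H : Finset (Finset E)} {A₁ A₂ A₃ : Finset E}
    (F : IsFrame e₀ H A₁ A₂ A₃) (hsum : ∑ e, n e = 0) (hω : ω.IsAlt)
    (hφ' : ∀ i, φ' i (toReal (n (s' i))) = 0) (hE : 3 ≤ Fintype.card E)
    (hι : Fintype.card ι + 3 = Fintype.card E + Module.finrank ℤ N) {C : ℝ}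
    (hdet : ∀ T : LabelledTree E, T.Trivalent → |evalDet T n e₀ s' φ'| =
        C * ∏ A ∈ nodes e₀ (hier T e₀), childTerm (hier T e₀)
          (fun B C => |ω (toReal (slopeSum n B)) (toReal (slopeSum n C))|) A)
    (x v : E → RealSpace N) :
    crossing n e₀ s φ s' φ' ω x v H (A₁ ∪ A₂) +
      crossing n e₀ s φ s' φ' ω x v (flip H A₁ A₂ A₃) (A₂ ∪ A₃) +
      crossing n e₀ s φ s' φ' ω x v (flip (flip H A₁ A₂ A₃) A₂ A₃ A₁) (A₃ ∪ A₁) = 0 := by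
  rw [crossing, crossing, crossing, F.isFrame_flip.inner_erase_flip, F.inner_erase_flip,
    ← smul_add, ← smul_add, F.sum_sign_smul_refinedHier hsum hω hφ' hE hι hdet rfl, smul_zero]

end Crossing

section Types

variable {E : Type*} [Fintype E]

theorem hier_tree_mk (T : LabelledTree E) (e₀ : E) :
    hier (CombType.tree (Quotient.mk _ T)) e₀ = hier T e₀ :=
  hier_eq_of_iso e₀ (Quotient.mk_out (s := ⟨LabelledTree.Iso, LabelledTree.iso_equivalence⟩) T)

/-- Combinatorial types are determined by their hierarchies. -/
theorem combType_ext {C C' : CombType E} {e₀ : E} (h : hier C.tree e₀ = hier C'.tree e₀) :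
    C = C' := by
  have h1 : (Quotient.mk ⟨LabelledTree.Iso, LabelledTree.iso_equivalence⟩ C.tree) =
      Quotient.mk ⟨LabelledTree.Iso, LabelledTree.iso_equivalence⟩ C'.tree :=
    Quotient.sound (iso_of_hier_eq h)
  exact (Quotient.out_eq C).symm.trans (h1.trans (Quotient.out_eq C'))

theorem IsHierarchy.exists_type {e₀ : E} {H : Finset (Finset E)} (hH : IsHierarchy e₀ H) :
    ∃ C : CombType E, hier C.tree e₀ = H :=
  ⟨Quotient.mk _ hH.tree, (hier_tree_mk _ _).trans hH.hier_tree⟩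

theorem sum_trivalent_eq_sum_binaries [Fintype (CombType E)] (e₀ : E) {G : Type*} [AddCommMonoid G]
    (g : Finset (Finset E) → G) :
    ∑ C ∈ univ.filter (fun C : CombType E => C.tree.Trivalent), g (hier C.tree e₀) =
      ∑ H ∈ binaries e₀, g H := by
  refine Finset.sum_bij (fun C _ => hier C.tree e₀) (fun C hC => ?_) (fun C _ C' _ h =>
    combType_ext h) (fun H hH => ?_) fun _ _ => rfl
  · exact mem_binaries.2 ⟨isHierarchy_hier _ _, (trivalent_iff_isBinary _ _).1 (mem_filter.1 hC).2⟩
  · obtain ⟨h1, h2⟩ := mem_binaries.1 hH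
    obtain ⟨C, rfl⟩ := h1.exists_type
    exact ⟨C, mem_filter.2 ⟨mem_univ _, (trivalent_iff_isBinary _ _).2 h2⟩, rfl⟩

end Types

/-! ### Invariance of the count -/

section Count

variable {E : Type*} [Fintype E] {N : Type*} [AddCommGroup N] [Module.Free ℤ N] [Module.Finite ℤ N]
  {ι : Type*} [Fintype ι] {n : E → N} {s s' : ι → E} {φ φ' : ι → Module.Dual ℝ (RealSpace N)}
  {e₀ : E} {ω : LinearMap.BilinForm ℝ (RealSpace N)}

/-- The number of trivalent curves satisfying the constraints `x`, counted with signed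
multiplicities. -/
def signedCount [Fintype (CombType E)] (n : E → N) (e₀ : E) (s : ι → E)
    (φ : ι → Module.Dual ℝ (RealSpace N)) (s' : ι → E) (φ' : ι → Module.Dual ℝ (RealSpace N))
    (ω : LinearMap.BilinForm ℝ (RealSpace N)) (x : E → RealSpace N) : RefinedRing n ω :=
  ∑ C ∈ univ.filter (fun C : CombType E => C.tree.Trivalent),
    if MeetsCone n s φ (inner e₀ (hier C.tree e₀)) x then
      signedMult n e₀ s φ s' φ' ω C.tree else 0

/-- The constraints `x` avoid the hyperplanes spanned by the walls of the cones on which the problem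
`(s', φ')` is invertible. -/
def Transverse (n : E → N) (e₀ : E) (s : ι → E) (φ : ι → Module.Dual ℝ (RealSpace N)) (s' : ι → E)
    (φ' : ι → Module.Dual ℝ (RealSpace N)) (x : E → RealSpace N) : Prop :=
  ∀ T : LabelledTree E, T.Trivalent → evalDet T n e₀ s' φ' ≠ 0 → ∀ A ∈ inner e₀ (hier T e₀),
    edgeCoord n s φ (inner e₀ (hier T e₀)) A x ≠ 0

instance isAddTorsionFree_refinedRing : IsAddTorsionFree (RefinedRing n ω) :=
  Function.Injective.isAddTorsionFree (AddMonoidAlgebra.coeffAddEquiv (R := ℤ)).toAddMonoidHom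
    AddMonoidAlgebra.coeffAddEquiv.injective

/-- The count is the same at the extremities of a segment that never meets two walls of a cone at
once: it changes by the sum of all crossings, which vanishes. -/
theorem signedCount_eq_of_segment [Fintype (CombType E)] (hsum : ∑ e, n e = 0) (hω : ω.IsAlt)
    (hφ' : ∀ i, φ' i (toReal (n (s' i))) = 0) (hE : 3 ≤ Fintype.card E)
    (hι : Fintype.card ι + 3 = Fintype.card E + Module.finrank ℤ N) {C : ℝ}
    (hdet : ∀ T : LabelledTree E, T.Trivalent → |evalDet T n e₀ s' φ'| =
        C * ∏ A ∈ nodes e₀ (hier T e₀), childTerm (hier T e₀)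
          (fun B C => |ω (toReal (slopeSum n B)) (toReal (slopeSum n C))|) A)
    (h0 : ∀ T : LabelledTree E, T.Trivalent → evalDet T n e₀ s' φ' ≠ 0 → evalDet T n e₀ s φ ≠ 0)
    {x y : E → RealSpace N} (hx : Transverse n e₀ s φ s' φ' x) (hy : Transverse n e₀ s φ s' φ' y)
    (hcom : ∀ T : LabelledTree E, T.Trivalent → evalDet T n e₀ s' φ' ≠ 0 →
      ∀ A ∈ inner e₀ (hier T e₀), ∀ B ∈ inner e₀ (hier T e₀), A ≠ B →
      edgeCoord n s φ (inner e₀ (hier T e₀)) A x * edgeCoord n s φ (inner e₀ (hier T e₀)) B y -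
      edgeCoord n s φ (inner e₀ (hier T e₀)) B x * edgeCoord n s φ (inner e₀ (hier T e₀)) A y ≠ 0) :
    signedCount n e₀ s φ s' φ' ω x = signedCount n e₀ s φ s' φ' ω y := by
  obtain ⟨v, rfl⟩ : ∃ v, y = x + v := ⟨y - x, by abel⟩
  rw [eq_comm, ← sub_eq_zero, signedCount, signedCount, ← Finset.sum_sub_distrib]
  refine Eq.trans (Finset.sum_congr rfl fun C hC => ?_)
    ((sum_trivalent_eq_sum_binaries e₀ fun H =>
      ∑ A ∈ inner e₀ H, crossing n e₀ s φ s' φ' ω x v H A).trans (sum_inner_eq_zero _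
        fun H A₁ A₂ A₃ F => F.sum_crossing hsum hω hφ' hE hι hdet x v))
  have hT := (mem_filter.1 hC).2
  refine indicator_sub_eq_sum_crossing hE hι hT (h0 _ hT) (hx _ hT) (hy _ hT)
    fun h A hA B hB hne t hAt hBt => hcom _ hT h A hA B hB hne ?_
  simp only [map_add, map_smul, smul_eq_mul] at hAt hBt ⊢
  set I := inner e₀ (hier (CombType.tree C) e₀)
  -- the point at time `t` is the barycentre of the extremities with weights `1 - t` and `t`
  by_cases ht : t = 0
  · subst ht
    simp only [zero_mul, add_zero] at hAt hBt
    rw [hAt, hBt]; ring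
  · refine mul_left_cancel₀ ht ?_
    linear_combination edgeCoord n s φ I A x * hBt - edgeCoord n s φ I B x * hAt

/-- Finitely many non-zero linear forms are simultaneously non-zero somewhere. -/
theorem exists_transverse [Finite (LabelledTree E)] (hE : 3 ≤ Fintype.card E)
    (hι : Fintype.card ι + 3 = Fintype.card E + Module.finrank ℤ N)
    (h0 : ∀ T : LabelledTree E, T.Trivalent → evalDet T n e₀ s' φ' ≠ 0 → evalDet T n e₀ s φ ≠ 0) :
    ∃ x, Transverse n e₀ s φ s' φ' x := by
  let J := {p : LabelledTree E × Finset E // p.1.Trivalent ∧ evalDet p.1 n e₀ s' φ' ≠ 0 ∧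
    p.2 ∈ inner e₀ (hier p.1 e₀)}
  obtain ⟨x, hx⟩ := Module.Dual.exists_forall_ne_zero_of_forall_exists
    (fun p : J => edgeCoord n s φ (inner e₀ (hier p.1.1 e₀)) p.1.2) fun p =>
      ⟨clusterVec n p.1.2, by
        obtain ⟨h1, h2, h3⟩ := p.2
        rw [edgeCoord_clusterVec (wallDet_ne_zero hE hι h1 (h0 _ h1 h2) h3) h3, if_pos rfl]
        exact one_ne_zero⟩
  exact ⟨x, fun T h1 h2 A hA => hx ⟨(T, A), h1, h2, hA⟩⟩

/-- The count does not depend on the constraints: two of them are joined through third ones, by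
segments that meet no intersection of two hyperplanes spanned by walls of a cone. -/
theorem signedCount_eq_of_transverse [Fintype (CombType E)] [Finite (LabelledTree E)]
    (hsum : ∑ e, n e = 0) (hω : ω.IsAlt)
    (hφ' : ∀ i, φ' i (toReal (n (s' i))) = 0) (hE : 3 ≤ Fintype.card E)
    (hι : Fintype.card ι + 3 = Fintype.card E + Module.finrank ℤ N) {C : ℝ}
    (hdet : ∀ T : LabelledTree E, T.Trivalent → |evalDet T n e₀ s' φ'| =
        C * ∏ A ∈ nodes e₀ (hier T e₀), childTerm (hier T e₀)
          (fun B C => |ω (toReal (slopeSum n B)) (toReal (slopeSum n C))|) A)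
    (h0 : ∀ T : LabelledTree E, T.Trivalent → evalDet T n e₀ s' φ' ≠ 0 → evalDet T n e₀ s φ ≠ 0)
    {x y : E → RealSpace N} (hx : Transverse n e₀ s φ s' φ' x)
    (hy : Transverse n e₀ s φ s' φ' y) :
    signedCount n e₀ s φ s' φ' ω x = signedCount n e₀ s φ s' φ' ω y := by
  let J := {p : LabelledTree E × Finset E // p.1.Trivalent ∧ evalDet p.1 n e₀ s' φ' ≠ 0 ∧
    p.2 ∈ inner e₀ (hier p.1 e₀)}
  let c : LabelledTree E → Finset E → (E → RealSpace N) →ₗ[ℝ] ℝ := fun T A =>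
    edgeCoord n s φ (inner e₀ (hier T e₀)) A
  have hc : ∀ p : J, ∀ B ∈ inner e₀ (hier p.1.1 e₀),
      c p.1.1 p.1.2 (clusterVec n B) = if p.1.2 = B then 1 else 0 := fun p B hB => by
    obtain ⟨h1, h2, h3⟩ := p.2
    exact edgeCoord_clusterVec (wallDet_ne_zero hE hι h1 (h0 _ h1 h2) h3) hB
  let J' := {p : J × Finset E // p.2 ∈ inner e₀ (hier p.1.1.1 e₀) ∧ p.1.1.2 ≠ p.2}
  -- the determinant of two coordinates at `z` and `w` is a non-zero linear form of `w`
  have hc' : ∀ z, Transverse n e₀ s φ s' φ' z → ∀ p : J', ∃ w,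
      (c p.1.1.1.1 p.1.1.1.2 z • c p.1.1.1.1 p.1.2 -
        c p.1.1.1.1 p.1.2 z • c p.1.1.1.1 p.1.1.1.2) w ≠ 0 := by
    rintro z hz ⟨⟨⟨⟨T, A⟩, h1, h2, h3⟩, B⟩, h4, h5⟩
    refine ⟨clusterVec n B, ?_⟩
    have e1 := hc ⟨(T, A), h1, h2, h3⟩ B h4
    have e2 := hc ⟨(T, B), h1, h2, h4⟩ B h4
    simp only [if_true, if_neg h5] at e1 e2
    simp only [LinearMap.sub_apply, LinearMap.smul_apply, e1, e2, mul_zero, sub_zero,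
      smul_eq_mul, mul_one]
    exact hz T h1 h2 A h3
  obtain ⟨z, hz⟩ := Module.Dual.exists_forall_ne_zero_of_forall_exists
    (Sum.elim (fun p : J => c p.1.1 p.1.2) (Sum.elim
      (fun p : J' => c p.1.1.1.1 p.1.1.1.2 x • c p.1.1.1.1 p.1.2 -
        c p.1.1.1.1 p.1.2 x • c p.1.1.1.1 p.1.1.1.2)
      (fun p : J' => c p.1.1.1.1 p.1.1.1.2 y • c p.1.1.1.1 p.1.2 -
        c p.1.1.1.1 p.1.2 y • c p.1.1.1.1 p.1.1.1.2))) (by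
      rintro (p | p | p)
      · exact ⟨clusterVec n p.1.2, by simp [hc p _ p.2.2.2]⟩
      · exact hc' x hx p
      · exact hc' y hy p)
  have hz1 : Transverse n e₀ s φ s' φ' z := fun T h1 h2 A hA =>
    hz (Sum.inl ⟨(T, A), h1, h2, hA⟩)
  rw [signedCount_eq_of_segment hsum hω hφ' hE hι hdet h0 hx hz1 fun T h1 h2 A hA B hB hne =>
      hz (Sum.inr (Sum.inl ⟨(⟨(T, A), h1, h2, hA⟩, B), hB, hne⟩)),
    signedCount_eq_of_segment hsum hω hφ' hE hι hdet h0 hy hz1 fun T h1 h2 A hA B hB hne =>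
      hz (Sum.inr (Sum.inr ⟨(⟨(T, A), h1, h2, hA⟩, B), hB, hne⟩))]

/-- Constraints which are not satisfied by curves with a vertex of higher valency do not lie on the
boundary of a cone: otherwise the edges of length zero can be contracted. -/
theorem not_boundary (hE : 3 ≤ Fintype.card E)
    (hι : Fintype.card ι + 3 = Fintype.card E + Module.finrank ℤ N) {x : E → RealSpace N}
    (hx : ∀ C : CombType E, MeetsCone n s φ (inner e₀ (hier C.tree e₀)) x → C.tree.Trivalent)
    {T : LabelledTree E} (hT : T.Trivalent) (h0 : evalDet T n e₀ s φ ≠ 0)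
    (hle : ∀ A ∈ inner e₀ (hier T e₀), 0 ≤ edgeCoord n s φ (inner e₀ (hier T e₀)) A x)
    {A : Finset E} (hA : A ∈ inner e₀ (hier T e₀)) :
    edgeCoord n s φ (inner e₀ (hier T e₀)) A x ≠ 0 := by
  intro hA0
  have hH := isHierarchy_hier T e₀
  obtain ⟨c, b, hcb⟩ := exists_coneVec_eq h0 x
  set H := hier T e₀ with hHd
  have hc : ∀ B ∈ inner e₀ H, edgeCoord n s φ (inner e₀ H) B x = c B := fun B hB =>
    edgeCoord_eq hB (wallDet_ne_zero hE hι hT h0 hB) hcb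
  -- the type obtained by contracting the edges of length zero
  let K := H.filter fun B => B ∈ inner e₀ H → c B ≠ 0
  have hKH : K ⊆ H := filter_subset _ _
  have hmem : ∀ B, B ∈ K ↔ B ∈ H ∧ (B ∈ inner e₀ H → c B ≠ 0) := fun B => by
    simp only [K, mem_filter]
  have hK : IsHierarchy e₀ K := by
    refine hH.of_subset hKH ((hmem _).2 ⟨hH.univ_mem, fun h => ?_⟩)
      ((hmem _).2 ⟨hH.top_mem, fun h => ?_⟩) fun e he => (hmem _).2 ⟨hH.singleton_mem e he,
        fun h => ?_⟩
    · exact absurd (mem_univ e₀) (mem_filter.1 (mem_of_mem_erase h)).2.1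
    · exact absurd rfl (mem_erase.1 h).1
    · have := (mem_filter.1 (mem_of_mem_erase h)).2.2
      rw [card_singleton] at this
      omega
  have hnK : nodes e₀ K ⊆ nodes e₀ H := filter_subset_filter _ hKH
  have hiK : inner e₀ K ⊆ inner e₀ H := erase_subset_erase _ hnK
  obtain ⟨C, hC⟩ := hK.exists_type
  have hmeet : MeetsCone n s φ (inner e₀ (hier C.tree e₀)) x := by
    rw [hC]
    refine ⟨c, b, fun B hB => ?_, ?_⟩
    · have h1 := hiK hB
      have h2 := ((hmem B).1 (mem_filter.1 (mem_of_mem_erase hB)).1).2 h1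
      exact lt_of_le_of_ne (hc B h1 ▸ hle B h1) h2.symm
    · rw [coneVec_of_eq_zero hiK fun B hB hB' => ?_, hcb]
      by_contra hne
      obtain ⟨h1, h2⟩ := mem_erase.1 hB
      obtain ⟨h3, h4, h5⟩ := mem_filter.1 h2
      exact hB' (mem_erase.2 ⟨h1, mem_filter.2 ⟨(hmem B).2 ⟨h3, fun _ => hne⟩, h4, h5⟩⟩)
  have hk := (trivalent_iff_k _ e₀).1 (hx C hmeet)
  have hk' := (trivalent_iff_k _ e₀).1 hT
  have hn : (nodes e₀ K).card = C.tree.k := by rw [← hC, card_nodes]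
  have hn' : (nodes e₀ H).card = T.k := card_nodes T e₀
  have hlt : (nodes e₀ K).card < (nodes e₀ H).card := by
    refine card_lt_card ⟨hnK, fun h => ?_⟩
    have := ((hmem A).1 (mem_filter.1 (h (mem_of_mem_erase hA))).1).2 hA
    exact this (by rw [← hc A hA, hA0])
  omega

/-- Constraints lying on no boundary of a cone can be moved to transverse ones without changing the
count. -/
theorem exists_transverse_signedCount_eq [Fintype (CombType E)] [Finite (LabelledTree E)]
    (hE : 3 ≤ Fintype.card E)
    (hι : Fintype.card ι + 3 = Fintype.card E + Module.finrank ℤ N)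
    (h0 : ∀ T : LabelledTree E, T.Trivalent → evalDet T n e₀ s' φ' ≠ 0 → evalDet T n e₀ s φ ≠ 0)
    {x : E → RealSpace N}
    (hx : ∀ C : CombType E, MeetsCone n s φ (inner e₀ (hier C.tree e₀)) x → C.tree.Trivalent) :
    ∃ y, Transverse n e₀ s φ s' φ' y ∧
      signedCount n e₀ s φ s' φ' ω y = signedCount n e₀ s φ s' φ' ω x := by
  obtain ⟨v, hv⟩ := exists_transverse (s := s) (φ := φ) hE hι h0
  have hlim : ∀ a b : ℝ, Filter.Tendsto (fun ε : ℝ => a + ε * b) (𝓝[>] 0) (𝓝 a) := fun a b => by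
    have : Filter.Tendsto (fun ε : ℝ => a + ε * b) (𝓝 0) (𝓝 (a + 0 * b)) :=
      Continuous.tendsto (by fun_prop) 0
    rw [zero_mul, add_zero] at this
    exact this.mono_left nhdsWithin_le_nhds
  have hexp : ∀ (T : LabelledTree E) A (ε : ℝ),
      edgeCoord n s φ (inner e₀ (hier T e₀)) A (x + ε • v) =
        edgeCoord n s φ (inner e₀ (hier T e₀)) A x +
          ε * edgeCoord n s φ (inner e₀ (hier T e₀)) A v := fun T A ε => by
    rw [map_add, map_smul, smul_eq_mul]
  -- `x + ε v` is transverse and lies in the same cones as `x` for small `ε > 0`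
  have h1 : ∀ᶠ ε : ℝ in 𝓝[>] 0, ∀ p : LabelledTree E × Finset E, p.1.Trivalent →
      evalDet p.1 n e₀ s' φ' ≠ 0 → p.2 ∈ inner e₀ (hier p.1 e₀) →
      edgeCoord n s φ (inner e₀ (hier p.1 e₀)) p.2 (x + ε • v) ≠ 0 := by
    rw [Filter.eventually_all]
    rintro ⟨T, A⟩
    by_cases hc : T.Trivalent ∧ evalDet T n e₀ s' φ' ≠ 0 ∧ A ∈ inner e₀ (hier T e₀)
    · obtain ⟨c1, c2, c3⟩ := hc
      by_cases hz : edgeCoord n s φ (inner e₀ (hier T e₀)) A x = 0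
      · filter_upwards [self_mem_nhdsWithin] with ε hε _ _ _
        rw [hexp, hz, zero_add]
        exact mul_ne_zero (ne_of_gt hε) (hv T c1 c2 A c3)
      · filter_upwards [(hlim _ (edgeCoord n s φ (inner e₀ (hier T e₀)) A v)).eventually_ne hz]
          with ε hε _ _ _
        rwa [hexp]
    · exact Filter.Eventually.of_forall fun ε c1 c2 c3 => absurd ⟨c1, c2, c3⟩ hc
  have h2 : ∀ᶠ ε : ℝ in 𝓝[>] 0, ∀ T : LabelledTree E, T.Trivalent → evalDet T n e₀ s' φ' ≠ 0 →
      (MeetsCone n s φ (inner e₀ (hier T e₀)) (x + ε • v) ↔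
        MeetsCone n s φ (inner e₀ (hier T e₀)) x) := by
    rw [Filter.eventually_all]
    intro T
    by_cases hc : T.Trivalent ∧ evalDet T n e₀ s' φ' ≠ 0
    · obtain ⟨c1, c2⟩ := hc
      simp only [meetsCone_iff hE hι c1 (h0 T c1 c2)]
      by_cases hpos : ∀ A ∈ inner e₀ (hier T e₀),
          0 < edgeCoord n s φ (inner e₀ (hier T e₀)) A x
      · have : ∀ᶠ ε : ℝ in 𝓝[>] 0, ∀ A ∈ inner e₀ (hier T e₀),
            0 < edgeCoord n s φ (inner e₀ (hier T e₀)) A (x + ε • v) := by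
          rw [Filter.eventually_all_finset]
          intro A hA
          simp only [hexp]
          exact (hlim _ _).eventually_const_lt (hpos A hA)
        filter_upwards [this] with ε hε _ _
        exact ⟨fun _ => hpos, fun _ => hε⟩
      · have : ∃ A ∈ inner e₀ (hier T e₀), edgeCoord n s φ (inner e₀ (hier T e₀)) A x < 0 := by
          by_contra! hle
          exact hpos fun A hA => lt_of_le_of_ne (hle A hA)
            (not_boundary hE hι hx c1 (h0 T c1 c2) hle hA).symm
        obtain ⟨A, hA, hneg⟩ := this
        filter_upwards [(hlim _ (edgeCoord n s φ (inner e₀ (hier T e₀)) A v)).eventually_lt_const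
          hneg] with ε hε _ _
        rw [← hexp] at hε
        exact ⟨fun h => absurd (h A hA) hε.not_gt, fun h => absurd (h A hA) hneg.not_gt⟩
    · exact Filter.Eventually.of_forall fun ε c1 c2 => absurd ⟨c1, c2⟩ hc
  obtain ⟨ε, e1, e2⟩ := (h1.and h2).exists
  refine ⟨x + ε • v, fun T c1 c2 A hA => e1 (T, A) c1 c2 hA, ?_⟩
  refine Finset.sum_congr rfl fun C hC => ?_
  by_cases hd : evalDet C.tree n e₀ s' φ' = 0
  · simp [signedMult, hd]
  · simp only [e2 _ (mem_filter.1 hC).2 hd]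

end Count

/-! ### Solutions of the problem with slope constraints -/

section Solutions

variable {E : Type*} [Fintype E] {N : Type*} [AddCommGroup N] {n : E → N} {l : E → ℕ} {e₀ : E}

theorem mem_space_iff {L : Slopes n l} {e : E} {v : RealSpace N} :
    v ∈ L.space e ↔ ∀ i : Fin (l e), L.forms ⟨e, i⟩ v = 0 := by
  simp [Slopes.space, Slopes.forms]

/-- Only the values of the forms on the positions of the ends matter. -/
theorem mem_solutions_iff {L : Slopes n l} {x : E → RealSpace N} {Γ : Curve E N} :
    Γ ∈ solutions L e₀ x ↔ evalForms Sigma.fst L.forms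
      (endPositions Γ.type.tree n e₀ (Γ.len, Γ.base)) = evalForms Sigma.fst L.forms x := by
  rw [← sub_eq_zero, ← map_sub]
  constructor
  · intro h
    ext ⟨e, i⟩
    exact mem_space_iff.1 (h e) i
  · intro h e
    exact mem_space_iff.2 fun i => congrFun h ⟨e, i⟩

/-- A solution of type `C` is a family of positive lengths indexed by the clusters of its bounded
edges. -/
theorem meetsCone_iff_exists_solution {L : Slopes n l} {x : E → RealSpace N} (C : CombType E) :
    MeetsCone n Sigma.fst L.forms (inner e₀ (hier C.tree e₀)) x ↔
      ∃ Γ ∈ solutions L e₀ x, Γ.type = C := by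
  constructor
  · rintro ⟨c, b, hc, h⟩
    rw [← endPositions_eq_coneVec] at h
    exact ⟨⟨C, fun γ => c (cluster C.tree e₀ γ.1), fun γ => hc _ (cluster_mem_inner e₀ γ), b⟩,
      mem_solutions_iff.2 h, rfl⟩
  · rintro ⟨Γ, hΓ, rfl⟩
    obtain ⟨c, hc⟩ := exists_length_eq Γ.type.tree e₀ Γ.len
    have h := mem_solutions_iff.1 hΓ
    rw [← hc, endPositions_eq_coneVec] at h
    refine ⟨c, Γ.base, fun A hA => ?_, h⟩
    obtain ⟨γ, rfl⟩ := exists_cluster_eq hA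
    have := Γ.len_pos γ
    rwa [← hc] at this

theorem surjective_pi_of_linearIndependent {V : Type*} [AddCommGroup V] [Module ℝ V] {m : ℕ}
    {ψ : Fin m → Module.Dual ℝ V} (h : LinearIndependent ℝ ψ) :
    Function.Surjective (LinearMap.pi ψ) := by
  rw [← LinearMap.range_eq_top]
  by_contra hne
  obtain ⟨g, hg, hle⟩ := Submodule.exists_le_ker_of_lt_top _ (lt_top_iff_ne_top.2 hne)
  have hgc : ∀ y : Fin m → ℝ, g y = ∑ i, y i * g (Pi.single i 1) := fun y => by
    conv_lhs => rw [← (Pi.basisFun ℝ (Fin m)).sum_repr y, map_sum]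
    simp
  have hc := Fintype.linearIndependent_iff.1 h (fun i => g (Pi.single i 1)) (by
    ext v
    have h1 : g (LinearMap.pi ψ v) = 0 := hle ⟨v, rfl⟩
    rw [hgc] at h1
    simpa [mul_comm] using h1)
  refine hg (LinearMap.ext fun y => ?_)
  rw [hgc, LinearMap.zero_apply]
  exact Finset.sum_eq_zero fun i _ => by rw [hc i, mul_zero]

/-- As the forms of each `L_e` are independent, the values of the constraints are arbitrary. -/
theorem surjective_evalForms (L : Slopes n l) :
    Function.Surjective (evalForms Sigma.fst L.forms) := by
  intro y
  have h : ∀ e, LinearIndependent ℝ fun i => (L.form e i : Module.Dual ℝ (RealSpace N)) :=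
    fun e => (LinearMap.linearIndependent_iff_of_injOn (perp (n e)).subtype
      (perp (n e)).injective_subtype.injOn).2 (L.linearIndependent e)
  choose x hx using fun e => surjective_pi_of_linearIndependent (h e) fun i => y ⟨e, i⟩
  refine ⟨x, ?_⟩
  ext ⟨e, i⟩
  exact congrFun (hx e) i

variable [Module.Free ℤ N] [Module.Finite ℤ N]

/-- A cone that is not top-dimensional, or with vanishing determinant, has its image in a proper
subspace, and finitely many proper subspaces do not fill the space of constraints. -/
theorem exists_generic (hE : 3 ≤ Fintype.card E)
    (hl : (∑ e, l e) + 3 = Fintype.card E + Module.finrank ℤ N) (L : Slopes n l) (e₀ : E) :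
    ∃ x, Generic L e₀ x := by
  have : Nonempty E := ⟨e₀⟩
  have := finite_labelledTree (E := E)
  have hι : Fintype.card (Σ e : E, Fin (l e)) = ∑ e, l e := by simp
  let J := {T : LabelledTree E // ¬ (T.Trivalent ∧ complexMult T n e₀ Sigma.fst L.forms ≠ 0)}
  obtain ⟨y, hy⟩ := Submodule.exists_forall_notMem_of_forall_ne_top
    (fun T : J => LinearMap.range (composedEval T.1 n e₀ Sigma.fst L.forms)) fun T htop => by
      have hsurj := LinearMap.range_eq_top.1 htop
      have := finite_domain T.1 N
      have h1 := LinearMap.finrank_le_finrank_of_surjective hsurj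
      rw [finrank_domain, Module.finrank_fintype_fun_eq_card, hι] at h1
      have h2 := card_boundedEdge hE T.1
      have h3 := k_add_two_le T.1 e₀
      refine T.2 ⟨(trivalent_iff_k T.1 e₀).2 (by omega), abs_ne_zero.2
        (evalDet_ne_zero_of_surjective (Fintype.card_eq.1 ?_) hsurj)⟩
      rw [hι, Fintype.card_sum, Fintype.card_fin]
      omega
  obtain ⟨x, rfl⟩ := surjective_evalForms L y
  refine ⟨x, fun Γ hΓ => ?_⟩
  by_contra hne
  exact hy ⟨Γ.type.tree, hne⟩ ⟨(Γ.len, Γ.base), mem_solutions_iff.1 hΓ⟩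

/-- For generic constraints there is at most one curve of each type, and the refined count is a sum
over types. -/
theorem refinedCount_eq_signedCount [Fintype (CombType E)] (hsum : ∑ e, n e = 0) (L : Slopes n l)
    {ω : LinearMap.BilinForm ℝ (RealSpace N)} (hω : ω.IsAlt) {d : ℕ}
    (f : Fin d → Module.Dual ℝ (RealSpace N))
    (o : (Σ e : E, Fin (l e)) ≃ Fin d ⊕ {e : E // e ≠ e₀}) {x : E → RealSpace N}
    (hx : Generic L e₀ x) : refinedCount L ω e₀ f o x =
      signedCount n e₀ Sigma.fst L.forms (omegaEnd e₀ ∘ o) (omegaForm n ω e₀ f ∘ o) ω x := by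
  have hinj : Set.InjOn Curve.type (solutions L e₀ x) := by
    rintro ⟨C, len, hlen, b⟩ hΓ ⟨C', len', hlen', b'⟩ hΓ' (rfl : C = C')
    have hb := bijective_of_evalDet_ne_zero (abs_ne_zero.1 (hx _ hΓ).2)
    have h := hb.1 ((mem_solutions_iff.1 hΓ).trans (mem_solutions_iff.1 hΓ').symm)
    obtain ⟨rfl, rfl⟩ := Prod.mk.inj h
    rfl
  have himg : Curve.type '' solutions L e₀ x = ↑((univ.filter fun C : CombType E =>
      C.tree.Trivalent).filter fun C =>
        MeetsCone n Sigma.fst L.forms (inner e₀ (hier C.tree e₀)) x) := by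
    ext C
    simp only [coe_filter, mem_filter, mem_univ, true_and, Set.mem_ofPred_eq,
      meetsCone_iff_exists_solution, Set.mem_image]
    constructor
    · rintro ⟨Γ, hΓ, rfl⟩
      exact ⟨(hx Γ hΓ).1, Γ, hΓ, rfl⟩
    · exact fun h => h.2
  rw [refinedCount, ← finsum_mem_image (f := fun C : CombType E =>
    typeSign C.tree L ω e₀ f o • refinedMult C.tree n ω) hinj, himg, finsum_mem_coe_finset,
    Finset.sum_filter, signedCount]
  refine Finset.sum_congr rfl fun C hC => ?_
  rw [refinedMult_eq hsum hω (mem_filter.1 hC).2 e₀]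
  rfl

end Solutions

/-! ### Nearby slopes -/

section Nearby

variable {E : Type*} [Fintype E] {N : Type*} [AddCommGroup N] [Module.Free ℤ N] [Module.Finite ℤ N]
  {n : E → N} {l : E → ℕ} {e₀ : E}

/-- A function of slopes that is continuous in terms of the Plücker vectors. -/
def PluckerContinuous (q : Slopes n l → ℝ) : Prop :=
  ∃ F : PluckerSpace n l → ℝ, Continuous F ∧ ∀ L : Slopes n l, F L.plucker = q L

theorem pluckerContinuous_evalDet (T : LabelledTree E) (n : E → N) (l : E → ℕ) (e₀ : E) :
    PluckerContinuous fun L : Slopes n l => evalDet T n e₀ Sigma.fst L.forms := by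
  by_cases h : Nonempty ((Σ e : E, Fin (l e)) ≃ T.BoundedEdge ⊕ Fin (Module.finrank ℤ N))
  · obtain ⟨F, hF, hFL⟩ := exists_continuous_det (n := n) (l := l)
      fun j => edgeFamily T n e₀ (h.some j)
    refine ⟨F, hF, fun L => ?_⟩
    beta_reduce
    rw [hFL, evalDet_eq h, ← Matrix.det_transpose]
    congr!
  · refine ⟨fun _ => 0, continuous_const, fun L => ?_⟩
    beta_reduce
    rw [evalDet, dif_neg h]

theorem pluckerContinuous_wallDet (n : E → N) (l : E → ℕ) (W : Finset (Finset E))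
    (u : E → RealSpace N) :
    PluckerContinuous fun L : Slopes n l => wallDet n Sigma.fst L.forms W u := by
  by_cases h : Nonempty ((Σ e : E, Fin (l e)) ≃ Option (W ⊕ Fin (Module.finrank ℤ N)))
  · obtain ⟨F, hF, hFL⟩ := exists_continuous_det (n := n) (l := l)
      fun j => wallFamily n W u (h.some j)
    refine ⟨F, hF, fun L => ?_⟩
    beta_reduce
    rw [hFL, wallDet_apply _ _ _ h]
    congr!
  · refine ⟨fun _ => 0, continuous_const, fun L => ?_⟩
    beta_reduce
    rw [wallDet, dif_neg h]
    rfl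

/-- Continuous functions of the Plücker vectors keep their signs near slopes where they do not
vanish. -/
theorem PluckerContinuous.eventually_sign_eq {q : Slopes n l → ℝ} (hq : PluckerContinuous q)
    {L₀ : Slopes n l} (h0 : q L₀ ≠ 0) : ∀ᶠ p in 𝓝 L₀.plucker, ∀ L : Slopes n l, L.plucker = p →
      SignType.sign (q L) = SignType.sign (q L₀) := by
  obtain ⟨F, hF, hFL⟩ := hq
  rw [← hFL] at h0
  rcases lt_or_gt_of_ne h0 with h | h
  · filter_upwards [hF.continuousAt.eventually_lt_const h] with p hp L hL
    rw [← hFL, ← hFL, sign_neg h, sign_neg (hL ▸ hp)]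
  · filter_upwards [hF.continuousAt.eventually_const_lt h] with p hp L hL
    rw [← hFL, ← hFL, sign_pos h, sign_pos (hL ▸ hp)]

theorem sign_edgeCoord {ι : Type*} [Fintype ι] (s : ι → E)
    (φ : ι → Module.Dual ℝ (RealSpace N)) (I : Finset (Finset E)) (A : Finset E)
    (x : E → RealSpace N) : SignType.sign (edgeCoord n s φ I A x) =
      SignType.sign (wallDet n s φ (I.erase A) (clusterVec n A)) *
        SignType.sign (wallDet n s φ (I.erase A) x) := by
  rw [edgeCoord, LinearMap.smul_apply, smul_eq_mul, sign_mul]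
  congr 1
  rcases lt_trichotomy (wallDet n s φ (I.erase A) (clusterVec n A)) 0 with h | h | h
  · rw [sign_neg h, sign_neg (inv_lt_zero.2 h)]
  · rw [h, inv_zero]
  · rw [sign_pos h, sign_pos (inv_pos.2 h)]

/-- For transverse constraints, nothing changes when the slopes are moved a little. -/
theorem eventually_signedCount_eq [Fintype (CombType E)] (hE : 3 ≤ Fintype.card E)
    (hι : Fintype.card (Σ e : E, Fin (l e)) + 3 = Fintype.card E + Module.finrank ℤ N)
    (ω : LinearMap.BilinForm ℝ (RealSpace N)) (s' : (Σ e : E, Fin (l e)) → E)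
    (φ' : (Σ e : E, Fin (l e)) → Module.Dual ℝ (RealSpace N)) {L₀ : Slopes n l}
    (h0 : ∀ T : LabelledTree E, T.Trivalent → evalDet T n e₀ s' φ' ≠ 0 →
      evalDet T n e₀ Sigma.fst L₀.forms ≠ 0)
    {x : E → RealSpace N} (hx : Transverse n e₀ Sigma.fst L₀.forms s' φ' x) :
    ∀ᶠ p in 𝓝 L₀.plucker, ∀ L : Slopes n l, L.plucker = p →
      (∀ T : LabelledTree E, T.Trivalent → evalDet T n e₀ s' φ' ≠ 0 →
        evalDet T n e₀ Sigma.fst L.forms ≠ 0) ∧ Transverse n e₀ Sigma.fst L.forms s' φ' x ∧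
      signedCount n e₀ Sigma.fst L.forms s' φ' ω x =
        signedCount n e₀ Sigma.fst L₀.forms s' φ' ω x := by
  have : Nonempty E := ⟨e₀⟩
  have := finite_labelledTree (E := E)
  have h1 : ∀ᶠ p in 𝓝 L₀.plucker, ∀ T : LabelledTree E, T.Trivalent →
      evalDet T n e₀ s' φ' ≠ 0 → ∀ L : Slopes n l, L.plucker = p →
      SignType.sign (evalDet T n e₀ Sigma.fst L.forms) =
        SignType.sign (evalDet T n e₀ Sigma.fst L₀.forms) := by
    simp only [Filter.eventually_all]
    exact fun T c1 c2 => (pluckerContinuous_evalDet T n l e₀).eventually_sign_eq (h0 T c1 c2)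
  have h2 : ∀ᶠ p in 𝓝 L₀.plucker, ∀ T : LabelledTree E, T.Trivalent →
      evalDet T n e₀ s' φ' ≠ 0 → ∀ A : Finset E, A ∈ inner e₀ (hier T e₀) →
      ∀ L : Slopes n l, L.plucker = p →
      SignType.sign (edgeCoord n Sigma.fst L.forms (inner e₀ (hier T e₀)) A x) =
        SignType.sign (edgeCoord n Sigma.fst L₀.forms (inner e₀ (hier T e₀)) A x) := by
    simp only [Filter.eventually_all]
    intro T c1 c2 A hA
    have hne := hx T c1 c2 A hA
    rw [← sign_ne_zero, sign_edgeCoord] at hne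
    filter_upwards [(pluckerContinuous_wallDet n l _ _).eventually_sign_eq
        (sign_ne_zero.1 (left_ne_zero_of_mul hne)),
      (pluckerContinuous_wallDet n l _ _).eventually_sign_eq
        (sign_ne_zero.1 (right_ne_zero_of_mul hne))] with p e1 e2 L hL
    rw [sign_edgeCoord, sign_edgeCoord, e1 L hL, e2 L hL]
  filter_upwards [h1, h2] with p e1 e2 L hL
  have hL0 : ∀ T : LabelledTree E, T.Trivalent → evalDet T n e₀ s' φ' ≠ 0 →
      evalDet T n e₀ Sigma.fst L.forms ≠ 0 := fun T c1 c2 => by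
    rw [← sign_ne_zero, e1 T c1 c2 L hL, sign_ne_zero]
    exact h0 T c1 c2
  refine ⟨hL0, fun T c1 c2 A hA => ?_, Finset.sum_congr rfl fun C hC => ?_⟩
  · rw [← sign_ne_zero, e2 T c1 c2 A hA L hL, sign_ne_zero]
    exact hx T c1 c2 A hA
  · have c1 := (mem_filter.1 hC).2
    by_cases c2 : evalDet C.tree n e₀ s' φ' = 0
    · simp [signedMult, c2]
    · have hs : signedMult n e₀ Sigma.fst L.forms s' φ' ω C.tree =
          signedMult n e₀ Sigma.fst L₀.forms s' φ' ω C.tree := by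
        rw [signedMult, signedMult, sign_mul, sign_mul, e1 _ c1 c2 L hL]
      rw [hs]
      congr 1
      rw [meetsCone_iff hE hι c1 (hL0 _ c1 c2), meetsCone_iff hE hι c1 (h0 _ c1 c2)]
      refine propext (forall₂_congr fun A hA => ?_)
      rw [← sign_eq_one_iff, ← sign_eq_one_iff, e2 _ c1 c2 A hA L hL]

end Nearby

end

end Tropical53

theorem theorem5p3 {E : Type*} [Fintype E] {N : Type*} [AddCommGroup N] [Module.Free ℤ N]
    [Module.Finite ℤ N]
    -- the lattice `N` and the degree `n`
    (hr : 2 ≤ Module.finrank ℤ N) (hE : 3 ≤ Fintype.card E)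
    (n : E → N) (hn : ∀ e, n e ≠ 0) (hsum : ∑ e, n e = 0)
    -- the slope constraints
    (l : E → ℕ) (hl : (∑ e, l e) + 3 = Fintype.card E + Module.finrank ℤ N)
    (L₀ : Tropical53.Slopes n l)
    -- the 2-form, and the `ω`-problem
    (ω : LinearMap.BilinForm ℝ (Tropical53.RealSpace N)) (hω : ω.IsAlt) (e₀ : E) (δ : N)
    (hδ : ω (Tropical53.toReal (n e₀)) ≠ 0 →
      ω (Tropical53.toReal (n e₀)) (Tropical53.toReal δ) ≠ 0)
    (f : Fin (Module.finrank ℤ N - 2) → Module.Dual ℝ (Tropical53.RealSpace N))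
    (hf : LinearIndependent ℝ f)
    (hf₀ : ∀ i, f i (Tropical53.toReal (n e₀)) = 0 ∧ f i (Tropical53.toReal δ) = 0)
    -- orientations of the codomains of the two composed evaluation maps
    (o : (Σ e : E, Fin (l e)) ≃ Fin (Module.finrank ℤ N - 2) ⊕ {e : E // e ≠ e₀})
    (hcond : Tropical53.ZeroMultHyp L₀ ω e₀ f) :
    ∃ U ∈ nhds L₀.plucker, ∃ β : Tropical53.RefinedRing n ω,
      ∀ L : Tropical53.Slopes n l, L.plucker ∈ U →
        Tropical53.ZeroMultHyp L ω e₀ f ∧ Tropical53.IsRefinedInvariant L ω e₀ f o β := by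
  classical
  open Tropical53 in
  have : Nonempty E := ⟨e₀⟩
  have := finite_labelledTree (E := E)
  have := finite_combType (E := E)
  let _ : Fintype (CombType E) := Fintype.ofFinite _
  have hι : Fintype.card (Σ e : E, Fin (l e)) + 3 = Fintype.card E + Module.finrank ℤ N := by
    rw [← hl]; simp
  let s' := omegaEnd e₀ ∘ o
  let φ' := omegaForm n ω e₀ f ∘ o
  have hφ' : ∀ i, φ' i (toReal (n (s' i))) = 0 := by
    intro i
    simp only [φ', s', Function.comp_apply]
    rcases o i with j | e
    · exact (hf₀ j).1
    · exact hω _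
  -- the zero-multiplicity hypothesis in terms of determinants
  have hzero : ∀ L : Slopes n l, ZeroMultHyp L ω e₀ f ↔ ∀ T : LabelledTree E, T.Trivalent →
      evalDet T n e₀ s' φ' ≠ 0 → evalDet T n e₀ Sigma.fst L.forms ≠ 0 := by
    intro L
    refine forall₂_congr fun T _ => ?_
    rw [← not_imp_not, complexMult, complexMult, abs_eq_zero, ← ne_eq, ← ne_eq,
      ← abs_ne_zero (a := evalDet T n e₀ s' φ'), abs_evalDet_comp_equiv, abs_ne_zero, abs_ne_zero]
  obtain ⟨c, hc⟩ := exists_abs_evalDet_omega (Nat.sub_add_cancel hr) hE n hsum hω e₀ δ hδ hf hf₀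
  have hdet : ∀ T : LabelledTree E, T.Trivalent → |evalDet T n e₀ s' φ'| =
      c * ∏ A ∈ nodes e₀ (hier T e₀), childTerm (hier T e₀)
        (fun B C => |ω (toReal (slopeSum n B)) (toReal (slopeSum n C))|) A := fun T hT => by
    rw [← hc T hT]
    exact abs_evalDet_comp_equiv T n e₀ _ _ o
  have h0 := (hzero L₀).1 hcond
  -- constraints fixed once and for all, transverse for `L₀` and for all nearby slopes
  obtain ⟨x₀, hx₀⟩ := exists_transverse hE hι h0
  refine ⟨_, eventually_signedCount_eq hE hι ω s' φ' h0 hx₀,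
    signedCount n e₀ Sigma.fst L₀.forms s' φ' ω x₀, fun L hL => ?_⟩
  obtain ⟨hL0, hLx, hLc⟩ := hL L rfl
  refine ⟨(hzero L).2 hL0, exists_generic hE hl L e₀, fun x hx => ?_⟩
  obtain ⟨y, hy, hyx⟩ := exists_transverse_signedCount_eq (ω := ω) hE hι hL0 (x := x) fun C hC => by
    obtain ⟨Γ, hΓ, rfl⟩ := (meetsCone_iff_exists_solution C).1 hC
    exact (hx Γ hΓ).1
  rw [refinedCount_eq_signedCount hsum L hω f o hx, ← hyx,
    signedCount_eq_of_transverse hsum hω hφ' hE hι hdet hL0 hy hLx, hLc]
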